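/- **Language and semantics.** $\mathbf{GDST}$ is the two-sorted language (set variables and ordinal variables) generated by: (1) atomic formulas $x\in y$, $x=y$, $x\downarrow$ for set or ordinal terms $x,y$ (sorts may be mixed; ordinals are identified with von Neumann ordinals); (2) $\wedge,\vee,\neg$; (3) bounded quantifiers $\forall x\in X$, $\exists x\in X$ ($X$ a set term) and $\forall\alpha<A$, $\exists\alpha<A$ ($A$ an ordinal term); (4) set terms $\{x\in X: P(x)\}$; (5) set terms $L_A$; (6) ordinal terms $\min\{\alpha:P(\alpha)\}$. For an ordinal $\eta$ and parameters $\mathbf x\in L_\eta^M\times\eta^N$, formulas, ordinal terms and set terms receive values $\iota_\eta(P[\mathbf x])\in\{\top,\bot,U\}$, $j_\eta(A[\mathbf x])\in\eta\cup\{U\}$, $j'_\eta(X[\mathbf x])\in L_\eta\cup\{U\}$ ($U$ = undefined) by recursion. An atomic formula with an undefined constituent is $U$; otherwise it has its usual truth value, and $x\downarrow$ is $\top$. A bounded universal quantifier is $U$ if its bound is $U$, otherwise $\bot$ if some instance is $\bot$, otherwise $U$ if some instance is $U$, otherwise $\top$; existential quantifiers are dual; $\wedge,\vee,\neg$ are treated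 in the same way (strong Kleene). $L_A$ has the value $L_{j_\eta(A)}$. $\{x\in X:P(x)\}$ has the value $\{x\in j'_\eta(X):\iota_\eta(P,x)=\top\}$ if $j_\eta'(X)\ne U$, no $\iota_\eta(P,x)$ with $x\in j'_\eta(X)$ is $U$ and this set belongs to $L_\eta$, and $U$ otherwise. $\min\{\alpha:P(\alpha)\}$ has the value $\alpha<\eta$ iff $\iota_\eta(P,\alpha)=\top$ and $\iota_\eta(P,\beta)=\bot$ for all $\beta<\alpha$; if there is no such $\alpha$, its value is $U$. **Reflection.** For a set $z$ and an ordinal $\eta$, let $f_z(\eta)$ be the least ordinal not of the form $j_\eta(A[\mathbf w])$ with $A$ an ordinal term of $\mathbf{GDST}$ and $\mathbf w$ a finite tuple from $z$ (as set parameters in $L_\eta$). An ordinal $\eta$ is *$k$-fold reflecting* if there are $\eta=\eta_0<\dots<\eta_k$ with $f_{\eta_i}(\eta_{i+1})=\eta_i$ for all $i<k$. **$\mathbf{NMID}$.** For a set term $T_{\mathbf x}(w)$ with a distinguished set variable $w$, a set term $W$ and an ordinal term $A$ let $T_{\mathbf x}^{A}(W)$ be the $\mathbf{GDST}$ term denoting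 $\{n\in L_\zeta : n\in h(A)\text{ for some compatible }h\in L_\zeta\text{ with }A\in\operatorname{dom} h\}$, where $\zeta$ is least such that $L_\zeta$ contains a compatible $h$ with $A\in\operatorname{dom}h$; here $h$ is *compatible* if it maps an ordinal to subsets of $\mathbb N$, $h(0)=W$, $h(\beta+1)=T_{\mathbf x}(h(\beta))$, and $h(\beta)=\bigcup_{\gamma<\beta}h(\gamma)$ for limit $\beta$. Let $T_{\mathbf x}^\infty(W)=T_{\mathbf x}^{\min\{\alpha:\,T_{\mathbf x}^{\alpha+1}(W)=T_{\mathbf x}^{\alpha}(W)\}}(W)$. $\mathbf{NMID}\subseteq\mathbf{GDST}$ is the sublanguage generated by (1)–(5) and (6b): if $T_{\mathbf x}(w)$ and $W$ are set terms of $\mathbf{NMID}$, so is $T_{\mathbf x}^\infty(W)$. A formula or term $E$ of $\mathbf{NMID}$ with parameters $\mathbf x$ is *regular at $\eta$* if for every occurrence of a term $T^\infty_{\mathbf y}(W)$ in $E$ and all values of bound variables in the ranges of their quantifiers and separation terms (as evaluated at $\eta$; inside an operator term $T(w)$ the variable $w$ ranges over $L_\eta\cap\mathcal P(\mathbb N)$):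 the value of $W$ at $\eta$, if defined, is a subset of $\mathbb N$; and for each $w\in L_\eta\cap\mathcal P(\mathbb N)$ the value $v=j'_\eta(T_{[\mathbf y]}[w])$, if defined, satisfies $w\subseteq v\subseteq\mathbb N$. **Corollary.** Let $\Lambda$ be the class of all ordinals or, more generally, any nonempty initial segment of it. Suppose that for all $k\in\mathbb N$ and $\alpha\in\Lambda$ there is a $k$-fold reflecting ordinal $\eta>\alpha$, with witnesses $\eta_0,\dots,\eta_k\in\Lambda$. Let $P$, $A$, $X$ be a formula, an ordinal term and a set term of $\mathbf{NMID}$ with $M$ free set variables and $N$ free ordinal variables, and let $\mathbf x=(x_1,\dots,x_M,\xi_1,\dots,\xi_N)$ with $x_i\in\bigcup_{\beta\in\Lambda}L_\beta$ and $\xi_j\in\Lambda$. Suppose that $P$, $A$, $X$ with the parameters $\mathbf x$ are regular at all $\eta\in\Lambda$ with $\mathbf x\in L_\eta^M\times\eta^N$. Then there exists $\eta\in\Lambda$ with $\mathbf x\in L_\eta^M\times\eta^N$ such that $\iota_\eta(P[\mathbf x])\neq U$, $j_\eta(A[\mathbf x])\neq U$ and $j'_\eta(X[\mathbf x])\neq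 U$. -/

import Mathlib

universe u

namespace GDST

/-! ## The constructible hierarchy -/

/-- The first-order language of set theory: one binary relation symbol. -/
inductive MemRel : ℕ → Type
  | mem : MemRel 2

/-- The first-order language of set theory `ST`. -/
def stLang : FirstOrder.Language := ⟨fun _ => Empty, MemRel⟩

/-- A set `a` regarded as the structure `(a, ∈)`. -/
instance stStructure (a : ZFSet.{u}) : stLang.Structure {y : ZFSet.{u} // y ∈ a} where
  funMap f _ := nomatch f
  RelMap | .mem => fun v => (v 0).1 ∈ (v 1).1

/-- `Def(a)`: the subsets of `a` that are first-order definable with parameters over `(a, ∈)`. -/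
noncomputable def defPow (a : ZFSet.{u}) : ZFSet.{u} :=
  ZFSet.sep
    (fun b => (Set.univ : Set {y : ZFSet.{u} // y ∈ a}).Definable₁ stLang {y | y.1 ∈ b})
    a.powerset

/-- The stages of the constructible universe: `L_α = ⋃_{β < α} Def(L_β)`, i.e. `L_0 = ∅`,
`L_{α+1} = Def(L_α)` and unions at limits. -/
noncomputable def Lset (α : Ordinal.{u}) : ZFSet.{u} :=
  ZFSet.iUnion fun β : Set.Iio α => defPow (Lset β.1)
termination_by α
decreasing_by exact β.2

/-! ## Syntax of GDST -/

/-- The two sorts. -/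
inductive Srt
  | ord
  | set

/-- Expressions are formulas, ordinal terms or set terms. -/
inductive Kind
  | fml
  | term (s : Srt)

/-- `Expr k M N`: the expressions of GDST of kind `k` with `M` free set variables and `N` free
ordinal variables. Variables are de Bruijn indices (separately for the two sorts): a binder
introduces the variable with index `0` and shifts the other variables of its sort up by one. -/
inductive Expr : Kind → ℕ → ℕ → Type
  | svar {M N : ℕ} (i : Fin M) : Expr (.term .set) M N
  | ovar {M N : ℕ} (i : Fin N) : Expr (.term .ord) M N
  | mem {s t : Srt} {M N : ℕ} (a : Expr (.term s) M N) (b : Expr (.term t) M N) : Expr .fml M N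
  | eq {s t : Srt} {M N : ℕ} (a : Expr (.term s) M N) (b : Expr (.term t) M N) : Expr .fml M N
  | dn {s : Srt} {M N : ℕ} (a : Expr (.term s) M N) : Expr .fml M N
  | and {M N : ℕ} (P Q : Expr .fml M N) : Expr .fml M N
  | or {M N : ℕ} (P Q : Expr .fml M N) : Expr .fml M N
  | not {M N : ℕ} (P : Expr .fml M N) : Expr .fml M N
  | allS {M N : ℕ} (X : Expr (.term .set) M N) (P : Expr .fml (M + 1) N) : Expr .fml M N
  | exS {M N : ℕ} (X : Expr (.term .set) M N) (P : Expr .fml (M + 1) N) : Expr .fml M N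
  | allO {M N : ℕ} (A : Expr (.term .ord) M N) (P : Expr .fml M (N + 1)) : Expr .fml M N
  | exO {M N : ℕ} (A : Expr (.term .ord) M N) (P : Expr .fml M (N + 1)) : Expr .fml M N
  | sep {M N : ℕ} (X : Expr (.term .set) M N) (P : Expr .fml (M + 1) N) : Expr (.term .set) M N
  | stage {M N : ℕ} (A : Expr (.term .ord) M N) : Expr (.term .set) M N
  | min {M N : ℕ} (P : Expr .fml M (N + 1)) : Expr (.term .ord) M N

/-- Formulas. -/
abbrev Fml := Expr .fml
/-- Ordinal terms. -/
abbrev OrdTm := Expr (.term .ord)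
/-- Set terms. -/
abbrev SetTm := Expr (.term .set)

/-! ## Semantics of GDST -/

/-- The three truth values: true, false and undefined. -/
inductive Truth : Type (u + 1)
  | top
  | bot
  | undef

namespace Truth

open Classical in
/-- Conjunction of a family of truth values: false if some member is false, otherwise undefined if
some member is undefined, otherwise true. -/
noncomputable def all {ι : Type*} (p : ι → Truth.{u}) : Truth.{u} :=
  if ∃ i, p i = bot then bot else if ∃ i, p i = undef then undef else top

open Classical in
/-- Disjunction of a family of truth values. -/
noncomputable def any {ι : Type*} (p : ι → Truth.{u}) : Truth.{u} :=
  if ∃ i, p i = top then top else if ∃ i, p i = undef then undef else bot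

/-- Binary conjunction. -/
def and : Truth.{u} → Truth.{u} → Truth.{u}
  | bot, _ => bot
  | _, bot => bot
  | top, top => top
  | _, _ => undef

/-- Binary disjunction. -/
def or : Truth.{u} → Truth.{u} → Truth.{u}
  | top, _ => top
  | _, top => top
  | bot, bot => bot
  | _, _ => undef

/-- Negation. -/
def not : Truth.{u} → Truth.{u}
  | top => bot
  | bot => top
  | undef => undef

open Classical in
/-- The defined truth value of a proposition. -/
noncomputable def ofProp (p : Prop) : Truth.{u} := if p then top else bot

end Truth

/-- The objects of a sort. -/
abbrev Srt.Carrier : Srt → Type (u + 1)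
  | .ord => Ordinal.{u}
  | .set => ZFSet.{u}

/-- Every object is a set; ordinals are identified with von Neumann ordinals. -/
noncomputable def Srt.toZF : (s : Srt) → Srt.Carrier.{u} s → ZFSet.{u}
  | .ord => Ordinal.toZFSet
  | .set => id

/-- Possible values of an expression; the value `none` of a term means "undefined". -/
abbrev Kind.Val : Kind → Type (u + 1)
  | .fml => Truth.{u}
  | .term s => Option (Srt.Carrier.{u} s)

/-- The expression value is defined. -/
def Kind.IsDefined : (k : Kind) → Kind.Val.{u} k → Prop
  | .fml => fun v => v ≠ Truth.undef
  | .term _ => fun v => v ≠ none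

/-- Extension of an assignment by a value for the variable with index `0`. -/
def ext {α : Type*} {n : ℕ} (a : α) (x : Fin n → α) : Fin (n + 1) → α :=
  Fin.cons (α := fun _ => α) a x

open Classical in
/-- The value at `η` of `{y ∈ v : p(y)}`: it is undefined if `p(y)` is undefined for some `y ∈ v`, and
also, since set terms take values in `L_η ∪ {U}`, if that set does not belong to `L_η`. -/
noncomputable def sepVal (η : Ordinal.{u}) (v : ZFSet.{u}) (p : ZFSet.{u} → Truth.{u}) :
    Option ZFSet.{u} :=
  if (∀ y ∈ v, p y ≠ Truth.undef) ∧ ZFSet.sep (fun y => p y = Truth.top) v ∈ Lset η then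
    some (ZFSet.sep (fun y => p y = Truth.top) v)
  else none

open Classical in
/-- The value at `η` of `min {α : p(α)}`: the (unique) `α < η` such that `p(α)` is true and `p(β)` is
false for all `β < α`, if there is one. -/
noncomputable def minVal (η : Ordinal.{u}) (p : Ordinal.{u} → Truth.{u}) : Option Ordinal.{u} :=
  if ∃ α < η, p α = Truth.top ∧ ∀ β < α, p β = Truth.bot then
    some (sInf {α | α < η ∧ p α = Truth.top ∧ ∀ β < α, p β = Truth.bot})
  else none

/-- The interpretation `I_η = (ι_η, j_η, j'_η)` of GDST. It is meant to be applied to assignments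
with `x i ∈ L_η` and `ξ j < η`. -/
noncomputable def interp (η : Ordinal.{u}) : {k : Kind} → {M N : ℕ} → Expr k M N →
    (Fin M → ZFSet.{u}) → (Fin N → Ordinal.{u}) → Kind.Val.{u} k
  | _, _, _, .svar i, x, _ => some (x i)
  | _, _, _, .ovar j, _, ξ => some (ξ j)
  | _, _, _, .mem (s := s) (t := t) a b, x, ξ =>
      match interp η a x ξ, interp η b x ξ with
      | some v, some w => Truth.ofProp (s.toZF v ∈ t.toZF w)
      | _, _ => Truth.undef
  | _, _, _, .eq (s := s) (t := t) a b, x, ξ =>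
      match interp η a x ξ, interp η b x ξ with
      | some v, some w => Truth.ofProp (s.toZF v = t.toZF w)
      | _, _ => Truth.undef
  | _, _, _, .dn a, x, ξ =>
      match interp η a x ξ with
      | some _ => Truth.top
      | none => Truth.undef
  | _, _, _, .and P Q, x, ξ => (interp η P x ξ).and (interp η Q x ξ)
  | _, _, _, .or P Q, x, ξ => (interp η P x ξ).or (interp η Q x ξ)
  | _, _, _, .not P, x, ξ => (interp η P x ξ).not
  | _, _, _, .allS X P, x, ξ =>
      match interp η X x ξ with
      | some v => Truth.all fun y : {y : ZFSet.{u} // y ∈ v} => interp η P (ext y.1 x) ξ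
      | none => Truth.undef
  | _, _, _, .exS X P, x, ξ =>
      match interp η X x ξ with
      | some v => Truth.any fun y : {y : ZFSet.{u} // y ∈ v} => interp η P (ext y.1 x) ξ
      | none => Truth.undef
  | _, _, _, .allO A P, x, ξ =>
      match interp η A x ξ with
      | some α => Truth.all fun β : {β : Ordinal.{u} // β < α} => interp η P x (ext β.1 ξ)
      | none => Truth.undef
  | _, _, _, .exO A P, x, ξ =>
      match interp η A x ξ with
      | some α => Truth.any fun β : {β : Ordinal.{u} // β < α} => interp η P x (ext β.1 ξ)
      | none => Truth.undef
  | _, _, _, .sep X P, x, ξ =>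
      match interp η X x ξ with
      | some v => sepVal η v fun y => interp η P (ext y x) ξ
      | none => none
  | _, _, _, .stage A, x, ξ => (interp η A x ξ).map Lset
  | _, _, _, .min P, x, ξ => minVal η fun α => interp η P x (ext α ξ)

/-- `x` and `ξ` are parameters from `L_η` and `η`. -/
def InDomain (η : Ordinal.{u}) {M N : ℕ} (x : Fin M → ZFSet.{u}) (ξ : Fin N → Ordinal.{u}) : Prop :=
  (∀ i, x i ∈ Lset η) ∧ ∀ j, ξ j < η

/-! ## `k`-fold reflecting ordinals -/

/-- `f_z(η)`: the least ordinal not of the form `j_η(A[w])` with `A` an ordinal term of GDST and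
`w` a finite tuple of elements of `z`. (All ordinals of that form are `< η`.) -/
noncomputable def descr (z : ZFSet.{u}) (η : Ordinal.{u}) : Ordinal.{u} :=
  sInf {α | ¬ ∃ (M : ℕ) (A : OrdTm M 0) (w : Fin M → ZFSet.{u}),
    (∀ i, w i ∈ z ∧ w i ∈ Lset η) ∧ interp η A w Fin.elim0 = some α}

/-- `η` is `k`-fold reflecting, with all the witnesses `η = η_0 < ⋯ < η_k` in the class `Λ` of
ordinals: `f_{η_i}(η_{i+1}) = η_i` for all `i < k`. -/
def KFoldReflecting (Λ : Set Ordinal.{u}) (k : ℕ) (η : Ordinal.{u}) : Prop :=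
  ∃ e : Fin (k + 1) → Ordinal.{u}, StrictMono e ∧ e 0 = η ∧ (∀ i, e i ∈ Λ) ∧
    ∀ i : Fin k, descr (e i.castSucc).toZFSet (e i.succ) = e i.castSucc

/-! ## The GDST term `T^∞_x(w₀)` -/

namespace Expr

/-- Lifting of a renaming of variables under a binder. -/
def under {m n : ℕ} (f : Fin m → Fin n) : Fin (m + 1) → Fin (n + 1) :=
  ext 0 (fun i => (f i).succ)

/-- Renaming of free variables. -/
def rename : {k : Kind} → {M N M' N' : ℕ} → (Fin M → Fin M') → (Fin N → Fin N') →
    Expr k M N → Expr k M' N'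
  | _, _, _, _, _, f, _, .svar i => .svar (f i)
  | _, _, _, _, _, _, g, .ovar j => .ovar (g j)
  | _, _, _, _, _, f, g, .mem a b => .mem (rename f g a) (rename f g b)
  | _, _, _, _, _, f, g, .eq a b => .eq (rename f g a) (rename f g b)
  | _, _, _, _, _, f, g, .dn a => .dn (rename f g a)
  | _, _, _, _, _, f, g, .and P Q => .and (rename f g P) (rename f g Q)
  | _, _, _, _, _, f, g, .or P Q => .or (rename f g P) (rename f g Q)
  | _, _, _, _, _, f, g, .not P => .not (rename f g P)
  | _, _, _, _, _, f, g, .allS X P => .allS (rename f g X) (rename (under f) g P)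
  | _, _, _, _, _, f, g, .exS X P => .exS (rename f g X) (rename (under f) g P)
  | _, _, _, _, _, f, g, .allO A P => .allO (rename f g A) (rename f (under g) P)
  | _, _, _, _, _, f, g, .exO A P => .exO (rename f g A) (rename f (under g) P)
  | _, _, _, _, _, f, g, .sep X P => .sep (rename f g X) (rename (under f) g P)
  | _, _, _, _, _, f, g, .stage A => .stage (rename f g A)
  | _, _, _, _, _, f, g, .min P => .min (rename f (under g) P)

variable {k : Kind} {s t : Srt} {M N : ℕ}

/-- Weakening by a new set variable with index `0`. -/
def upS (e : Expr k M N) : Expr k (M + 1) N := e.rename Fin.succ id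

/-- Weakening by a new ordinal variable with index `0`. -/
def upO (e : Expr k M N) : Expr k M (N + 1) := e.rename id Fin.succ

/-- Weakening by a new set variable with index `1`, which keeps the variable with index `0`. -/
def upS' (e : Expr k (M + 1) N) : Expr k (M + 2) N := e.rename (under Fin.succ) id

/-- `P → Q` as a shorthand for `¬ P ∨ Q`. -/
def imp (P Q : Fml M N) : Fml M N := P.not.or Q

/-- `P ↔ Q`. -/
def iff (P Q : Fml M N) : Fml M N := (P.imp Q).and (Q.imp P)

/-- `v = {a}`. -/
def isSingleton (v : SetTm M N) (a : Expr (.term s) M N) : Fml M N :=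
  (mem a v).and (allS v (eq (svar 0 : SetTm (M + 1) N) a.upS))

/-- `v = {a, b}`. -/
def isUPair (v : SetTm M N) (a : Expr (.term s) M N) (b : Expr (.term t) M N) : Fml M N :=
  (mem a v).and ((mem b v).and
    (allS v ((eq (svar 0 : SetTm (M + 1) N) a.upS).or (eq (svar 0 : SetTm (M + 1) N) b.upS))))

/-- `p = (a, b) = {{a}, {a, b}}`. -/
def isPair (p : SetTm M N) (a : Expr (.term s) M N) (b : Expr (.term t) M N) : Fml M N :=
  (allS p ((isSingleton (svar 0) a.upS).or (isUPair (svar 0) a.upS b.upS))).and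
    ((exS p (isSingleton (svar 0) a.upS)).and (exS p (isUPair (svar 0) a.upS b.upS)))

/-- `(a, b) ∈ h`. -/
def pairMem (a : Expr (.term s) M N) (b : Expr (.term t) M N) (h : SetTm M N) : Fml M N :=
  exS h (isPair (svar 0) a.upS b.upS)

/-- `A = 0`. -/
def isZero (A : OrdTm M N) : Fml M N :=
  allO A (eq (ovar 0 : OrdTm M (N + 1)) (ovar 0 : OrdTm M (N + 1))).not

/-- `B = A + 1`. -/
def isSucc (B A : OrdTm M N) : Fml M N :=
  (mem A B).and (allO B ((mem (ovar 0 : OrdTm M (N + 1)) A.upO).or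
    (eq (ovar 0 : OrdTm M (N + 1)) A.upO)))

/-- `A` is a limit ordinal (in particular, `A ≠ 0`). -/
def isLimit (A : OrdTm M N) : Fml M N :=
  (isZero A).not.and
    (allO A (exO A.upO (mem (ovar 1 : OrdTm M (N + 2)) (ovar 0 : OrdTm M (N + 2)))))

/-- `ℕ = ω = min {α : α is a limit ordinal}`. -/
def omega : OrdTm M N := min (isLimit (ovar 0))

/-- `A + 1 = min {α : A < α}`. -/
def succ (A : OrdTm M N) : OrdTm M N := min (mem A.upO (ovar 0 : OrdTm M (N + 1)))

/-- `X ⊆ ℕ`. -/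
def subOmega (X : SetTm M N) : Fml M N := allS X (mem (svar 0 : SetTm (M + 1) N) (omega))

/-- For `h ∈ L_ζ`: `h` is a map from the ordinal `δ` to subsets of `ℕ` which is compatible with the
operator `w ↦ T(w)` (where `w` is the set variable of `T` with index `0`) and the initial set `W`,
i.e. `h(0) = W`, `h(β + 1) = T(h(β))`, and `h(β) = ⋃_{γ < β} h(γ)` for limit `β`. -/
def compat (T : SetTm (M + 1) N) (W h : SetTm M N) (δ ζ : OrdTm M N) : Fml M N :=
  -- `h ⊆ δ × P(ℕ)`
  (allS h (exO δ.upS (exS (stage ζ.upS.upO)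
    ((isPair (svar 1) (ovar 0 : OrdTm (M + 2) (N + 1)) (svar 0 : SetTm (M + 2) (N + 1))).and
      (subOmega (svar 0)))))).and <|
  -- `h` is defined on all of `δ`
  (allO δ (exS (stage ζ.upO) (pairMem (ovar 0 : OrdTm (M + 1) (N + 1))
    (svar 0 : SetTm (M + 1) (N + 1)) h.upO.upS))).and <|
  -- `h` is single-valued
  (allO δ (allS (stage ζ.upO) (allS (stage ζ.upO.upS)
    (((pairMem (ovar 0 : OrdTm (M + 2) (N + 1)) (svar 0 : SetTm (M + 2) (N + 1))
        h.upO.upS.upS).and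
      (pairMem (ovar 0 : OrdTm (M + 2) (N + 1)) (svar 1 : SetTm (M + 2) (N + 1))
        h.upO.upS.upS)).imp
      (eq (svar 0 : SetTm (M + 2) (N + 1)) (svar 1 : SetTm (M + 2) (N + 1))))))).and <|
  -- `h(0) = W`
  (allO δ ((isZero (ovar 0)).imp (pairMem (ovar 0 : OrdTm M (N + 1)) W.upO h.upO))).and <|
  -- `h(β + 1) = T(h(β))`, where `β` and `β + 1` are the ordinal variables `1` and `0`
  (allO δ (allO δ.upO ((isSucc (ovar 0) (ovar 1)).imp
    (allS (stage ζ.upO.upO)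
      ((pairMem (ovar 1 : OrdTm (M + 1) (N + 2)) (svar 0 : SetTm (M + 1) (N + 2))
          h.upO.upO.upS).imp
        (pairMem (ovar 0 : OrdTm (M + 1) (N + 2)) T.upO.upO h.upO.upO.upS)))))).and <|
  -- `h(β) = ⋃_{γ < β} h(γ)` for limit `β`
  (allO δ ((isLimit (ovar 0)).imp
    (allS (stage ζ.upO)
      ((pairMem (ovar 0 : OrdTm (M + 1) (N + 1)) (svar 0 : SetTm (M + 1) (N + 1)) h.upO.upS).imp
        (allS (stage ζ.upO.upS)
          ((mem (svar 0 : SetTm (M + 2) (N + 1)) (svar 1 : SetTm (M + 2) (N + 1))).iff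
            (exO (ovar 0) (exS (stage ζ.upO.upS.upS.upO)
              ((pairMem (ovar 0 : OrdTm (M + 3) (N + 2)) (svar 0 : SetTm (M + 3) (N + 2))
                  h.upO.upS.upS.upO.upS).and
                (mem (svar 1 : SetTm (M + 3) (N + 2)) (svar 0 : SetTm (M + 3) (N + 2))))))))))))

/-- `L_ζ` contains a compatible map whose domain contains `A`. -/
def hasIter (T : SetTm (M + 1) N) (W : SetTm M N) (A ζ : OrdTm M N) : Fml M N :=
  exS (stage ζ) (exO ζ.upS ((mem A.upS.upO (ovar 0 : OrdTm (M + 1) (N + 1))).and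
    (compat T.upS'.upO W.upS.upO (svar 0) (ovar 0) ζ.upS.upO)))

/-- `min {ζ : L_ζ contains a compatible map whose domain contains A}`. -/
def iterIndex (T : SetTm (M + 1) N) (W : SetTm M N) (A : OrdTm M N) : OrdTm M N :=
  min (hasIter T.upO W.upO A.upO (ovar 0))

/-- The value `{n ∈ L_ζ : n ∈ h(A) for some compatible h ∈ L_ζ}` at `A` of the compatible maps
in `L_ζ`. -/
def iterAt (T : SetTm (M + 1) N) (W : SetTm M N) (A ζ : OrdTm M N) : SetTm M N :=
  sep (stage ζ) (exS (stage ζ.upS) (exO ζ.upS.upS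
    ((mem A.upS.upS.upO (ovar 0 : OrdTm (M + 2) (N + 1))).and
      ((compat T.upS'.upS'.upO W.upS.upS.upO (svar 0) (ovar 0) ζ.upS.upS.upO).and
        (exS (stage ζ.upS.upS.upO)
          ((pairMem A.upS.upS.upO.upS (svar 0 : SetTm (M + 3) (N + 1)) (svar 1)).and
            (mem (svar 2 : SetTm (M + 3) (N + 1)) (svar 0 : SetTm (M + 3) (N + 1)))))))))

/-- The term `T^A(W)`: the iterate with index `A` of `w ↦ T(w)` starting from `W`. -/
def iter (T : SetTm (M + 1) N) (W : SetTm M N) (A : OrdTm M N) : SetTm M N :=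
  iterAt T W A (iterIndex T W A)

/-- The term `T^∞(W) = T^{min {α : T^{α+1}(W) = T^α(W)}}(W)`. -/
def iterInfty (T : SetTm (M + 1) N) (W : SetTm M N) : SetTm M N :=
  iter T W (min (eq (iter T.upO W.upO (succ (ovar 0))) (iter T.upO W.upO (ovar 0))))

end Expr

/-! ## The language NMID -/

/-- The expressions of NMID: those generated by the formation rules of GDST without `min`, together
with the terms `T^∞(W)`. In `infty T W`, the variable `w` of the operator `w ↦ T(w)` is the set
variable of `T` with index `0`. -/
inductive NMID : Kind → ℕ → ℕ → Type
  | svar {M N : ℕ} (i : Fin M) : NMID (.term .set) M N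
  | ovar {M N : ℕ} (i : Fin N) : NMID (.term .ord) M N
  | mem {s t : Srt} {M N : ℕ} (a : NMID (.term s) M N) (b : NMID (.term t) M N) : NMID .fml M N
  | eq {s t : Srt} {M N : ℕ} (a : NMID (.term s) M N) (b : NMID (.term t) M N) : NMID .fml M N
  | dn {s : Srt} {M N : ℕ} (a : NMID (.term s) M N) : NMID .fml M N
  | and {M N : ℕ} (P Q : NMID .fml M N) : NMID .fml M N
  | or {M N : ℕ} (P Q : NMID .fml M N) : NMID .fml M N
  | not {M N : ℕ} (P : NMID .fml M N) : NMID .fml M N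
  | allS {M N : ℕ} (X : NMID (.term .set) M N) (P : NMID .fml (M + 1) N) : NMID .fml M N
  | exS {M N : ℕ} (X : NMID (.term .set) M N) (P : NMID .fml (M + 1) N) : NMID .fml M N
  | allO {M N : ℕ} (A : NMID (.term .ord) M N) (P : NMID .fml M (N + 1)) : NMID .fml M N
  | exO {M N : ℕ} (A : NMID (.term .ord) M N) (P : NMID .fml M (N + 1)) : NMID .fml M N
  | sep {M N : ℕ} (X : NMID (.term .set) M N) (P : NMID .fml (M + 1) N) : NMID (.term .set) M N
  | stage {M N : ℕ} (A : NMID (.term .ord) M N) : NMID (.term .set) M N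
  | infty {M N : ℕ} (T : NMID (.term .set) (M + 1) N) (W : NMID (.term .set) M N) :
      NMID (.term .set) M N

namespace NMID

/-- The inclusion of the sublanguage NMID into GDST. -/
def toExpr : {k : Kind} → {M N : ℕ} → NMID k M N → Expr k M N
  | _, _, _, .svar i => .svar i
  | _, _, _, .ovar j => .ovar j
  | _, _, _, .mem a b => .mem a.toExpr b.toExpr
  | _, _, _, .eq a b => .eq a.toExpr b.toExpr
  | _, _, _, .dn a => .dn a.toExpr
  | _, _, _, .and P Q => .and P.toExpr Q.toExpr
  | _, _, _, .or P Q => .or P.toExpr Q.toExpr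
  | _, _, _, .not P => .not P.toExpr
  | _, _, _, .allS X P => .allS X.toExpr P.toExpr
  | _, _, _, .exS X P => .exS X.toExpr P.toExpr
  | _, _, _, .allO A P => .allO A.toExpr P.toExpr
  | _, _, _, .exO A P => .exO A.toExpr P.toExpr
  | _, _, _, .sep X P => .sep X.toExpr P.toExpr
  | _, _, _, .stage A => .stage A.toExpr
  | _, _, _, .infty T W => Expr.iterInfty T.toExpr W.toExpr

/-- The value at `η` of an NMID expression. -/
noncomputable def val (η : Ordinal.{u}) {k : Kind} {M N : ℕ} (E : NMID k M N)
    (x : Fin M → ZFSet.{u}) (ξ : Fin N → Ordinal.{u}) : Kind.Val.{u} k :=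
  interp η E.toExpr x ξ

/-- `E` with the parameters `x, ξ` is regular at `η`: every term `T^∞(W)` that occurs in it (the
bound variables taking all values in the ranges of their quantifiers) is applied to a subset of `ℕ`,
and to an operator which maps each `w ∈ L_η ∩ P(ℕ)` to some `v` with `w ⊆ v ⊆ ℕ`. These conditions
are imposed only on those values at `η` that are defined. -/
def RegularAt (η : Ordinal.{u}) : {k : Kind} → {M N : ℕ} → NMID k M N →
    (Fin M → ZFSet.{u}) → (Fin N → Ordinal.{u}) → Prop
  | _, _, _, .svar _, _, _ => True
  | _, _, _, .ovar _, _, _ => True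
  | _, _, _, .mem a b, x, ξ => a.RegularAt η x ξ ∧ b.RegularAt η x ξ
  | _, _, _, .eq a b, x, ξ => a.RegularAt η x ξ ∧ b.RegularAt η x ξ
  | _, _, _, .dn a, x, ξ => a.RegularAt η x ξ
  | _, _, _, .and P Q, x, ξ => P.RegularAt η x ξ ∧ Q.RegularAt η x ξ
  | _, _, _, .or P Q, x, ξ => P.RegularAt η x ξ ∧ Q.RegularAt η x ξ
  | _, _, _, .not P, x, ξ => P.RegularAt η x ξ
  | _, _, _, .allS X P, x, ξ => X.RegularAt η x ξ ∧
      ∀ v, X.val η x ξ = some v → ∀ y ∈ v, P.RegularAt η (ext y x) ξ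
  | _, _, _, .exS X P, x, ξ => X.RegularAt η x ξ ∧
      ∀ v, X.val η x ξ = some v → ∀ y ∈ v, P.RegularAt η (ext y x) ξ
  | _, _, _, .allO A P, x, ξ => A.RegularAt η x ξ ∧
      ∀ α, A.val η x ξ = some α → ∀ β < α, P.RegularAt η x (ext β ξ)
  | _, _, _, .exO A P, x, ξ => A.RegularAt η x ξ ∧
      ∀ α, A.val η x ξ = some α → ∀ β < α, P.RegularAt η x (ext β ξ)
  | _, _, _, .sep X P, x, ξ => X.RegularAt η x ξ ∧
      ∀ v, X.val η x ξ = some v → ∀ y ∈ v, P.RegularAt η (ext y x) ξ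
  | _, _, _, .stage A, x, ξ => A.RegularAt η x ξ
  | _, _, _, .infty T W, x, ξ => W.RegularAt η x ξ ∧
      (∀ v, W.val η x ξ = some v → v ⊆ Ordinal.omega0.toZFSet) ∧
      ∀ w ∈ Lset η, w ⊆ Ordinal.omega0.toZFSet → T.RegularAt η (ext w x) ξ ∧
        ∀ v, T.val η (ext w x) ξ = some v → w ⊆ v ∧ v ⊆ Ordinal.omega0.toZFSet

/-- `E` with the parameters `x, ξ` is regular at all `η` in the class `Λ` that are large enough for
the parameters. -/
def Regular (Λ : Set Ordinal.{u}) {k : Kind} {M N : ℕ} (E : NMID k M N)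
    (x : Fin M → ZFSet.{u}) (ξ : Fin N → Ordinal.{u}) : Prop :=
  ∀ η ∈ Λ, InDomain η x ξ → E.RegularAt η x ξ

end NMID

end GDST

/-!
Every expression `E` of NMID turns out to be defined at `k`-fold reflecting ordinals, for a number
`k` that depends only on the shape of `E` (`NMID.exists_definedAtFold`). The theorem follows by
taking `k` large enough for `P`, `A` and `X` and a `k`-fold reflecting ordinal above the
parameters.

*Reflection.* The condition `f_η(θ) = η`, where `η < θ`, says that no term with parameters from
`η` denotes `η` at `θ`. Since every element of `L_η` is denoted at `θ` by a term with parameters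
from `η` (`named_of_mem`), the same is true of terms with parameters from `L_η`
(`indescribable_of_descr`). Hence a property of ordinals which is decided at `θ` up to `η` and
which holds of `η` holds of some smaller ordinal: otherwise `η` would be `min {α : P(α)}`
(`Indescribable.reflect`). In particular, all first-order properties of the structure `L_η`
reflect to limit stages below (`Indescribable.reflect_dfn`).

*Definability of the interpretation.* For limit ordinals `α`, the interpretation `I_α` of an
expression is first-order definable over `L_α`, uniformly in `α` (`Expr.dfnInterp`). This rests on
the definability of `β ↦ L_β` over `L_α` (`Dfn.stage`). There, satisfaction is not formalized
inside `L_α`; instead, the definable subsets of a transitive set are obtained from relations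
generated by finitely many operations (`Der`), which can be described within `L_α`.

*Separation.* If all the instances of a separation term are defined at `η`, then by reflection
they are already defined at some limit `β < η`, so that the set is definable over `L_β` and
belongs to `L_η` (`Indescribable.sep_isDefined`). One more degree of reflection pays for this
step. Quantifiers and connectives need no additional reflection.

*Inductive definitions.* Let `η₀ < η₁ < η₂` be members of a reflecting chain at which `T` is
defined for all sets of natural numbers in the respective stage. Reflection, in place of
replacement, and separation show that the sequence of the iterates of `T` can be constructed
inside `L_η₀` up to every `δ < η₀`, and inside `L_η₁` beyond `η₀` (`Indescribable.iterSeq_mem`).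
If a natural number `n` entered at the step from `η₀` to `η₀ + 1`, then `η₀` would be describable
at `η₁`, as the least `α` such that `n` belongs to the iterate with index `α + 1`. So the
iteration has closed at `η₀` (`Indescribable.iterate_eq`). The closure ordinal is describable at
`η₁`, hence less than `η₀`, and `T^∞(W)` is defined at `η₀` (`Indescribable.iterInfty_isDefined`).
Regularity is used to make the operator inflationary on the subsets of `ℕ`.
-/

namespace GDST

/-! ### First-order formulas over transitive sets -/

/-- First-order formulas of set theory. Variables are de Bruijn indices in an unbounded context: a
quantifier binds the variable `0` and shifts the others up by one. Equality is not primitive, since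
the structures of interest are transitive and hence extensional. -/
inductive SetFml
  | mem (i j : ℕ)
  | neg (φ : SetFml)
  | and (φ ψ : SetFml)
  | ex (φ : SetFml)

/-- Extension of an infinite assignment by a value for the variable `0`. -/
def push {α : Type*} (y : α) (s : ℕ → α) : ℕ → α
  | 0 => y
  | i + 1 => s i

@[simp] lemma push_zero {α : Type*} (y : α) (s : ℕ → α) : push y s 0 = y := rfl
@[simp] lemma push_succ {α : Type*} (y : α) (s : ℕ → α) (i : ℕ) : push y s (i + 1) = s i := rfl

lemma comp_push {α β : Type*} (f : α → β) (y : α) (s : ℕ → α) :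
    (fun i => f (push y s i)) = push (f y) (fun i => f (s i)) := by
  funext i; cases i <;> rfl

namespace SetFml

/-- Satisfaction in the structure `(U, ∈)`. -/
def Sat (U : ZFSet.{u}) : SetFml → (ℕ → ZFSet.{u}) → Prop
  | mem i j, s => s i ∈ s j
  | neg φ, s => ¬ φ.Sat U s
  | and φ ψ, s => φ.Sat U s ∧ ψ.Sat U s
  | ex φ, s => ∃ y ∈ U, φ.Sat U (push y s)

/-- Renaming of the free variables. -/
def rename : SetFml → (ℕ → ℕ) → SetFml
  | mem i j, f => mem (f i) (f j)
  | neg φ, f => neg (φ.rename f)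
  | and φ ψ, f => and (φ.rename f) (ψ.rename f)
  | ex φ, f => ex (φ.rename (push 0 fun i => f i + 1))

/-- A bound for the free variables. -/
def fv : SetFml → ℕ
  | mem i j => max i j + 1
  | neg φ => φ.fv
  | and φ ψ => max φ.fv ψ.fv
  | ex φ => φ.fv - 1

lemma sat_rename (U : ZFSet.{u}) (φ : SetFml) (f : ℕ → ℕ) (s : ℕ → ZFSet.{u}) :
    (φ.rename f).Sat U s ↔ φ.Sat U (fun i => s (f i)) := by
  induction φ generalizing f s with
  | mem i j => rfl
  | neg φ ih => simp only [rename, Sat, ih]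
  | and φ ψ ih₁ ih₂ => simp only [rename, Sat, ih₁, ih₂]
  | ex φ ih =>
    simp only [rename, Sat, ih]
    refine exists_congr fun y => and_congr_right fun _ => ?_
    rw [show (fun i => push y s (push 0 (fun i => f i + 1) i)) = push y fun i => s (f i) from
      comp_push (push y s) 0 _]

lemma sat_congr (U : ZFSet.{u}) (φ : SetFml) {s t : ℕ → ZFSet.{u}} (h : ∀ i < φ.fv, s i = t i) :
    φ.Sat U s ↔ φ.Sat U t := by
  induction φ generalizing s t with
  | mem i j =>
    simp only [fv] at h
    simp only [Sat]
    rw [h i (by omega), h j (by omega)]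
  | neg φ ih => simp only [Sat, ih h]
  | and φ ψ ih₁ ih₂ =>
    simp only [fv] at h
    simp only [Sat, ih₁ fun i hi => h i (by omega), ih₂ fun i hi => h i (by omega)]
  | ex φ ih =>
    simp only [fv] at h
    simp only [Sat]
    refine exists_congr fun y => and_congr_right fun _ => ih fun i hi => ?_
    cases i with
    | zero => rfl
    | succ i => exact h i (by omega)

/-- Universal quantification. -/
def all (φ : SetFml) : SetFml := neg (ex (neg φ))

/-- Implication. -/
def imp (φ ψ : SetFml) : SetFml := neg (and φ (neg ψ))

/-- Equality, expressed through extensionality. -/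
def eq (i j : ℕ) : SetFml :=
  all (and (imp (mem 0 (i + 1)) (mem 0 (j + 1))) (imp (mem 0 (j + 1)) (mem 0 (i + 1))))

@[simp] lemma sat_all (U : ZFSet.{u}) (φ : SetFml) (s : ℕ → ZFSet.{u}) :
    φ.all.Sat U s ↔ ∀ y ∈ U, φ.Sat U (push y s) := by simp [all, Sat]

@[simp] lemma sat_imp (U : ZFSet.{u}) (φ ψ : SetFml) (s : ℕ → ZFSet.{u}) :
    (φ.imp ψ).Sat U s ↔ (φ.Sat U s → ψ.Sat U s) := by simp [imp, Sat]

lemma sat_eq {U : ZFSet.{u}} (hU : U.IsTransitive) {i j : ℕ} {s : ℕ → ZFSet.{u}}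
    (hi : s i ∈ U ∨ s i = ∅) (hj : s j ∈ U ∨ s j = ∅) : (eq i j).Sat U s ↔ s i = s j := by
  have aux : ∀ {x}, (x ∈ U ∨ x = ∅) → ∀ z ∈ x, z ∈ U := by
    rintro x (hx | rfl) z hz
    · exact hU x hx hz
    · exact (ZFSet.notMem_empty z hz).elim
  simp only [eq, sat_all, Sat, sat_imp, push_zero, push_succ]
  refine ⟨fun h => ZFSet.ext fun z => ⟨fun hz => (h z (aux hi z hz)).1 hz, fun hz =>
    (h z (aux hj z hz)).2 hz⟩, fun h z _ => by rw [h]; exact ⟨id, id⟩⟩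

open FirstOrder FirstOrder.Language

/-- Translation to a formula of Mathlib's first-order logic, where `e` tells which variable the
index `i` stands for. -/
noncomputable def toBounded {α : Type*} : SetFml → {n : ℕ} → (ℕ → α ⊕ Fin n) →
    stLang.BoundedFormula α n
  | mem i j, _, e => Relations.boundedFormula₂ (L := stLang) MemRel.mem (.var (e i)) (.var (e j))
  | neg φ, _, e => (φ.toBounded e).not
  | and φ ψ, _, e => φ.toBounded e ⊓ ψ.toBounded e
  | ex φ, n, e => (φ.toBounded (push (Sum.inr (Fin.last n)) fun i => (e i).map id Fin.castSucc)).ex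

lemma realize_toBounded {a : ZFSet.{u}} {α : Type*} (φ : SetFml) {n : ℕ} (e : ℕ → α ⊕ Fin n)
    (v : α → {y : ZFSet.{u} // y ∈ a}) (xs : Fin n → {y : ZFSet.{u} // y ∈ a}) :
    (φ.toBounded e).Realize v xs ↔ φ.Sat a fun i => (Sum.elim v xs (e i)).1 := by
  induction φ generalizing n with
  | mem i j =>
    rfl
  | neg φ ih => simp only [toBounded, BoundedFormula.realize_not, ih, Sat]
  | and φ ψ ih₁ ih₂ => simp only [toBounded, BoundedFormula.realize_inf, ih₁, ih₂, Sat]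
  | ex φ ih =>
    simp only [toBounded, BoundedFormula.realize_ex, ih, Sat, Subtype.exists]
    refine exists_congr fun y => ⟨fun ⟨hy, h⟩ => ⟨hy, ?_⟩, fun ⟨hy, h⟩ => ⟨hy, ?_⟩⟩ <;>
    · convert h using 2 with i
      cases i with
      | zero => simp
      | succ i => simp only [push_succ]; rcases e i with j | j <;> simp

/-- Every formula of Mathlib's first-order logic is equivalent, over transitive sets, to one of the
formulas considered here. -/
lemma exists_sat_iff_realize {a : ZFSet.{u}} (ha : a.IsTransitive) {α : Type*} [Nonempty α] {n : ℕ}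
    (φ : stLang.BoundedFormula α n) : ∃ (e : ℕ → α ⊕ Fin n) (ψ : SetFml),
      ∀ (v : α → {y : ZFSet.{u} // y ∈ a}) (xs : Fin n → {y : ZFSet.{u} // y ∈ a}),
        φ.Realize v xs ↔ ψ.Sat a fun i => (Sum.elim v xs (e i)).1 := by
  classical
  have hterm : ∀ {n : ℕ} (t : stLang.Term (α ⊕ Fin n)), ∃ c, t = .var c := by
    rintro n (c | ⟨f, _⟩)
    · exact ⟨c, rfl⟩
    · exact nomatch f
  induction φ with
  | falsum =>
    refine ⟨fun _ => Sum.inl (Classical.arbitrary α), mem 0 0, fun v xs => ?_⟩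
    simpa [Sat, BoundedFormula.Realize] using ZFSet.mem_irrefl _
  | equal t₁ t₂ =>
    obtain ⟨c, rfl⟩ := hterm t₁
    obtain ⟨d, rfl⟩ := hterm t₂
    refine ⟨push c fun _ => d, eq 0 1, fun v xs => ?_⟩
    rw [sat_eq ha (Or.inl (Subtype.prop _)) (Or.inl (Subtype.prop _))]
    simp only [push_zero, push_succ, BoundedFormula.Realize, Term.realize_var]
    exact Subtype.ext_iff
  | rel R ts =>
    cases R
    obtain ⟨c, hc⟩ := hterm (ts 0)
    obtain ⟨d, hd⟩ := hterm (ts 1)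
    refine ⟨push c fun _ => d, mem 0 1, fun v xs => ?_⟩
    simp only [Sat, push_zero, push_succ, BoundedFormula.Realize]
    change (Term.realize (M := {y : ZFSet.{u} // y ∈ a}) (Sum.elim v xs) (ts 0)).1 ∈
      (Term.realize (M := {y : ZFSet.{u} // y ∈ a}) (Sum.elim v xs) (ts 1)).1 ↔ _
    rw [hc, hd]
    rfl
  | @imp n φ₁ φ₂ ih₁ ih₂ =>
    obtain ⟨e₁, ψ₁, h₁⟩ := ih₁
    obtain ⟨e₂, ψ₂, h₂⟩ := ih₂
    refine ⟨fun i => if i % 2 = 0 then e₁ (i / 2) else e₂ (i / 2),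
      imp (ψ₁.rename fun i => 2 * i) (ψ₂.rename fun i => 2 * i + 1), fun v xs => ?_⟩
    have key : ∀ i : ℕ, (2 * i + 1) / 2 = i := by omega
    simp [BoundedFormula.realize_imp, sat_rename, h₁, h₂, key]
  | @all n φ ih =>
    obtain ⟨e, ψ, h⟩ := ih
    let c : α ⊕ Fin n := Sum.inl (Classical.arbitrary α)
    refine ⟨fun i => Sum.elim Sum.inl
        (fun j => Fin.lastCases (motive := fun _ => α ⊕ Fin n) c Sum.inr j) (e i),
      all (ψ.rename fun i => if e i = Sum.inr (Fin.last n) then 0 else i + 1), fun v xs => ?_⟩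
    simp only [BoundedFormula.realize_all, h, sat_all, sat_rename, Subtype.forall]
    refine forall₂_congr fun y hy => iff_of_eq ?_
    congr 1
    funext i
    rcases hei : e i with j | j
    · simp [hei]
    · induction j using Fin.lastCases with
      | last => simp
      | cast j => simp [hei, (Fin.castSucc_lt_last j).ne]

end SetFml

lemma empty_mem_of_isTransitive {a : ZFSet.{u}} (ha : a.IsTransitive) (hne : a ≠ ∅) : ∅ ∈ a := by
  obtain ⟨y, hy, h⟩ := ZFSet.regularity a hne
  have : y = ∅ := (ZFSet.eq_empty y).2 fun z hz =>
    ZFSet.notMem_empty z (h ▸ ZFSet.mem_inter.2 ⟨ha y hy hz, hz⟩)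
  rwa [← this]

open FirstOrder FirstOrder.Language in
/-- Membership in `Def(a)` for transitive `a`. The value `∅` is allowed for the irrelevant
parameters, so that `a = ∅` is not exceptional. -/
lemma mem_defPow {a : ZFSet.{u}} (ha : a.IsTransitive) {b : ZFSet.{u}} :
    b ∈ defPow a ↔ b ⊆ a ∧ ∃ (φ : SetFml) (p : ℕ → ZFSet.{u}), (∀ i, p i ∈ a ∨ p i = ∅) ∧
      ∀ y ∈ a, (y ∈ b ↔ φ.Sat a (push y p)) := by
  classical
  rw [defPow, ZFSet.mem_sep, ZFSet.mem_powerset]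
  refine and_congr_right fun hb => ?_
  rw [Set.Definable₁, Set.definable_iff_exists_formula_sum]
  constructor
  · rintro ⟨φ, hφ⟩
    obtain ⟨e, ψ, h⟩ := SetFml.exists_sat_iff_realize ha (n := 0) φ
    let p : ℕ → ZFSet.{u} := fun i =>
      Sum.elim (Sum.elim (fun c => c.1.1) fun _ => ∅) (fun j => j.elim0) (e i)
    refine ⟨ψ.rename fun i => if e i = Sum.inl (Sum.inr 0) then 0 else i + 1, p, fun i => ?_,
      fun y hy => ?_⟩
    · simp only [p]
      rcases e i with (c | c) | j
      · exact Or.inl c.1.2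
      · exact Or.inr rfl
      · exact j.elim0
    · have h1 : y ∈ b ↔ (fun _ : Fin 1 => (⟨y, hy⟩ : {y // y ∈ a})) ∈
          {x : Fin 1 → {y // y ∈ a} | x 0 ∈ {y : {y // y ∈ a} | y.1 ∈ b}} := Iff.rfl
      rw [h1, hφ]
      show Formula.Realize _ _ ↔ _
      rw [Formula.Realize, h, SetFml.sat_rename]
      refine iff_of_eq ?_
      congr 1
      funext i
      simp only [p]
      rcases hei : e i with (c | c) | j
      · simp [hei]
      · obtain rfl : c = 0 := Subsingleton.elim _ _
        simp
      · exact j.elim0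
  · rintro ⟨φ, p, hp, h⟩
    by_cases hne : a = ∅
    · subst hne
      refine ⟨⊥, ?_⟩
      ext v
      exact (ZFSet.notMem_empty _ (v 0).2).elim
    have hp' : ∀ i, p i ∈ a := fun i => (hp i).elim id fun h => h ▸ empty_mem_of_isTransitive ha hne
    refine ⟨φ.toBounded (push (Sum.inl (Sum.inr 0)) fun i =>
      Sum.inl (Sum.inl ⟨⟨p i, hp' i⟩, trivial⟩)), ?_⟩
    ext v
    show (v 0).1 ∈ b ↔ Formula.Realize _ _
    rw [Formula.Realize, SetFml.realize_toBounded, h _ (v 0).2]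
    refine iff_of_eq ?_
    congr 1
    funext i
    cases i <;> rfl

/-! ### Basic properties of the constructible hierarchy -/

lemma subset_of_mem_defPow {a b : ZFSet.{u}} (h : b ∈ defPow a) : b ⊆ a := by
  rw [defPow, ZFSet.mem_sep, ZFSet.mem_powerset] at h
  exact h.1

lemma mem_Lset {α : Ordinal.{u}} {y : ZFSet.{u}} :
    y ∈ Lset α ↔ ∃ β < α, y ∈ defPow (Lset β) := by
  rw [Lset, ZFSet.mem_iUnion]
  simp

lemma Lset_mono {α β : Ordinal.{u}} (h : α ≤ β) : Lset α ⊆ Lset β := fun y hy => by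
  obtain ⟨γ, hγ, hy⟩ := mem_Lset.1 hy
  exact mem_Lset.2 ⟨γ, hγ.trans_le h, hy⟩

lemma subset_defPow {a : ZFSet.{u}} (ha : a.IsTransitive) : a ⊆ defPow a := fun x hx =>
  (mem_defPow ha).2 ⟨ha x hx, .mem 0 1, fun _ => x, fun _ => Or.inl hx, fun _ _ => Iff.rfl⟩

lemma self_mem_defPow {a : ZFSet.{u}} (ha : a.IsTransitive) : a ∈ defPow a :=
  (mem_defPow ha).2 ⟨fun _ h => h, .neg (.mem 0 0), fun _ => ∅, fun _ => Or.inr rfl, fun y hy =>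
    ⟨fun _ => ZFSet.mem_irrefl y, fun _ => hy⟩⟩

lemma isTransitive_Lset (α : Ordinal.{u}) : (Lset α).IsTransitive := by
  induction α using WellFoundedLT.induction with
  | ind α ih =>
    intro y hy z hz
    obtain ⟨β, hβ, hy⟩ := mem_Lset.1 hy
    exact mem_Lset.2 ⟨β, hβ, subset_defPow (ih β hβ) (subset_of_mem_defPow hy hz)⟩

lemma Lset_add_one (α : Ordinal.{u}) : Lset (α + 1) = defPow (Lset α) := by
  ext y
  rw [mem_Lset]
  constructor
  · rintro ⟨β, hβ, hy⟩
    rcases (Order.lt_add_one_iff.1 hβ).eq_or_lt with rfl | hβ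
    · exact hy
    · exact subset_defPow (isTransitive_Lset α) (mem_Lset.2 ⟨β, hβ, hy⟩)
  · exact fun hy => ⟨α, Order.lt_add_one_iff.2 le_rfl, hy⟩

lemma Lset_mem_Lset {α β : Ordinal.{u}} (h : α < β) : Lset α ∈ Lset β :=
  mem_Lset.2 ⟨α, h, self_mem_defPow (isTransitive_Lset α)⟩

lemma subset_Lset_of_mem {α : Ordinal.{u}} {y : ZFSet.{u}} (h : y ∈ Lset α) :
    ∃ β < α, y ⊆ Lset β := by
  obtain ⟨β, hβ, hy⟩ := mem_Lset.1 h
  exact ⟨β, hβ, subset_of_mem_defPow hy⟩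

lemma rank_lt_of_mem_Lset {α : Ordinal.{u}} {y : ZFSet.{u}} (h : y ∈ Lset α) : y.rank < α := by
  induction α using WellFoundedLT.induction generalizing y with
  | ind α ih =>
    obtain ⟨β, hβ, hy⟩ := subset_Lset_of_mem h
    exact (ZFSet.rank_le_iff.2 fun z hz => ih β hβ (hy hz)).trans_lt hβ

lemma Lset_exists_lt_of_limit {δ : Ordinal.{u}} (hδ : Order.IsSuccLimit δ) {y : ZFSet.{u}}
    (hy : y ∈ Lset δ) : ∃ γ < δ, y ∈ Lset γ := by
  obtain ⟨β, hβ, hy⟩ := mem_Lset.1 hy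
  exact ⟨β + 1, hδ.add_one_lt hβ, by rwa [Lset_add_one]⟩

lemma empty_mem_Lset {α : Ordinal.{u}} (h : 0 < α) : (∅ : ZFSet.{u}) ∈ Lset α :=
  empty_mem_of_isTransitive (isTransitive_Lset α) fun h0 =>
    ZFSet.notMem_empty _ (h0 ▸ Lset_mem_Lset h)

/-- Finitely many elements of a limit stage belong to a common earlier stage. -/
lemma exists_lt_forall_mem_Lset {δ : Ordinal.{u}} (hδ : Order.IsSuccLimit δ) {ι : Type*} [Finite ι]
    {x : ι → ZFSet.{u}} (hx : ∀ i, x i ∈ Lset δ) : ∃ γ < δ, ∀ i, x i ∈ Lset γ := by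
  choose g hg hxg using fun i => Lset_exists_lt_of_limit hδ (hx i)
  cases nonempty_fintype ι
  refine ⟨Finset.univ.sup g, (Finset.sup_lt_iff hδ.bot_lt).2 fun i _ => hg i, fun i =>
    Lset_mono (Finset.le_sup (Finset.mem_univ i)) (hxg i)⟩

/-! ### Uniform definability over the stages of the constructible hierarchy -/

namespace SetFml

/-- The variable `i` denotes an ordinal: it is a transitive set of transitive sets. -/
def ord (i : ℕ) : SetFml :=
  all (imp (mem 0 (i + 1))
    (all (imp (mem 0 1) (and (mem 0 (i + 2)) (all (imp (mem 0 1) (mem 0 2)))))))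

lemma sat_ord {U : ZFSet.{u}} (hU : U.IsTransitive) {i : ℕ} {s : ℕ → ZFSet.{u}}
    (hi : s i ⊆ U) : (ord i).Sat U s ↔ (s i).IsOrdinal := by
  rw [ZFSet.isOrdinal_iff_forall_mem_isTransitive]
  simp only [ord, sat_all, sat_imp, Sat, push_zero, push_succ]
  change (∀ y ∈ U, y ∈ s i → ∀ z ∈ U, z ∈ y → z ∈ s i ∧ ∀ w ∈ U, w ∈ z → w ∈ y) ↔ _
  constructor
  · intro h
    refine ⟨fun y hy z hz => (h y (hi hy) hy z (hU y (hi hy) hz) hz).1, fun y hy z hz w hw => ?_⟩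
    have hzU := hU y (hi hy) hz
    exact (h y (hi hy) hy z hzU hz).2 w (hU z hzU hw) hw
  · rintro ⟨h1, h2⟩ y - hy z - hz
    exact ⟨h1 y hy hz, fun w _ hw => h2 y hy z hz hw⟩

end SetFml

lemma toZFSet_mem_Lset {α β : Ordinal.{u}} : α.toZFSet ∈ Lset β ↔ α < β := by
  refine ⟨fun h => ?_, fun h => ?_⟩
  · simpa using rank_lt_of_mem_Lset h
  · induction α using WellFoundedLT.induction generalizing β with
    | ind α ih =>
      refine mem_Lset.2 ⟨α, h, (mem_defPow (isTransitive_Lset α)).2 ⟨fun z hz => ?_, .ord 0,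
        fun _ => ∅, fun _ => Or.inr rfl, fun y hy => ?_⟩⟩
      · obtain ⟨γ, hγ, rfl⟩ := Ordinal.mem_toZFSet_iff.1 hz
        exact ih γ hγ hγ
      · rw [SetFml.sat_ord (isTransitive_Lset α) (isTransitive_Lset α y hy), push_zero]
        refine ⟨fun h => ?_, fun h => ?_⟩
        · obtain ⟨γ, hγ, rfl⟩ := Ordinal.mem_toZFSet_iff.1 h
          exact ZFSet.isOrdinal_toZFSet γ
        · rw [← h.toZFSet_rank_eq, Ordinal.toZFSet_mem_toZFSet_iff]
          exact rank_lt_of_mem_Lset hy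

/-- The value of a variable of either sort, as a set. -/
noncomputable def varVal {M N : ℕ} (x : Fin M → ZFSet.{u}) (ξ : Fin N → Ordinal.{u})
    (c : Fin M ⊕ Fin N) : ZFSet.{u} :=
  Sum.elim x (fun j => (ξ j).toZFSet) c

/-- The infinite assignment that gives the index `i` the value of the variable `e i`, or `∅`. -/
noncomputable def envVal {M N : ℕ} (e : ℕ → Option (Fin M ⊕ Fin N)) (x : Fin M → ZFSet.{u})
    (ξ : Fin N → Ordinal.{u}) (i : ℕ) : ZFSet.{u} :=
  (e i).elim ∅ (varVal x ξ)

/-- The relation `R α x ξ` is defined over `L_α` by a first-order formula which is the same for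
all `α ∈ K`. -/
def Dfn (K : Set Ordinal.{u}) {M N : ℕ}
    (R : Ordinal.{u} → (Fin M → ZFSet.{u}) → (Fin N → Ordinal.{u}) → Prop) : Prop :=
  ∃ (e : ℕ → Option (Fin M ⊕ Fin N)) (φ : SetFml), ∀ α ∈ K, ∀ x ξ, InDomain α x ξ →
    (φ.Sat (Lset α) (envVal e x ξ) ↔ R α x ξ)

/-- `p` reads off one of the variables. -/
def IsVar {M N : ℕ} (p : (Fin M → ZFSet.{u}) → (Fin N → Ordinal.{u}) → ZFSet.{u}) : Prop :=
  ∃ c : Fin M ⊕ Fin N, ∀ x ξ, p x ξ = varVal x ξ c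

lemma isVar_set {M N : ℕ} (i : Fin M) :
    IsVar fun (x : Fin M → ZFSet.{u}) (_ : Fin N → Ordinal.{u}) => x i :=
  ⟨.inl i, fun _ _ => rfl⟩

lemma isVar_ord {M N : ℕ} (j : Fin N) :
    IsVar fun (_ : Fin M → ZFSet.{u}) (ξ : Fin N → Ordinal.{u}) => (ξ j).toZFSet :=
  ⟨.inr j, fun _ _ => rfl⟩

lemma varVal_mem {α : Ordinal.{u}} {M N : ℕ} {x : Fin M → ZFSet.{u}} {ξ : Fin N → Ordinal.{u}}
    (h : InDomain α x ξ) (c : Fin M ⊕ Fin N) : varVal x ξ c ∈ Lset α := by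
  rcases c with i | j
  · exact h.1 i
  · exact toZFSet_mem_Lset.2 (h.2 j)

lemma envVal_mem {α : Ordinal.{u}} {M N : ℕ} {x : Fin M → ZFSet.{u}} {ξ : Fin N → Ordinal.{u}}
    (h : InDomain α x ξ) (e : ℕ → Option (Fin M ⊕ Fin N)) (i : ℕ) :
    envVal e x ξ i ∈ Lset α ∨ envVal e x ξ i = ∅ := by
  unfold envVal
  rcases e i with _ | c
  · exact Or.inr rfl
  · exact Or.inl (varVal_mem h c)

lemma IsVar.mem {α : Ordinal.{u}} {M N : ℕ} {x : Fin M → ZFSet.{u}} {ξ : Fin N → Ordinal.{u}}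
    {p : (Fin M → ZFSet.{u}) → (Fin N → Ordinal.{u}) → ZFSet.{u}} (hp : IsVar p)
    (h : InDomain α x ξ) : p x ξ ∈ Lset α := by
  obtain ⟨c, hc⟩ := hp
  exact hc x ξ ▸ varVal_mem h c

@[simp] lemma ext_zero {α : Type*} {n : ℕ} (a : α) (x : Fin n → α) : ext a x 0 = a := rfl
@[simp] lemma ext_succ {α : Type*} {n : ℕ} (a : α) (x : Fin n → α) (i : Fin n) :
    ext a x i.succ = x i := rfl

lemma InDomain.extS {α : Ordinal.{u}} {M N : ℕ} {x : Fin M → ZFSet.{u}} {ξ : Fin N → Ordinal.{u}}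
    (h : InDomain α x ξ) {y : ZFSet.{u}} (hy : y ∈ Lset α) : InDomain α (ext y x) ξ :=
  ⟨fun i => Fin.cases hy h.1 i, h.2⟩

lemma InDomain.extO {α : Ordinal.{u}} {M N : ℕ} {x : Fin M → ZFSet.{u}} {ξ : Fin N → Ordinal.{u}}
    (h : InDomain α x ξ) {β : Ordinal.{u}} (hβ : β < α) : InDomain α x (ext β ξ) :=
  ⟨h.1, fun i => Fin.cases hβ h.2 i⟩

lemma InDomain.mono {α β : Ordinal.{u}} {M N : ℕ} {x : Fin M → ZFSet.{u}}
    {ξ : Fin N → Ordinal.{u}} (h : InDomain α x ξ) (hαβ : α ≤ β) : InDomain β x ξ :=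
  ⟨fun i => Lset_mono hαβ (h.1 i), fun j => (h.2 j).trans_le hαβ⟩

namespace Dfn

variable {K : Set Ordinal.{u}} {M N : ℕ}
  {P Q : Ordinal.{u} → (Fin M → ZFSet.{u}) → (Fin N → Ordinal.{u}) → Prop}
  {p q r : (Fin M → ZFSet.{u}) → (Fin N → Ordinal.{u}) → ZFSet.{u}}

lemma congr (h : Dfn K P) (hPQ : ∀ α ∈ K, ∀ x ξ, InDomain α x ξ → (P α x ξ ↔ Q α x ξ)) :
    Dfn K Q := by
  obtain ⟨e, φ, h⟩ := h
  exact ⟨e, φ, fun α hα x ξ hx => (h α hα x ξ hx).trans (hPQ α hα x ξ hx)⟩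

lemma not (h : Dfn K P) : Dfn K fun α x ξ => ¬ P α x ξ := by
  obtain ⟨e, φ, h⟩ := h
  exact ⟨e, .neg φ, fun α hα x ξ hx => not_congr (h α hα x ξ hx)⟩

/-- The contexts of two formulas are merged by interleaving. -/
lemma and (hP : Dfn K P) (hQ : Dfn K Q) : Dfn K fun α x ξ => P α x ξ ∧ Q α x ξ := by
  obtain ⟨e₁, φ₁, h₁⟩ := hP
  obtain ⟨e₂, φ₂, h₂⟩ := hQ
  refine ⟨fun i => if i % 2 = 0 then e₁ (i / 2) else e₂ (i / 2),
    .and (φ₁.rename fun i => 2 * i) (φ₂.rename fun i => 2 * i + 1), fun α hα x ξ hx => ?_⟩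
  have key : ∀ i : ℕ, (2 * i + 1) / 2 = i := by omega
  beta_reduce
  rw [← h₁ α hα x ξ hx, ← h₂ α hα x ξ hx]
  simp [SetFml.Sat, SetFml.sat_rename, envVal, key]
  rfl

lemma or (hP : Dfn K P) (hQ : Dfn K Q) : Dfn K fun α x ξ => P α x ξ ∨ Q α x ξ :=
  (hP.not.and hQ.not).not.congr fun _ _ _ _ _ => by tauto

lemma imp (hP : Dfn K P) (hQ : Dfn K Q) : Dfn K fun α x ξ => P α x ξ → Q α x ξ :=
  (hP.and hQ.not).not.congr fun _ _ _ _ _ => by tauto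

lemma iff (hP : Dfn K P) (hQ : Dfn K Q) : Dfn K fun α x ξ => P α x ξ ↔ Q α x ξ :=
  ((hP.imp hQ).and (hQ.imp hP)).congr fun _ _ _ _ _ => by tauto

lemma mem (hp : IsVar p) (hq : IsVar q) : Dfn K fun _ x ξ => p x ξ ∈ q x ξ := by
  obtain ⟨c, hc⟩ := hp
  obtain ⟨d, hd⟩ := hq
  refine ⟨push (some c) fun _ => some d, .mem 0 1, fun α _ x ξ _ => ?_⟩
  beta_reduce
  rw [hc, hd]
  rfl

lemma eq (hp : IsVar p) (hq : IsVar q) : Dfn K fun _ x ξ => p x ξ = q x ξ := by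
  obtain ⟨c, hc⟩ := hp
  obtain ⟨d, hd⟩ := hq
  refine ⟨push (some c) fun _ => some d, .eq 0 1, fun α _ x ξ hx => ?_⟩
  beta_reduce
  rw [hc, hd, SetFml.sat_eq (isTransitive_Lset α) (envVal_mem hx _ _) (envVal_mem hx _ _)]
  rfl

lemma isOrdinal (hp : IsVar p) : Dfn K fun _ x ξ => (p x ξ).IsOrdinal := by
  obtain ⟨c, hc⟩ := hp
  refine ⟨fun _ => some c, .ord 0, fun α _ x ξ hx => ?_⟩
  beta_reduce
  rw [hc, SetFml.sat_ord (isTransitive_Lset α) (isTransitive_Lset α _ (varVal_mem hx c))]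
  rfl

lemma eq_empty (hp : IsVar p) : Dfn K fun _ x ξ => p x ξ = ∅ := by
  obtain ⟨c, hc⟩ := hp
  refine ⟨push (some c) fun _ => none, .eq 0 1, fun α _ x ξ hx => ?_⟩
  beta_reduce
  rw [hc, SetFml.sat_eq (isTransitive_Lset α) (envVal_mem hx _ _) (envVal_mem hx _ _)]
  rfl

lemma true : Dfn K fun _ (_ : Fin M → ZFSet.{u}) (_ : Fin N → Ordinal.{u}) => True :=
  ⟨fun _ => none, .neg (.mem 0 0), fun _ _ _ _ _ => by simp [SetFml.Sat, ZFSet.mem_irrefl]⟩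

lemma exists_mem_Lset {R : Ordinal.{u} → (Fin M → ZFSet.{u}) → (Fin N → Ordinal.{u}) →
      ZFSet.{u} → Prop}
    (h : Dfn K fun α (z : Fin (M + 1) → ZFSet.{u}) ξ => R α (fun i => z i.succ) ξ (z 0)) :
    Dfn K fun α x ξ => ∃ y ∈ Lset α, R α x ξ y := by
  obtain ⟨e, φ, h⟩ := h
  refine ⟨fun i => match e i with
      | some (.inl i) => Fin.cases (motive := fun _ => Option (Fin M ⊕ Fin N)) none
          (fun i => some (.inl i)) i
      | some (.inr j) => some (.inr j)
      | none => none,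
    .ex (φ.rename fun i => if e i = some (.inl 0) then 0 else i + 1), fun α hα x ξ hx => ?_⟩
  simp only [SetFml.Sat, SetFml.sat_rename]
  refine exists_congr fun y => and_congr_right fun hy => ?_
  refine Iff.trans (iff_of_eq ?_) (h α hα (ext y x) ξ (hx.extS hy))
  congr 1
  funext i
  rcases hei : e i with _ | (c | c)
  · simp [envVal, hei]
  · induction c using Fin.cases with
    | zero => simp [envVal, hei, varVal]
    | succ c => simp [envVal, hei, varVal]
  · simp [envVal, hei, varVal]

lemma forall_mem_Lset {R : Ordinal.{u} → (Fin M → ZFSet.{u}) → (Fin N → Ordinal.{u}) →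
      ZFSet.{u} → Prop}
    (h : Dfn K fun α (z : Fin (M + 1) → ZFSet.{u}) ξ => R α (fun i => z i.succ) ξ (z 0)) :
    Dfn K fun α x ξ => ∀ y ∈ Lset α, R α x ξ y :=
  (exists_mem_Lset (R := fun α x ξ y => ¬ R α x ξ y) h.not).not.congr fun _ _ _ _ _ => by
    push Not; rfl

lemma exists_mem {R : Ordinal.{u} → (Fin M → ZFSet.{u}) → (Fin N → Ordinal.{u}) →
      ZFSet.{u} → Prop} (hp : IsVar p)
    (h : Dfn K fun α (z : Fin (M + 1) → ZFSet.{u}) ξ => R α (fun i => z i.succ) ξ (z 0)) :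
    Dfn K fun α x ξ => ∃ y ∈ p x ξ, R α x ξ y := by
  refine (exists_mem_Lset (R := fun α x ξ y => y ∈ p x ξ ∧ R α x ξ y) (and (mem (isVar_set 0) ?_)
    h)).congr fun α _ x ξ hx => ?_
  · obtain ⟨c, hc⟩ := hp
    refine ⟨c.map Fin.succ id, fun z ξ => ?_⟩
    beta_reduce
    rw [hc]
    cases c <;> rfl
  · exact ⟨fun ⟨y, _, h⟩ => ⟨y, h⟩, fun ⟨y, hy, h⟩ =>
      ⟨y, isTransitive_Lset α _ (hp.mem hx) hy, hy, h⟩⟩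

lemma forall_mem {R : Ordinal.{u} → (Fin M → ZFSet.{u}) → (Fin N → Ordinal.{u}) →
      ZFSet.{u} → Prop} (hp : IsVar p)
    (h : Dfn K fun α (z : Fin (M + 1) → ZFSet.{u}) ξ => R α (fun i => z i.succ) ξ (z 0)) :
    Dfn K fun α x ξ => ∀ y ∈ p x ξ, R α x ξ y :=
  (exists_mem (R := fun α x ξ y => ¬ R α x ξ y) hp h.not).not.congr fun _ _ _ _ _ => by
    push Not; rfl

/-- Substitution of variables for variables; ordinals may take the place of sets. -/
lemma reindex {M' N' : ℕ} (h : Dfn K P) (f : Fin M → Fin M' ⊕ Fin N') (g : Fin N → Fin N') :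
    Dfn K fun α x ξ => P α (fun i => varVal x ξ (f i)) fun j => ξ (g j) := by
  obtain ⟨e, φ, h⟩ := h
  refine ⟨fun i => (e i).map (Sum.elim f fun j => .inr (g j)), φ, fun α hα x ξ hx => ?_⟩
  beta_reduce
  rw [← h α hα _ _ ⟨fun i => varVal_mem hx (f i), fun j => hx.2 (g j)⟩]
  refine iff_of_eq ?_
  congr 1
  funext i
  simp only [envVal]
  rcases e i with _ | (c | c) <;> rfl

lemma comp₂ {R : Ordinal.{u} → ZFSet.{u} → ZFSet.{u} → Prop}
    (h : Dfn K fun α (x : Fin 2 → ZFSet.{u}) (_ : Fin 0 → Ordinal.{u}) => R α (x 0) (x 1))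
    (hp : IsVar p) (hq : IsVar q) : Dfn K fun α x ξ => R α (p x ξ) (q x ξ) := by
  obtain ⟨c, hc⟩ := hp
  obtain ⟨d, hd⟩ := hq
  exact (h.reindex ![c, d] Fin.elim0).congr fun α _ x ξ _ => by rw [hc, hd]; rfl

lemma comp₃ {R : Ordinal.{u} → ZFSet.{u} → ZFSet.{u} → ZFSet.{u} → Prop}
    (h : Dfn K fun α (x : Fin 3 → ZFSet.{u}) (_ : Fin 0 → Ordinal.{u}) => R α (x 0) (x 1) (x 2))
    (hp : IsVar p) (hq : IsVar q) (hr : IsVar r) :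
    Dfn K fun α x ξ => R α (p x ξ) (q x ξ) (r x ξ) := by
  obtain ⟨c, hc⟩ := hp
  obtain ⟨d, hd⟩ := hq
  obtain ⟨e, he⟩ := hr
  exact (h.reindex ![c, d, e] Fin.elim0).congr fun α _ x ξ _ => by rw [hc, hd, he]; rfl

lemma exists_lt {R : Ordinal.{u} → (Fin M → ZFSet.{u}) → (Fin N → Ordinal.{u}) →
      Ordinal.{u} → Prop}
    (h : Dfn K fun α x (ζ : Fin (N + 1) → Ordinal.{u}) => R α x (fun j => ζ j.succ) (ζ 0)) :
    Dfn K fun α x ξ => ∃ β < α, R α x ξ β := by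
  obtain ⟨e, φ, h⟩ := h
  -- the bound ordinal is replaced by a bound set variable which denotes an ordinal
  let e' : ℕ → Option (Fin (M + 1) ⊕ Fin N) := fun i => (e i).map <| Sum.elim (fun i => .inl i.succ)
    (Fin.cases (.inl 0) fun j => .inr j)
  have h' : Dfn K fun α (z : Fin (M + 1) → ZFSet.{u}) ξ => φ.Sat (Lset α) (envVal e' z ξ) :=
    ⟨e', φ, fun _ _ _ _ _ => Iff.rfl⟩
  refine (exists_mem_Lset (R := fun α x ξ y => y.IsOrdinal ∧ φ.Sat (Lset α) (envVal e' (ext y x) ξ))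
    ((isOrdinal (isVar_set 0)).and (h'.congr fun α _ z ξ _ => ?_))).congr fun α hα x ξ hx => ?_
  · rw [show ext (z 0) (fun i => z i.succ) = z from Fin.cons_self_tail z]
  · have key : ∀ β < α, (φ.Sat (Lset α) (envVal e' (ext β.toZFSet x) ξ) ↔ R α x ξ β) := by
      intro β hβ
      refine Iff.trans (iff_of_eq ?_) (h α hα x (ext β ξ) (hx.extO hβ))
      congr 1
      funext i
      simp only [envVal, e']
      rcases e i with _ | (c | c)
      · rfl
      · rfl
      · induction c using Fin.cases <;> rfl
    constructor
    · rintro ⟨y, hy, ho, hs⟩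
      rw [← ho.toZFSet_rank_eq] at hs
      exact ⟨y.rank, rank_lt_of_mem_Lset hy, (key _ (rank_lt_of_mem_Lset hy)).1 hs⟩
    · rintro ⟨β, hβ, hs⟩
      exact ⟨β.toZFSet, toZFSet_mem_Lset.2 hβ, ZFSet.isOrdinal_toZFSet β, (key β hβ).2 hs⟩

lemma forall_lt {R : Ordinal.{u} → (Fin M → ZFSet.{u}) → (Fin N → Ordinal.{u}) →
      Ordinal.{u} → Prop}
    (h : Dfn K fun α x (ζ : Fin (N + 1) → Ordinal.{u}) => R α x (fun j => ζ j.succ) (ζ 0)) :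
    Dfn K fun α x ξ => ∀ β < α, R α x ξ β :=
  (exists_lt (R := fun α x ξ y => ¬ R α x ξ y) h.not).not.congr fun _ _ _ _ _ => by
    push Not; rfl

/-- A set which is first-order definable over `L_γ` belongs to `L_{γ+1}`. -/
lemma sep_mem {R : Ordinal.{u} → (Fin M → ZFSet.{u}) → (Fin N → Ordinal.{u}) → ZFSet.{u} → Prop}
    (h : Dfn K fun α (z : Fin (M + 1) → ZFSet.{u}) ξ => R α (fun i => z i.succ) ξ (z 0))
    {γ : Ordinal.{u}} (hγ : γ ∈ K) {x : Fin M → ZFSet.{u}} {ξ : Fin N → Ordinal.{u}}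
    (hx : InDomain γ x ξ) : ZFSet.sep (R γ x ξ) (Lset γ) ∈ Lset (γ + 1) := by
  obtain ⟨e, φ, h⟩ := h
  rw [Lset_add_one, mem_defPow (isTransitive_Lset γ)]
  -- the separated variable is moved to the index `0`
  refine ⟨ZFSet.sep_subset, φ.rename fun i => if e i = some (.inl 0) then 0 else i + 1,
    envVal (fun i => match e i with
      | some (.inl i) => Fin.cases (motive := fun _ => Option (Fin M ⊕ Fin N)) none
          (fun i => some (.inl i)) i
      | some (.inr j) => some (.inr j)
      | none => none) x ξ, envVal_mem hx _, fun y hy => ?_⟩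
  rw [ZFSet.mem_sep, and_iff_right hy, SetFml.sat_rename]
  refine Iff.trans (h γ hγ (ext y x) ξ (hx.extS hy)).symm (iff_of_eq ?_)
  congr 1
  funext i
  rcases hei : e i with _ | (c | c)
  · simp [envVal, hei]
  · induction c using Fin.cases with
    | zero => simp [envVal, hei, varVal]
    | succ c => simp [envVal, hei, varVal]
  · simp [envVal, hei, varVal]

end Dfn

/-! ### Closure properties of limit stages -/

namespace Dfn

variable {K : Set Ordinal.{u}} {M N : ℕ}
  {p q r : (Fin M → ZFSet.{u}) → (Fin N → Ordinal.{u}) → ZFSet.{u}}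

lemma eq_upair (hp : IsVar p) (hq : IsVar q) (hr : IsVar r) :
    Dfn K fun _ x ξ => p x ξ = {q x ξ, r x ξ} := by
  have h : Dfn K fun _ (x : Fin 3 → ZFSet.{u}) (_ : Fin 0 → Ordinal.{u}) => x 0 = {x 1, x 2} := by
    have h' : Dfn K fun _ (x : Fin 3 → ZFSet.{u}) (_ : Fin 0 → Ordinal.{u}) =>
        x 1 ∈ x 0 ∧ x 2 ∈ x 0 ∧ ∀ w ∈ x 0, w = x 1 ∨ w = x 2 :=
      and (mem (isVar_set _) (isVar_set _)) (and (mem (isVar_set _) (isVar_set _))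
        (forall_mem (isVar_set _) (or (eq (isVar_set _) (isVar_set _))
          (eq (isVar_set _) (isVar_set _)))))
    refine h'.congr fun α _ x _ _ => ?_
    constructor
    · rintro ⟨h1, h2, h3⟩
      ext w
      rw [ZFSet.mem_pair]
      exact ⟨h3 w, by rintro (rfl | rfl) <;> assumption⟩
    · intro h
      rw [h]
      simp
  exact comp₃ (R := fun _ a b c => a = {b, c}) h hp hq hr

lemma eq_pair (hp : IsVar p) (hq : IsVar q) (hr : IsVar r) :
    Dfn K fun _ x ξ => p x ξ = ZFSet.pair (q x ξ) (r x ξ) := by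
  have h : Dfn K fun _ (x : Fin 3 → ZFSet.{u}) (_ : Fin 0 → Ordinal.{u}) =>
      x 0 = ZFSet.pair (x 1) (x 2) := by
    have h' : Dfn K fun _ (x : Fin 3 → ZFSet.{u}) (_ : Fin 0 → Ordinal.{u}) =>
        (∀ w ∈ x 0, w = {x 1, x 1} ∨ w = {x 1, x 2}) ∧
          (∃ w ∈ x 0, w = {x 1, x 1}) ∧ ∃ w ∈ x 0, w = {x 1, x 2} := by
      refine and (forall_mem (isVar_set _) (or ?_ ?_))
        (and (exists_mem (isVar_set _) ?_) (exists_mem (isVar_set _) ?_)) <;>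
      exact eq_upair (isVar_set _) (isVar_set _) (isVar_set _)
    refine h'.congr fun α _ x _ _ => ?_
    simp only [ZFSet.pair_eq_singleton]
    constructor
    · rintro ⟨h1, ⟨w, hw, rfl⟩, ⟨w, hw', rfl⟩⟩
      ext w
      rw [ZFSet.pair, ZFSet.mem_pair]
      exact ⟨h1 w, by rintro (rfl | rfl) <;> assumption⟩
    · intro h
      rw [h, ZFSet.pair]
      simp
  exact comp₃ (R := fun _ a b c => a = ZFSet.pair b c) h hp hq hr

lemma pair_mem (hp : IsVar p) (hq : IsVar q) (hr : IsVar r) :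
    Dfn K fun _ x ξ => ZFSet.pair (p x ξ) (q x ξ) ∈ r x ξ := by
  have h : Dfn K fun _ (x : Fin 3 → ZFSet.{u}) (_ : Fin 0 → Ordinal.{u}) =>
      ZFSet.pair (x 0) (x 1) ∈ x 2 := by
    have h' : Dfn K fun _ (x : Fin 3 → ZFSet.{u}) (_ : Fin 0 → Ordinal.{u}) =>
        ∃ w ∈ x 2, w = ZFSet.pair (x 0) (x 1) :=
      exists_mem (isVar_set _) (eq_pair (isVar_set _) (isVar_set _) (isVar_set _))
    exact h'.congr fun α _ x _ _ => by simp
  exact comp₃ (R := fun _ a b c => ZFSet.pair a b ∈ c) h hp hq hr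

lemma subset (hp : IsVar p) (hq : IsVar q) : Dfn K fun _ x ξ => p x ξ ⊆ q x ξ := by
  have h : Dfn K fun _ (x : Fin 2 → ZFSet.{u}) (_ : Fin 0 → Ordinal.{u}) => x 0 ⊆ x 1 :=
    (forall_mem (R := fun _ x _ w => w ∈ x 1) (isVar_set 0)
      (mem (isVar_set 0) (isVar_set 2))).congr fun α _ x _ _ => ZFSet.subset_def.symm
  exact comp₂ (R := fun _ a b => a ⊆ b) h hp hq

/-- A definable collection of elements of a stage before the limit stage `L_δ` is in `L_δ`. -/
lemma mem_of_limit {R : (Fin M → ZFSet.{u}) → (Fin N → Ordinal.{u}) → ZFSet.{u} → Prop}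
    (h : Dfn Set.univ fun _ (z : Fin (M + 1) → ZFSet.{u}) ξ => R (fun i => z i.succ) ξ (z 0))
    {δ : Ordinal.{u}} (hδ : Order.IsSuccLimit δ) {x : Fin M → ZFSet.{u}} {ξ : Fin N → Ordinal.{u}}
    (hx : InDomain δ x ξ) {γ : Ordinal.{u}} (hγ : γ < δ) :
    ZFSet.sep (R x ξ) (Lset γ) ∈ Lset δ := by
  obtain ⟨γ', hγ', hx'⟩ := exists_lt_forall_mem_Lset hδ fun c => varVal_mem hx c
  have hμ : max γ γ' < δ := max_lt hγ hγ'
  have hy : ∀ γ'' < δ, γ' ≤ γ'' → γ < γ'' → ZFSet.sep (R x ξ) (Lset γ) ∈ Lset δ := by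
    intro γ'' h1 h2 h3
    have := sep_mem (M := M + 1) (K := Set.univ) (γ := γ'') (x := ext (Lset γ) x) (ξ := ξ)
      (R := fun _ z ξ y => y ∈ z 0 ∧ R (fun i => z i.succ) ξ y)
      ((mem (isVar_set 0) (isVar_set 1)).and
        (h.reindex (Fin.cases (.inl 0) fun i => .inl i.succ.succ) id)) trivial
      (InDomain.extS ⟨fun i => Lset_mono h2 (hx' (.inl i)), fun j =>
        toZFSet_mem_Lset.1 (Lset_mono h2 (hx' (.inr j)))⟩ (Lset_mem_Lset h3))
    refine Lset_mono (hδ.add_one_lt h1).le ?_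
    convert this using 1
    ext y
    simp only [ZFSet.mem_sep, ext_zero, ext_succ]
    exact ⟨fun h => ⟨Lset_mono h3.le h.1, h⟩, fun h => h.2⟩
  exact hy (max γ γ' + 1) (hδ.add_one_lt hμ)
    ((le_max_right _ _).trans (le_add_of_nonneg_right zero_le_one))
    ((le_max_left _ _).trans_lt (Order.lt_add_one_iff.2 le_rfl))

end Dfn

lemma upair_mem_Lset {γ : Ordinal.{u}} {x y : ZFSet.{u}} (hx : x ∈ Lset γ) (hy : y ∈ Lset γ) :
    ({x, y} : ZFSet.{u}) ∈ Lset (γ + 1) := by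
  have := Dfn.sep_mem (M := 2) (N := 0) (K := Set.univ) (γ := γ) (x := ![x, y]) (ξ := Fin.elim0)
    (R := fun _ z _ y => y = z 0 ∨ y = z 1)
    ((Dfn.eq (isVar_set 0) (isVar_set 1)).or (Dfn.eq (isVar_set 0) (isVar_set 2))) trivial
    ⟨fun i => by fin_cases i <;> assumption, fun j => j.elim0⟩
  convert this using 1
  ext z
  simp only [ZFSet.mem_sep, ZFSet.mem_pair, Matrix.cons_val_zero, Matrix.cons_val_one]
  exact ⟨fun h => ⟨by rcases h with rfl | rfl <;> assumption, h⟩, fun h => h.2⟩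

lemma pair_mem_Lset {γ : Ordinal.{u}} {x y : ZFSet.{u}} (hx : x ∈ Lset γ) (hy : y ∈ Lset γ) :
    ZFSet.pair x y ∈ Lset (γ + 1 + 1) := by
  have h := upair_mem_Lset (upair_mem_Lset hx hx) (upair_mem_Lset hx hy)
  rwa [ZFSet.pair_eq_singleton] at h

lemma mem_of_pair_mem_Lset {γ : Ordinal.{u}} {x y : ZFSet.{u}} (h : ZFSet.pair x y ∈ Lset γ) :
    x ∈ Lset γ ∧ y ∈ Lset γ := by
  have h1 : ({x, y} : ZFSet.{u}) ∈ Lset γ := isTransitive_Lset γ _ h (by simp [ZFSet.pair])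
  exact ⟨isTransitive_Lset γ _ h1 (by simp), isTransitive_Lset γ _ h1 (by simp)⟩

section Limit

variable {δ : Ordinal.{u}} {x y : ZFSet.{u}}

lemma pair_mem_Lset_limit (hδ : Order.IsSuccLimit δ) (hx : x ∈ Lset δ) (hy : y ∈ Lset δ) :
    ZFSet.pair x y ∈ Lset δ := by
  obtain ⟨γ, hγ, hx⟩ := Lset_exists_lt_of_limit hδ hx
  obtain ⟨γ', hγ', hy⟩ := Lset_exists_lt_of_limit hδ hy
  exact Lset_mono (hδ.add_one_lt (hδ.add_one_lt (max_lt hγ hγ'))).le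
    (pair_mem_Lset (Lset_mono (le_max_left _ _) hx) (Lset_mono (le_max_right _ _) hy))

lemma upair_mem_Lset_limit (hδ : Order.IsSuccLimit δ) (hx : x ∈ Lset δ) (hy : y ∈ Lset δ) :
    ({x, y} : ZFSet.{u}) ∈ Lset δ := by
  obtain ⟨γ, hγ, hx⟩ := Lset_exists_lt_of_limit hδ hx
  obtain ⟨γ', hγ', hy⟩ := Lset_exists_lt_of_limit hδ hy
  exact Lset_mono (hδ.add_one_lt (max_lt hγ hγ')).le
    (upair_mem_Lset (Lset_mono (le_max_left _ _) hx) (Lset_mono (le_max_right _ _) hy))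

lemma insert_mem_Lset_limit (hδ : Order.IsSuccLimit δ) (hx : x ∈ Lset δ) (hy : y ∈ Lset δ) :
    (insert x y : ZFSet.{u}) ∈ Lset δ := by
  obtain ⟨γ, hγ, hx'⟩ := Lset_exists_lt_of_limit hδ hx
  obtain ⟨γ', hγ', hy'⟩ := subset_Lset_of_mem hy
  have := Dfn.mem_of_limit (M := 2) (N := 0) (x := ![x, y]) (ξ := Fin.elim0)
    (R := fun z _ w => w = z 0 ∨ w ∈ z 1)
    ((Dfn.eq (isVar_set 0) (isVar_set 1)).or (Dfn.mem (isVar_set 0) (isVar_set 2))) hδ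
    ⟨fun i => by fin_cases i <;> assumption, fun j => j.elim0⟩ (max_lt hγ hγ')
  convert this using 1
  ext z
  simp only [ZFSet.mem_sep, ZFSet.mem_insert_iff, Matrix.cons_val_zero, Matrix.cons_val_one]
  refine ⟨fun h => ⟨?_, h⟩, fun h => h.2⟩
  rcases h with rfl | h
  · exact Lset_mono (le_max_left _ _) hx'
  · exact Lset_mono (le_max_right _ _) (hy' h)

lemma union_mem_Lset_limit (hδ : Order.IsSuccLimit δ) (hx : x ∈ Lset δ) (hy : y ∈ Lset δ) :
    (x ∪ y : ZFSet.{u}) ∈ Lset δ := by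
  obtain ⟨γ, hγ, hx'⟩ := subset_Lset_of_mem hx
  obtain ⟨γ', hγ', hy'⟩ := subset_Lset_of_mem hy
  have := Dfn.mem_of_limit (M := 2) (N := 0) (x := ![x, y]) (ξ := Fin.elim0)
    (R := fun z _ w => w ∈ z 0 ∨ w ∈ z 1)
    ((Dfn.mem (isVar_set 0) (isVar_set 1)).or (Dfn.mem (isVar_set 0) (isVar_set 2))) hδ
    ⟨fun i => by fin_cases i <;> assumption, fun j => j.elim0⟩ (max_lt hγ hγ')
  convert this using 1
  ext z
  simp only [ZFSet.mem_sep, ZFSet.mem_union, Matrix.cons_val_zero, Matrix.cons_val_one]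
  refine ⟨fun h => ⟨?_, h⟩, fun h => h.2⟩
  rcases h with h | h
  · exact Lset_mono (le_max_left _ _) (hx' h)
  · exact Lset_mono (le_max_right _ _) (hy' h)

end Limit

/-! ### The definable power set by way of an inductively generated family of relations -/

/-- The set coding a finite list, by iterated pairs. -/
noncomputable def listCode : List ZFSet.{u} → ZFSet.{u}
  | [] => ∅
  | y :: l => ZFSet.pair y (listCode l)

/-- The infinite assignment given by a list, continued by `∅`. -/
noncomputable def listEnv (l : List ZFSet.{u}) (i : ℕ) : ZFSet.{u} := l.getD i ∅

lemma listEnv_cons (y : ZFSet.{u}) (l : List ZFSet.{u}) :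
    listEnv (y :: l) = push y (listEnv l) := by
  funext i; cases i <;> rfl

lemma pair_ne_empty (x y : ZFSet.{u}) : ZFSet.pair x y ≠ ∅ := fun h =>
  ZFSet.notMem_empty {x} (h ▸ by simp [ZFSet.pair])

lemma listCode_eq_pair {l : List ZFSet.{u}} {y z : ZFSet.{u}} (h : listCode l = ZFSet.pair y z) :
    ∃ l', l = y :: l' ∧ z = listCode l' := by
  cases l with
  | nil => exact (pair_ne_empty _ _ h.symm).elim
  | cons w l =>
    obtain ⟨rfl, rfl⟩ := ZFSet.pair_inj.1 h
    exact ⟨l, rfl, rfl⟩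

/-- The operations on finitary relations over a set (a relation being a set of codes of lists) which
generate the first-order definable relations: adding a variable, transposing the first two
variables, restricting the first two variables by the membership relation, existential
quantification, and difference. -/
inductive RelOp
  | pad
  | swap
  | mem
  | proj
  | diff

/-- `y` belongs to the relation over `a` which results from `S` and `T` by the operation. -/
def RelOp.In (a S T y : ZFSet.{u}) : RelOp → Prop
  | pad => ∃ x ∈ a, ∃ s ∈ S, y = ZFSet.pair x s
  | swap => ∃ x ∈ a, ∃ z ∈ a, ∃ s, y = ZFSet.pair x (ZFSet.pair z s) ∧
      ZFSet.pair z (ZFSet.pair x s) ∈ S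
  | mem => ∃ x ∈ a, ∃ z ∈ a, ∃ s ∈ S, y = ZFSet.pair x (ZFSet.pair z s) ∧ x ∈ z
  | proj => ∃ x ∈ a, ZFSet.pair x y ∈ S
  | diff => y ∈ S ∧ y ∉ T

/-- The relations over `a` generated by the operations. -/
inductive Der (a : ZFSet.{u}) : ZFSet.{u} → Prop
  | base : Der a {∅}
  | step {S T R : ZFSet.{u}} (o : RelOp) (hS : Der a S) (hT : Der a T)
      (h : ∀ y, y ∈ R ↔ o.In a S T y) : Der a R

lemma Der.exists_list {a R : ZFSet.{u}} (h : Der a R) {z : ZFSet.{u}} (hz : z ∈ R) :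
    ∃ l : List ZFSet.{u}, (∀ y ∈ l, y ∈ a) ∧ z = listCode l := by
  induction h generalizing z with
  | base => exact ⟨[], by simp, ZFSet.mem_singleton.1 hz⟩
  | step o _ _ h ih₁ ih₂ =>
    rw [h] at hz
    cases o with
    | pad =>
      obtain ⟨x, hx, s, hs, rfl⟩ := hz
      obtain ⟨l, hl, rfl⟩ := ih₁ hs
      exact ⟨x :: l, by simpa [hx] using hl, rfl⟩
    | swap =>
      obtain ⟨x, hx, w, hw, s, rfl, hs⟩ := hz
      obtain ⟨l, hl, h₁⟩ := ih₁ hs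
      obtain ⟨l, rfl, h₂⟩ := listCode_eq_pair h₁.symm
      obtain ⟨l, rfl, rfl⟩ := listCode_eq_pair h₂.symm
      exact ⟨x :: w :: l, fun y hy => hl y (by simp at hy ⊢; tauto), rfl⟩
    | mem =>
      obtain ⟨x, hx, w, hw, s, hs, rfl, -⟩ := hz
      obtain ⟨l, hl, rfl⟩ := ih₁ hs
      exact ⟨x :: w :: l, by simpa [hx, hw] using hl, rfl⟩
    | proj =>
      obtain ⟨x, hx, hs⟩ := hz
      obtain ⟨l, hl, h⟩ := ih₁ hs
      obtain ⟨l, rfl, rfl⟩ := listCode_eq_pair h.symm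
      exact ⟨l, fun y hy => hl y (by simp [hy]), rfl⟩
    | diff => exact ih₁ hz.1

/-- Every generated relation is first-order definable. -/
lemma Der.exists_sat {a R : ZFSet.{u}} (h : Der a R) (n : ℕ) : ∃ φ : SetFml,
    ∀ l : List ZFSet.{u}, l.length = n → (∀ y ∈ l, y ∈ a) →
      (listCode l ∈ R ↔ φ.Sat a (listEnv l)) := by
  have hfalse : ∀ s : ℕ → ZFSet.{u}, ¬ (SetFml.mem 0 0).Sat a s := fun s => ZFSet.mem_irrefl _
  induction h generalizing n with
  | base =>
    cases n with
    | zero =>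
      refine ⟨.neg (.mem 0 0), fun l hl _ => ?_⟩
      obtain rfl := List.length_eq_zero_iff.1 hl
      exact iff_of_true (by simp [listCode]) (hfalse _)
    | succ n =>
      refine ⟨.mem 0 0, fun l hl _ => iff_of_false (fun h => ?_) (hfalse _)⟩
      obtain ⟨y, l, rfl⟩ := List.exists_cons_of_length_eq_add_one hl
      exact pair_ne_empty _ _ (ZFSet.mem_singleton.1 h)
  | step o _ _ h ih₁ ih₂ =>
    cases o with
    | pad =>
      cases n with
      | zero =>
        refine ⟨.mem 0 0, fun l hl _ => iff_of_false (fun h' => ?_) (hfalse _)⟩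
        obtain rfl := List.length_eq_zero_iff.1 hl
        obtain ⟨x, hx, s, hs, h'⟩ := (h _).1 h'
        exact pair_ne_empty _ _ h'.symm
      | succ n =>
        obtain ⟨φ, hφ⟩ := ih₁ n
        refine ⟨φ.rename Nat.succ, fun l hl ha => ?_⟩
        obtain ⟨y, l, rfl⟩ := List.exists_cons_of_length_eq_add_one hl
        rw [h, SetFml.sat_rename, listEnv_cons]
        refine Iff.trans ⟨?_, fun hs => ⟨y, ha y (by simp), _, hs, rfl⟩⟩
          (hφ l (by simpa using hl) fun y hy => ha y (by simp [hy]))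
        rintro ⟨x, hx, s, hs, h'⟩
        rwa [(ZFSet.pair_inj.1 h').2]
    | swap =>
      rcases n with _ | _ | n
      · refine ⟨.mem 0 0, fun l hl _ => iff_of_false (fun h' => ?_) (hfalse _)⟩
        obtain rfl := List.length_eq_zero_iff.1 hl
        obtain ⟨x, hx, z, hz, s, h', -⟩ := (h _).1 h'
        exact pair_ne_empty _ _ h'.symm
      · refine ⟨.mem 0 0, fun l hl _ => iff_of_false (fun h' => ?_) (hfalse _)⟩
        obtain ⟨y, rfl⟩ := List.length_eq_one_iff.1 hl
        obtain ⟨x, hx, z, hz, s, h', -⟩ := (h _).1 h'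
        exact pair_ne_empty _ _ (ZFSet.pair_inj.1 h').2.symm
      · obtain ⟨φ, hφ⟩ := ih₁ (n + 2)
        refine ⟨φ.rename (push 1 (push 0 fun i => i + 2)), fun l hl ha => ?_⟩
        obtain ⟨y, l, rfl⟩ := List.exists_cons_of_length_eq_add_one hl
        obtain ⟨w, l, rfl⟩ := List.exists_cons_of_length_eq_add_one (Nat.succ_injective hl)
        have hs := hφ (w :: y :: l) (by simpa using hl) fun z hz => ha z (by simp at hz ⊢; tauto)
        rw [h, SetFml.sat_rename]
        refine Iff.trans ⟨?_, fun hs => ⟨y, ha y (by simp), w, ha w (by simp), _, rfl, hs⟩⟩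
          (hs.trans (iff_of_eq ?_))
        · rintro ⟨x, hx, z, hz, s, h', h''⟩
          obtain ⟨rfl, h₂⟩ := ZFSet.pair_inj.1 h'
          obtain ⟨rfl, rfl⟩ := ZFSet.pair_inj.1 h₂
          exact h''
        · congr 1
          funext i
          rcases i with _ | _ | i <;> rfl
    | mem =>
      rcases n with _ | _ | n
      · refine ⟨.mem 0 0, fun l hl _ => iff_of_false (fun h' => ?_) (hfalse _)⟩
        obtain rfl := List.length_eq_zero_iff.1 hl
        obtain ⟨x, hx, z, hz, s, hs, h', -⟩ := (h _).1 h'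
        exact pair_ne_empty _ _ h'.symm
      · refine ⟨.mem 0 0, fun l hl _ => iff_of_false (fun h' => ?_) (hfalse _)⟩
        obtain ⟨y, rfl⟩ := List.length_eq_one_iff.1 hl
        obtain ⟨x, hx, z, hz, s, hs, h', -⟩ := (h _).1 h'
        exact pair_ne_empty _ _ (ZFSet.pair_inj.1 h').2.symm
      · obtain ⟨φ, hφ⟩ := ih₁ n
        refine ⟨.and (.mem 0 1) (φ.rename fun i => i + 2), fun l hl ha => ?_⟩
        obtain ⟨y, l, rfl⟩ := List.exists_cons_of_length_eq_add_one hl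
        obtain ⟨w, l, rfl⟩ := List.exists_cons_of_length_eq_add_one (Nat.succ_injective hl)
        rw [h, SetFml.Sat, SetFml.sat_rename]
        change _ ↔ y ∈ w ∧ φ.Sat a (listEnv l)
        rw [← hφ l (by simpa using hl) fun z hz => ha z (by simp [hz])]
        refine ⟨?_, fun hs => ⟨y, ha y (by simp), w, ha w (by simp), _, hs.2, rfl, hs.1⟩⟩
        rintro ⟨x, hx, z, hz, s, hs, h', h''⟩
        obtain ⟨rfl, h₂⟩ := ZFSet.pair_inj.1 h'
        obtain ⟨rfl, rfl⟩ := ZFSet.pair_inj.1 h₂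
        exact ⟨h'', hs⟩
    | proj =>
      obtain ⟨φ, hφ⟩ := ih₁ (n + 1)
      refine ⟨.ex φ, fun l hl ha => ?_⟩
      rw [h]
      refine exists_congr fun y => and_congr_right fun hy => ?_
      rw [← listEnv_cons]
      exact hφ (y :: l) (by simpa using hl) fun z hz => by
        rcases List.mem_cons.1 hz with rfl | hz
        · exact hy
        · exact ha z hz
    | diff =>
      obtain ⟨φ, hφ⟩ := ih₁ n
      obtain ⟨ψ, hψ⟩ := ih₂ n
      refine ⟨.and φ (.neg ψ), fun l hl ha => ?_⟩
      rw [h, SetFml.Sat, SetFml.Sat, ← hφ l hl ha, ← hψ l hl ha]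
      rfl

/-- The relations resulting from the operations exist as sets. -/
def RelOp.Exists (a : ZFSet.{u}) : Prop :=
  ∀ (o : RelOp) (S T : ZFSet.{u}), Der a S → Der a T → ∃ R : ZFSet.{u}, ∀ y, y ∈ R ↔ o.In a S T y

section Complete

variable {a : ZFSet.{u}}

lemma Der.exists_full (hex : RelOp.Exists a) (n : ℕ) : ∃ R, Der a R ∧
    ∀ l : List ZFSet.{u}, l.length = n → (∀ y ∈ l, y ∈ a) → listCode l ∈ R := by
  induction n with
  | zero =>
    refine ⟨_, .base, fun l hl _ => ?_⟩
    obtain rfl := List.length_eq_zero_iff.1 hl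
    simp [listCode]
  | succ n ih =>
    obtain ⟨S, hS, h⟩ := ih
    obtain ⟨R, hR⟩ := hex .pad S S hS hS
    refine ⟨R, .step .pad hS hS hR, fun l hl ha => ?_⟩
    obtain ⟨y, l, rfl⟩ := List.exists_cons_of_length_eq_add_one hl
    exact (hR _).2 ⟨y, ha y (by simp), _, h l (by simpa using hl) fun y hy => ha y (by simp [hy]),
      rfl⟩

lemma Der.exists_diff (hex : RelOp.Exists a) {S T : ZFSet.{u}} (hS : Der a S) (hT : Der a T) :
    ∃ R, Der a R ∧ ∀ y, y ∈ R ↔ y ∈ S ∧ y ∉ T := by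
  obtain ⟨R, hR⟩ := hex .diff S T hS hT
  exact ⟨R, .step .diff hS hT hR, hR⟩

lemma Der.exists_pad (hex : RelOp.Exists a) {S : ZFSet.{u}} (hS : Der a S) : ∃ R, Der a R ∧
    ∀ y ∈ a, ∀ s, (ZFSet.pair y s ∈ R ↔ s ∈ S) := by
  obtain ⟨R, hR⟩ := hex .pad S S hS hS
  refine ⟨R, .step .pad hS hS hR, fun y hy s => (hR _).trans ⟨?_, fun h => ⟨y, hy, s, h, rfl⟩⟩⟩
  rintro ⟨x, hx, t, ht, h⟩
  rwa [(ZFSet.pair_inj.1 h).2]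

lemma Der.exists_swap (hex : RelOp.Exists a) {S : ZFSet.{u}} (hS : Der a S) :
    ∃ R, Der a R ∧ ∀ y ∈ a, ∀ z ∈ a, ∀ s,
    (ZFSet.pair y (ZFSet.pair z s) ∈ R ↔ ZFSet.pair z (ZFSet.pair y s) ∈ S) := by
  obtain ⟨R, hR⟩ := hex .swap S S hS hS
  refine ⟨R, .step .swap hS hS hR, fun y hy z hz s => (hR _).trans
    ⟨?_, fun h => ⟨y, hy, z, hz, s, rfl, h⟩⟩⟩
  rintro ⟨x, hx, w, hw, t, h, h'⟩
  obtain ⟨rfl, h₂⟩ := ZFSet.pair_inj.1 h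
  obtain ⟨rfl, rfl⟩ := ZFSet.pair_inj.1 h₂
  exact h'

/-- The atomic relations are generated. -/
lemma Der.exists_mem (hex : RelOp.Exists a) (n i j : ℕ) (hi : i < n) (hj : j < n) : ∃ R, Der a R ∧
    ∀ l : List ZFSet.{u}, l.length = n → (∀ y ∈ l, y ∈ a) →
      (listCode l ∈ R ↔ listEnv l i ∈ listEnv l j) := by
  have cons2 : ∀ {n : ℕ} {l : List ZFSet.{u}}, l.length = n + 2 → (∀ y ∈ l, y ∈ a) →
      ∃ x z l', l = x :: z :: l' ∧ x ∈ a ∧ z ∈ a ∧ l'.length = n ∧ ∀ y ∈ l', y ∈ a := by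
    intro n l hl ha
    obtain ⟨x, l, rfl⟩ := List.exists_cons_of_length_eq_add_one hl
    obtain ⟨z, l, rfl⟩ := List.exists_cons_of_length_eq_add_one (Nat.succ_injective hl)
    exact ⟨x, z, l, rfl, ha x (by simp), ha z (by simp), by simpa using hl,
      fun y hy => ha y (by simp [hy])⟩
  -- the membership relation between the first two variables
  have h01 : ∀ n, ∃ R, Der a R ∧ ∀ l : List ZFSet.{u}, l.length = n + 2 → (∀ y ∈ l, y ∈ a) →
      (listCode l ∈ R ↔ listEnv l 0 ∈ listEnv l 1) := by
    intro n
    obtain ⟨S, hS, h⟩ := Der.exists_full hex n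
    obtain ⟨R, hR⟩ := hex .mem S S hS hS
    refine ⟨R, .step .mem hS hS hR, fun l hl ha => ?_⟩
    obtain ⟨x, z, l, rfl, hx, hz, hl', ha'⟩ := cons2 hl ha
    refine (hR _).trans ⟨?_, fun h' => ⟨x, hx, z, hz, _, h l hl' ha', rfl, h'⟩⟩
    rintro ⟨x', hx', z', hz', s, hs, h', h''⟩
    obtain ⟨rfl, h₂⟩ := ZFSet.pair_inj.1 h'
    obtain ⟨rfl, rfl⟩ := ZFSet.pair_inj.1 h₂
    exact h''
  induction n generalizing i j with
  | zero => omega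
  | succ n ih =>
    rcases i with _ | i <;> rcases j with _ | j
    · obtain ⟨R, hR, h⟩ := Der.exists_diff hex (Der.base (a := a)) Der.base
      exact ⟨R, hR, fun l _ _ => iff_of_false (fun hl => ((h _).1 hl).2 ((h _).1 hl).1)
        (ZFSet.mem_irrefl _)⟩
    · obtain ⟨n, rfl⟩ : ∃ m, n = m + 1 := ⟨n - 1, by omega⟩
      rcases j with _ | j
      · exact h01 n
      · obtain ⟨S, hS, h⟩ := ih 0 (j + 1) (by omega) (by omega)
        obtain ⟨S', hS', h'⟩ := Der.exists_pad hex hS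
        obtain ⟨R, hR, h''⟩ := Der.exists_swap hex hS'
        refine ⟨R, hR, fun l hl ha => ?_⟩
        obtain ⟨x, z, l, rfl, hx, hz, hl', ha'⟩ := cons2 hl ha
        rw [listCode, listCode, h'' x hx z hz, h' z hz]
        exact h (x :: l) (by simp [hl']) (by simpa [hx] using ha')
    · obtain ⟨n, rfl⟩ : ∃ m, n = m + 1 := ⟨n - 1, by omega⟩
      rcases i with _ | i
      · obtain ⟨S, hS, h⟩ := h01 n
        obtain ⟨R, hR, h''⟩ := Der.exists_swap hex hS
        refine ⟨R, hR, fun l hl ha => ?_⟩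
        obtain ⟨x, z, l, rfl, hx, hz, hl', ha'⟩ := cons2 hl ha
        rw [listCode, listCode, h'' x hx z hz]
        exact h (z :: x :: l) (by simp [hl']) (by simpa [hx, hz] using ha')
      · obtain ⟨S, hS, h⟩ := ih (i + 1) 0 (by omega) (by omega)
        obtain ⟨S', hS', h'⟩ := Der.exists_pad hex hS
        obtain ⟨R, hR, h''⟩ := Der.exists_swap hex hS'
        refine ⟨R, hR, fun l hl ha => ?_⟩
        obtain ⟨x, z, l, rfl, hx, hz, hl', ha'⟩ := cons2 hl ha
        rw [listCode, listCode, h'' x hx z hz, h' z hz]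
        exact h (x :: l) (by simp [hl']) (by simpa [hx] using ha')
    · obtain ⟨S, hS, h⟩ := ih i j (by omega) (by omega)
      obtain ⟨R, hR, h'⟩ := Der.exists_pad hex hS
      refine ⟨R, hR, fun l hl ha => ?_⟩
      obtain ⟨y, l, rfl⟩ := List.exists_cons_of_length_eq_add_one hl
      rw [listCode, h' y (ha y (by simp))]
      exact h l (by simpa using hl) fun y hy => ha y (by simp [hy])

/-- Every first-order definable relation is generated. -/
lemma Der.exists_of_sat (hex : RelOp.Exists a) (φ : SetFml) (n : ℕ) (hn : φ.fv ≤ n) : ∃ R, Der a R ∧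
    ∀ l : List ZFSet.{u}, l.length = n → (∀ y ∈ l, y ∈ a) →
      (listCode l ∈ R ↔ φ.Sat a (listEnv l)) := by
  induction φ generalizing n with
  | mem i j =>
    simp only [SetFml.fv] at hn
    exact Der.exists_mem hex n i j (by omega) (by omega)
  | neg φ ih =>
    obtain ⟨S, hS, h⟩ := ih n hn
    obtain ⟨F, hF, h'⟩ := Der.exists_full hex n
    obtain ⟨R, hR, h''⟩ := Der.exists_diff hex hF hS
    refine ⟨R, hR, fun l hl ha => ?_⟩
    rw [h'', SetFml.Sat, h l hl ha, and_iff_right (h' l hl ha)]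
  | and φ ψ ih₁ ih₂ =>
    simp only [SetFml.fv] at hn
    obtain ⟨S, hS, h⟩ := ih₁ n (by omega)
    obtain ⟨T, hT, h'⟩ := ih₂ n (by omega)
    obtain ⟨R', hR', h''⟩ := Der.exists_diff hex hS hT
    obtain ⟨R, hR, h'''⟩ := Der.exists_diff hex hS hR'
    refine ⟨R, hR, fun l hl ha => ?_⟩
    rw [h''', h'', SetFml.Sat, h l hl ha, h' l hl ha]
    tauto
  | ex φ ih =>
    simp only [SetFml.fv] at hn
    obtain ⟨S, hS, h⟩ := ih (n + 1) (by omega)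
    obtain ⟨R, hR⟩ := hex .proj S S hS hS
    refine ⟨R, .step .proj hS hS hR, fun l hl ha => (hR _).trans ?_⟩
    refine exists_congr fun y => and_congr_right fun hy => ?_
    rw [← listEnv_cons]
    exact h (y :: l) (by simpa using hl) fun z hz => by
      rcases List.mem_cons.1 hz with rfl | hz
      · exact hy
      · exact ha z hz

end Complete

/-! ### Definability of the constructible hierarchy over limit stages -/

namespace Dfn

variable {K : Set Ordinal.{u}} {M N : ℕ}

lemma comp₄ {R : Ordinal.{u} → ZFSet.{u} → ZFSet.{u} → ZFSet.{u} → ZFSet.{u} → Prop}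
    {p q r s : (Fin M → ZFSet.{u}) → (Fin N → Ordinal.{u}) → ZFSet.{u}}
    (h : Dfn K fun α (x : Fin 4 → ZFSet.{u}) (_ : Fin 0 → Ordinal.{u}) =>
      R α (x 0) (x 1) (x 2) (x 3))
    (hp : IsVar p) (hq : IsVar q) (hr : IsVar r) (hs : IsVar s) :
    Dfn K fun α x ξ => R α (p x ξ) (q x ξ) (r x ξ) (s x ξ) := by
  obtain ⟨c, hc⟩ := hp
  obtain ⟨d, hd⟩ := hq
  obtain ⟨e, he⟩ := hr
  obtain ⟨f, hf⟩ := hs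
  exact (h.reindex ![c, d, e, f] Fin.elim0).congr fun α _ x ξ _ => by rw [hc, hd, he, hf]; rfl

lemma relOp_in (o : RelOp) : Dfn K fun _ (z : Fin 4 → ZFSet.{u}) (_ : Fin 0 → Ordinal.{u}) =>
    o.In (z 1) (z 2) (z 3) (z 0) := by
  cases o with
  | pad =>
    exact exists_mem (isVar_set _) (exists_mem (isVar_set _)
      (eq_pair (isVar_set _) (isVar_set _) (isVar_set _)))
  | swap =>
    have h : Dfn K fun α (z : Fin 4 → ZFSet.{u}) (_ : Fin 0 → Ordinal.{u}) =>
        ∃ x ∈ z 1, ∃ w ∈ z 1, ∃ s ∈ Lset α, (∃ t ∈ Lset α, t = ZFSet.pair w s ∧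
          z 0 = ZFSet.pair x t) ∧ ∃ t ∈ Lset α, t = ZFSet.pair x s ∧ ZFSet.pair w t ∈ z 2 :=
      exists_mem (isVar_set _) (exists_mem (isVar_set _) (exists_mem_Lset (and
        (exists_mem_Lset (and (eq_pair (isVar_set _) (isVar_set _) (isVar_set _))
          (eq_pair (isVar_set _) (isVar_set _) (isVar_set _))))
        (exists_mem_Lset (and (eq_pair (isVar_set _) (isVar_set _) (isVar_set _))
          (pair_mem (isVar_set _) (isVar_set _) (isVar_set _)))))))
    refine h.congr fun α _ z _ hz => ?_
    refine exists_congr fun x => and_congr_right fun _ => exists_congr fun w =>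
      and_congr_right fun _ => exists_congr fun s => ?_
    constructor
    · rintro ⟨-, ⟨t, -, rfl, h⟩, t', -, rfl, h'⟩
      exact ⟨h, h'⟩
    · rintro ⟨h, h'⟩
      have h1 := mem_of_pair_mem_Lset (h ▸ hz.1 0)
      have h2 := mem_of_pair_mem_Lset (isTransitive_Lset α _ (hz.1 2) h')
      exact ⟨(mem_of_pair_mem_Lset h1.2).2, ⟨_, h1.2, rfl, h⟩, _, h2.2, rfl, h'⟩
  | mem =>
    have h : Dfn K fun α (z : Fin 4 → ZFSet.{u}) (_ : Fin 0 → Ordinal.{u}) =>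
        ∃ x ∈ z 1, ∃ w ∈ z 1, ∃ s ∈ z 2, (∃ t ∈ Lset α, t = ZFSet.pair w s ∧
          z 0 = ZFSet.pair x t) ∧ x ∈ w :=
      exists_mem (isVar_set _) (exists_mem (isVar_set _) (exists_mem (isVar_set _) (and
        (exists_mem_Lset (and (eq_pair (isVar_set _) (isVar_set _) (isVar_set _))
          (eq_pair (isVar_set _) (isVar_set _) (isVar_set _))))
        (mem (isVar_set _) (isVar_set _)))))
    refine h.congr fun α _ z _ hz => ?_
    refine exists_congr fun x => and_congr_right fun _ => exists_congr fun w =>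
      and_congr_right fun _ => exists_congr fun s => and_congr_right fun _ =>
      and_congr_left fun _ => ?_
    constructor
    · rintro ⟨t, -, rfl, h⟩
      exact h
    · exact fun h => ⟨_, (mem_of_pair_mem_Lset (h ▸ hz.1 0)).2, rfl, h⟩
  | proj =>
    exact exists_mem (isVar_set _) (pair_mem (isVar_set _) (isVar_set _) (isVar_set _))
  | diff =>
    exact and (mem (isVar_set _) (isVar_set _)) (not (mem (isVar_set _) (isVar_set _)))

lemma exists_relOp {P : RelOp → Ordinal.{u} → (Fin M → ZFSet.{u}) → (Fin N → Ordinal.{u}) → Prop}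
    (h : ∀ o, Dfn K (P o)) : Dfn K fun α x ξ => ∃ o, P o α x ξ := by
  refine ((h .pad).or ((h .swap).or ((h .mem).or ((h .proj).or (h .diff))))).congr
    fun α _ x ξ _ => ⟨?_, ?_⟩
  · rintro (h | h | h | h | h) <;> exact ⟨_, h⟩
  · rintro ⟨o, h⟩
    cases o <;> tauto

end Dfn

lemma RelOp.In.mem_Lset {a S T y : ZFSet.{u}} {o : RelOp} {γ : Ordinal.{u}} (ha : a ⊆ Lset γ)
    (hS : S ⊆ Lset γ) (h : o.In a S T y) : y ∈ Lset (γ + 1 + 1 + 1 + 1) := by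
  have h2 : Lset γ ⊆ Lset (γ + 1 + 1) := Lset_mono (by simp [add_assoc])
  have h4 : Lset (γ + 1 + 1) ⊆ Lset (γ + 1 + 1 + 1 + 1) := Lset_mono (by simp [add_assoc])
  cases o with
  | pad =>
    obtain ⟨x, hx, s, hs, rfl⟩ := h
    exact h4 (pair_mem_Lset (ha hx) (hS hs))
  | swap =>
    obtain ⟨x, hx, z, hz, s, rfl, hs⟩ := h
    have hs' := (mem_of_pair_mem_Lset (mem_of_pair_mem_Lset (hS hs)).2).2
    exact pair_mem_Lset (h2 (ha hx)) (pair_mem_Lset (ha hz) hs')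
  | mem =>
    obtain ⟨x, hx, z, hz, s, hs, rfl, -⟩ := h
    exact pair_mem_Lset (h2 (ha hx)) (pair_mem_Lset (ha hz) (hS hs))
  | proj =>
    obtain ⟨x, hx, h⟩ := h
    exact h4 (h2 (mem_of_pair_mem_Lset (hS h)).2)
  | diff => exact h4 (h2 (hS h.1))

section Limit

variable {δ : Ordinal.{u}} {a b C R S T y : ZFSet.{u}}

lemma RelOp.exists_set (hδ : Order.IsSuccLimit δ) (ha : a ∈ Lset δ) (hS : S ∈ Lset δ)
    (hT : T ∈ Lset δ) (o : RelOp) : ∃ R ∈ Lset δ, ∀ y, y ∈ R ↔ o.In a S T y := by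
  obtain ⟨γ, hγ, hab⟩ := subset_Lset_of_mem ha
  obtain ⟨γ', hγ', hSb⟩ := subset_Lset_of_mem hS
  refine ⟨_, Dfn.mem_of_limit (M := 3) (N := 0) (x := ![a, S, T]) (ξ := Fin.elim0)
    (R := fun z _ y => o.In (z 0) (z 1) (z 2) y) (Dfn.relOp_in o) hδ
    ⟨fun i => by fin_cases i <;> assumption, fun j => j.elim0⟩
    (hδ.add_one_lt (hδ.add_one_lt (hδ.add_one_lt (hδ.add_one_lt (max_lt hγ hγ'))))), fun y => ?_⟩
  rw [ZFSet.mem_sep]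
  refine ⟨fun h => h.2, fun h => ⟨RelOp.In.mem_Lset ?_ ?_ h, h⟩⟩
  · exact fun z hz => Lset_mono (le_max_left _ _) (hab hz)
  · exact fun z hz => Lset_mono (le_max_right _ _) (hSb hz)

lemma Der.mem_Lset (hδ : Order.IsSuccLimit δ) (ha : a ∈ Lset δ) (h : Der a R) : R ∈ Lset δ := by
  induction h with
  | base =>
    have := upair_mem_Lset_limit hδ (empty_mem_Lset hδ.bot_lt) (empty_mem_Lset hδ.bot_lt)
    rwa [ZFSet.pair_eq_singleton] at this
  | step o _ _ h ih₁ ih₂ =>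
    obtain ⟨R', hR', h'⟩ := RelOp.exists_set hδ ha ih₁ ih₂ o
    rwa [ZFSet.ext fun y => (h y).trans (h' y).symm]

lemma RelOp.exists_of_mem (hδ : Order.IsSuccLimit δ) (ha : a ∈ Lset δ) : RelOp.Exists a :=
  fun o _ _ hS hT => by
    obtain ⟨R, -, h⟩ := RelOp.exists_set hδ ha (hS.mem_Lset hδ ha) (hT.mem_Lset hδ ha) o
    exact ⟨R, h⟩

/-- The relation `R`, with the label `i`, results by an operation from relations whose labels are
elements of `i`, and which are listed, with their labels, in `C`. -/
def DerStep (α : Ordinal.{u}) (a C i R : ZFSet.{u}) : Prop :=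
  (∀ y ∈ Lset α, (y ∈ R ↔ y = ∅)) ∨ ∃ j ∈ i, ∃ k ∈ i, ∃ S ∈ Lset α, ∃ T ∈ Lset α,
    ZFSet.pair j S ∈ C ∧ ZFSet.pair k T ∈ C ∧ ∃ o : RelOp, ∀ y ∈ Lset α, (y ∈ R ↔ o.In a S T y)

/-- `C` is a set of labelled relations which documents that they are generated by the operations.
Any sets may serve as labels: since the labels decrease along `∈`, no finiteness of `C` need be
required. -/
def DerWitness (α : Ordinal.{u}) (a C : ZFSet.{u}) : Prop :=
  ∀ p ∈ C, ∃ i ∈ Lset α, ∃ R ∈ Lset α, p = ZFSet.pair i R ∧ DerStep α a C i R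

lemma RelOp.In.mem_Lset_limit {o : RelOp} (hδ : Order.IsSuccLimit δ) (ha : a ∈ Lset δ)
    (hS : S ∈ Lset δ) (hT : T ∈ Lset δ) (h : o.In a S T y) : y ∈ Lset δ := by
  obtain ⟨R, hR, h'⟩ := RelOp.exists_set hδ ha hS hT o
  exact isTransitive_Lset δ _ hR ((h' y).2 h)

lemma DerWitness.der (hδ : Order.IsSuccLimit δ) (ha : a ∈ Lset δ) (hC : DerWitness δ a C)
    (i : ZFSet.{u}) : ∀ R, ZFSet.pair i R ∈ C → Der a R := by
  induction i using ZFSet.inductionOn with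
  | h i ih =>
    intro R h
    obtain ⟨i', hi', R', hR', h1, h2⟩ := hC _ h
    obtain ⟨rfl, rfl⟩ := ZFSet.pair_inj.1 h1
    have hmem : ∀ y ∈ R, y ∈ Lset δ := fun y hy => isTransitive_Lset δ _ hR' hy
    rcases h2 with h2 | ⟨j, hj, k, hk, S, hS, T, hT, hjS, hkT, o, ho⟩
    · have : R = {∅} := ZFSet.ext fun y => by
        rw [ZFSet.mem_singleton]
        exact ⟨fun hy => (h2 y (hmem y hy)).1 hy, fun hy =>
          (h2 y (hy ▸ empty_mem_Lset hδ.bot_lt)).2 hy⟩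
      exact this ▸ Der.base
    · exact .step o (ih j hj S hjS) (ih k hk T hkT) fun y => ⟨fun hy => (ho y (hmem y hy)).1 hy,
        fun hy => (ho y (hy.mem_Lset_limit hδ ha hS hT)).2 hy⟩

lemma DerStep.mono {C' i : ZFSet.{u}} (h : DerStep δ a C i R) (hC : C ⊆ C') :
    DerStep δ a C' i R := by
  rcases h with h | ⟨j, hj, k, hk, S, hS, T, hT, hjS, hkT, o⟩
  · exact Or.inl h
  · exact Or.inr ⟨j, hj, k, hk, S, hS, T, hT, hC hjS, hC hkT, o⟩

lemma DerWitness.union {C' : ZFSet.{u}} (h : DerWitness δ a C) (h' : DerWitness δ a C') :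
    DerWitness δ a (C ∪ C') := fun p hp => by
  rcases ZFSet.mem_union.1 hp with hp | hp
  · obtain ⟨i, hi, R, hR, rfl, hs⟩ := h p hp
    exact ⟨i, hi, R, hR, rfl, hs.mono fun z hz => ZFSet.mem_union.2 (Or.inl hz)⟩
  · obtain ⟨i, hi, R, hR, rfl, hs⟩ := h' p hp
    exact ⟨i, hi, R, hR, rfl, hs.mono fun z hz => ZFSet.mem_union.2 (Or.inr hz)⟩

lemma DerWitness.insert {i : ZFSet.{u}} (h : DerWitness δ a C) (hi : i ∈ Lset δ) (hR : R ∈ Lset δ)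
    (hs : DerStep δ a C i R) : DerWitness δ a (insert (ZFSet.pair i R) C) := fun p hp => by
  have hsub : C ⊆ Insert.insert (ZFSet.pair i R) C := fun z hz => ZFSet.mem_insert_iff.2 (Or.inr hz)
  rcases ZFSet.mem_insert_iff.1 hp with rfl | hp
  · exact ⟨i, hi, R, hR, rfl, hs.mono hsub⟩
  · obtain ⟨i, hi, R, hR, rfl, hs⟩ := h p hp
    exact ⟨i, hi, R, hR, rfl, hs.mono hsub⟩

/-- Limit stages contain a witness for every generated relation. The relation that results from those
with the labels `i` and `i'` gets the label `{i, i'}`. -/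
lemma der_iff_exists_witness (hδ : Order.IsSuccLimit δ) (ha : a ∈ Lset δ) : Der a R ↔
    ∃ C ∈ Lset δ, DerWitness δ a C ∧ ∃ i ∈ Lset δ, ZFSet.pair i R ∈ C := by
  refine ⟨fun h => ?_, fun ⟨C, _, hC, i, _, hi⟩ => hC.der hδ ha i R hi⟩
  have h0 := empty_mem_Lset hδ.bot_lt
  induction h with
  | base =>
    refine ⟨_, insert_mem_Lset_limit hδ (pair_mem_Lset_limit hδ h0 (Der.base.mem_Lset hδ ha)) h0,
      DerWitness.insert (fun p hp => (ZFSet.notMem_empty p hp).elim) h0 (Der.base.mem_Lset hδ ha)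
        (Or.inl fun y _ => ZFSet.mem_singleton), ∅, h0, ZFSet.mem_insert _ _⟩
  | @step S T R o hS hT h ih₁ ih₂ =>
    obtain ⟨C, hC, hw, i, hi, hp⟩ := ih₁
    obtain ⟨C', hC', hw', i', hi', hp'⟩ := ih₂
    have hR := (Der.step o hS hT h).mem_Lset hδ ha
    have hii := upair_mem_Lset_limit hδ hi hi'
    refine ⟨_, insert_mem_Lset_limit hδ (pair_mem_Lset_limit hδ hii hR)
      (union_mem_Lset_limit hδ hC hC'), (hw.union hw').insert hii hR (Or.inr ⟨i, by simp, i',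
        by simp, S, hS.mem_Lset hδ ha, T, hT.mem_Lset hδ ha, ZFSet.mem_union.2 (Or.inl hp),
        ZFSet.mem_union.2 (Or.inr hp'), o, fun y _ => h y⟩), _, hii, ZFSet.mem_insert _ _⟩

/-- A version of `b ∈ Def(a)` which is definable over limit stages: `b` is a section of a generated
relation, where `s` codes the list of the parameters. -/
def InDef (α : Ordinal.{u}) (a b : ZFSet.{u}) : Prop :=
  b ⊆ a ∧ ∃ R ∈ Lset α, ∃ s ∈ Lset α, Der a R ∧ ∀ y ∈ a, (y ∈ b ↔ ZFSet.pair y s ∈ R)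

lemma inDef_iff (hδ : Order.IsSuccLimit δ) (ha : a ∈ Lset δ) (hat : a.IsTransitive) :
    InDef δ a b ↔ b ∈ defPow a := by
  rw [InDef, mem_defPow hat]
  refine and_congr_right fun hb => ?_
  constructor
  · rintro ⟨R, hR, s, hs, hd, h⟩
    -- if `b` is not empty, then `s` is the code of a list
    by_cases hne : b = ∅
    · exact ⟨.mem 0 0, fun _ => ∅, fun _ => Or.inr rfl, fun y _ => iff_of_false
        (hne ▸ ZFSet.notMem_empty y) (ZFSet.mem_irrefl _)⟩
    obtain ⟨y, hy⟩ := (ZFSet.eq_empty_or_nonempty b).resolve_left hne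
    obtain ⟨l, hl, h1⟩ := hd.exists_list ((h y (hb hy)).1 hy)
    obtain ⟨l, rfl, rfl⟩ := listCode_eq_pair h1.symm
    obtain ⟨φ, hφ⟩ := hd.exists_sat (l.length + 1)
    refine ⟨φ, listEnv l, fun i => ?_, fun z hz => ?_⟩
    · by_cases hi : i < l.length
      · left
        rw [listEnv, List.getD_eq_getElem _ _ hi]
        exact hl _ (List.mem_cons_of_mem _ (List.getElem_mem hi))
      · right
        rw [listEnv, List.getD_eq_default _ _ (not_lt.1 hi)]
    · rw [h z hz, ← listEnv_cons, ← hφ (z :: l) rfl]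
      · rfl
      · intro w hw
        rcases List.mem_cons.1 hw with rfl | hw
        · exact hz
        · exact hl _ (List.mem_cons_of_mem _ hw)
  · rintro ⟨φ, p, hp, h⟩
    have h0 := empty_mem_Lset hδ.bot_lt
    by_cases hne : a = ∅
    · subst hne
      exact ⟨_, Der.base.mem_Lset hδ ha, _, h0, .base, fun y hy => (ZFSet.notMem_empty y hy).elim⟩
    have hp' : ∀ i, p i ∈ a := fun i => (hp i).elim id fun h =>
      h ▸ empty_mem_of_isTransitive hat hne
    have hlist : ∀ l : List ZFSet.{u}, (∀ y ∈ l, y ∈ a) → listCode l ∈ Lset δ := by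
      intro l hl
      induction l with
      | nil => exact h0
      | cons y l ih =>
        exact pair_mem_Lset_limit hδ (isTransitive_Lset δ _ ha (hl y (by simp)))
          (ih fun y hy => hl y (by simp [hy]))
    obtain ⟨R, hR, hRφ⟩ := Der.exists_of_sat (RelOp.exists_of_mem hδ ha) φ (φ.fv + 1) (by omega)
    have hl : ∀ y ∈ List.ofFn fun i : Fin φ.fv => p i, y ∈ a := by
      intro y hy
      obtain ⟨i, rfl⟩ := (List.mem_ofFn' _ _).1 hy
      exact hp' i
    refine ⟨R, hR.mem_Lset hδ ha, listCode (List.ofFn fun i : Fin φ.fv => p i), hlist _ hl, hR,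
      fun y hy => ?_⟩
    rw [h y hy]
    refine Iff.trans ?_ (hRφ (y :: List.ofFn fun i : Fin φ.fv => p i) (by simp) ?_).symm
    · rw [listEnv_cons]
      refine φ.sat_congr a fun i hi => ?_
      cases i with
      | zero => rfl
      | succ i =>
        have : i < φ.fv := by omega
        simp [listEnv, this]
    · intro w hw
      rcases List.mem_cons.1 hw with rfl | hw
      · exact hy
      · exact hl _ hw

/-- `C` consists of pairs `(β, y)` which obey the recursion that defines the constructible
hierarchy. -/
def StageSeq (α : Ordinal.{u}) (C : ZFSet.{u}) : Prop :=
  ∀ p ∈ C, ∃ β ∈ Lset α, ∃ y ∈ Lset α, p = ZFSet.pair β y ∧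
    (∀ γ ∈ β, ∃ z ∈ Lset α, ZFSet.pair γ z ∈ C ∧ ∀ v ∈ Lset α, InDef α z v → v ∈ y) ∧
    ∀ v ∈ y, ∃ γ ∈ β, ∃ z ∈ Lset α, ZFSet.pair γ z ∈ C ∧ InDef α z v

lemma StageSeq.eq_Lset (hδ : Order.IsSuccLimit δ) (hC : StageSeq δ C) {γ : Ordinal.{u}}
    (h : ZFSet.pair γ.toZFSet y ∈ C) : y = Lset γ := by
  induction γ using WellFoundedLT.induction generalizing y with
  | ind γ ih =>
    obtain ⟨β, hβ, y', hy, h1, h2, h3⟩ := hC _ h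
    obtain ⟨rfl, rfl⟩ := ZFSet.pair_inj.1 h1
    have hγ := toZFSet_mem_Lset.1 hβ
    ext v
    rw [mem_Lset]
    constructor
    · intro hv
      obtain ⟨β, hβ, z, hz, hp, hd⟩ := h3 v hv
      obtain ⟨β', hβ', rfl⟩ := Ordinal.mem_toZFSet_iff.1 hβ
      obtain rfl := ih β' hβ' hp
      exact ⟨β', hβ', (inDef_iff hδ hz (isTransitive_Lset β')).1 hd⟩
    · rintro ⟨β, hβ, hv⟩
      obtain ⟨z, hz, hp, hd⟩ := h2 _ (Ordinal.toZFSet_mem_toZFSet_iff.2 hβ)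
      obtain rfl := ih β hβ hp
      refine hd v ?_ ((inDef_iff hδ hz (isTransitive_Lset β)).2 hv)
      exact mem_Lset.2 ⟨β, hβ.trans hγ, hv⟩

/-- The sequence of the stages before `γ`. -/
noncomputable def stageSeq (γ : Ordinal.{u}) : ZFSet.{u} :=
  ZFSet.range fun β : Set.Iio γ => ZFSet.pair β.1.toZFSet (Lset β.1)

lemma mem_stageSeq {γ : Ordinal.{u}} {p : ZFSet.{u}} :
    p ∈ stageSeq γ ↔ ∃ β < γ, p = ZFSet.pair β.toZFSet (Lset β) := by
  simp [stageSeq, eq_comm]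

lemma stageSeq_spec (hδ : Order.IsSuccLimit δ) {γ : Ordinal.{u}} (hγ : γ ≤ δ) :
    StageSeq δ (stageSeq γ) := fun p hp => by
  obtain ⟨β, hβ, rfl⟩ := mem_stageSeq.1 hp
  refine ⟨_, toZFSet_mem_Lset.2 (hβ.trans_le hγ), _, Lset_mem_Lset (hβ.trans_le hγ), rfl, ?_, ?_⟩
  · intro b hb
    obtain ⟨β', hβ', rfl⟩ := Ordinal.mem_toZFSet_iff.1 hb
    have hm : Lset β' ∈ Lset δ := Lset_mem_Lset ((hβ'.trans hβ).trans_le hγ)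
    exact ⟨_, hm, mem_stageSeq.2 ⟨β', hβ'.trans hβ, rfl⟩, fun v _ hv => mem_Lset.2
      ⟨β', hβ', (inDef_iff hδ hm (isTransitive_Lset β')).1 hv⟩⟩
  · intro v hv
    obtain ⟨β', hβ', hv⟩ := mem_Lset.1 hv
    have hm : Lset β' ∈ Lset δ := Lset_mem_Lset ((hβ'.trans hβ).trans_le hγ)
    exact ⟨_, Ordinal.toZFSet_mem_toZFSet_iff.2 hβ', _, hm, mem_stageSeq.2 ⟨β', hβ'.trans hβ, rfl⟩,
      (inDef_iff hδ hm (isTransitive_Lset β')).2 hv⟩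

end Limit

/-- The limit ordinals. -/
def limits : Set Ordinal.{u} := {α | Order.IsSuccLimit α}

namespace Dfn

lemma der : Dfn limits fun _ (z : Fin 2 → ZFSet.{u}) (_ : Fin 0 → Ordinal.{u}) =>
    Der (z 0) (z 1) := by
  have hin : ∀ (o : RelOp) {M : ℕ} (i j k l : Fin M), Dfn limits fun _ (z : Fin M → ZFSet.{u})
      (_ : Fin 0 → Ordinal.{u}) => o.In (z i) (z j) (z k) (z l) := fun o M i j k l =>
    comp₄ (R := fun _ y a S T => o.In a S T y) (relOp_in o) (isVar_set l) (isVar_set i)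
      (isVar_set j) (isVar_set k)
  have h : Dfn limits fun α (z : Fin 2 → ZFSet.{u}) (_ : Fin 0 → Ordinal.{u}) =>
      ∃ C ∈ Lset α, DerWitness α (z 0) C ∧ ∃ i ∈ Lset α, ZFSet.pair i (z 1) ∈ C := by
    refine exists_mem_Lset (and ?_ (exists_mem_Lset (pair_mem (isVar_set _) (isVar_set _)
      (isVar_set _))))
    refine forall_mem (isVar_set _) (exists_mem_Lset (exists_mem_Lset (and
      (eq_pair (isVar_set _) (isVar_set _) (isVar_set _)) (or ?_ ?_))))
    · exact forall_mem_Lset (iff (mem (isVar_set _) (isVar_set _)) (eq_empty (isVar_set _)))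
    · refine exists_mem (isVar_set _) (exists_mem (isVar_set _) (exists_mem_Lset (exists_mem_Lset
        (and (pair_mem (isVar_set _) (isVar_set _) (isVar_set _)) (and
        (pair_mem (isVar_set _) (isVar_set _) (isVar_set _)) (exists_relOp fun o => ?_))))))
      exact forall_mem_Lset (iff (mem (isVar_set _) (isVar_set _)) (hin o _ _ _ _))
  exact h.congr fun α hα z _ hz => (der_iff_exists_witness hα (hz.1 0)).symm

lemma inDef : Dfn limits fun α (z : Fin 2 → ZFSet.{u}) (_ : Fin 0 → Ordinal.{u}) =>
    InDef α (z 0) (z 1) := by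
  refine and (subset (isVar_set _) (isVar_set _)) (exists_mem_Lset (exists_mem_Lset (and ?_
    (forall_mem (isVar_set _) (iff (mem (isVar_set _) (isVar_set _)) (pair_mem (isVar_set _)
      (isVar_set _) (isVar_set _)))))))
  exact comp₂ (R := fun _ a R => Der a R) der (isVar_set _) (isVar_set _)

lemma stageSeq {M N : ℕ} (i : Fin M) :
    Dfn limits fun α (z : Fin M → ZFSet.{u}) (_ : Fin N → Ordinal.{u}) => StageSeq α (z i) := by
  have hin : ∀ {M N : ℕ} (i j : Fin M), Dfn limits fun α (z : Fin M → ZFSet.{u})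
      (_ : Fin N → Ordinal.{u}) => InDef α (z i) (z j) := fun i j =>
    comp₂ (R := fun α a b => InDef α a b) inDef (isVar_set _) (isVar_set _)
  refine forall_mem (isVar_set _) (exists_mem_Lset (exists_mem_Lset (and
    (eq_pair (isVar_set _) (isVar_set _) (isVar_set _)) (and ?_ ?_))))
  · exact forall_mem (isVar_set _) (exists_mem_Lset (and (pair_mem (isVar_set _) (isVar_set _)
      (isVar_set _)) (forall_mem_Lset (imp (hin _ _) (mem (isVar_set _) (isVar_set _))))))
  · exact forall_mem (isVar_set _) (exists_mem (isVar_set _) (exists_mem_Lset (and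
      (pair_mem (isVar_set _) (isVar_set _) (isVar_set _)) (hin _ _))))

end Dfn

lemma stageSeq_mem_Lset {γ : Ordinal.{u}} : ∀ {δ : Ordinal.{u}}, Order.IsSuccLimit δ → γ < δ →
    stageSeq γ ∈ Lset δ := by
  induction γ using Ordinal.limitRecOn with
  | zero =>
    intro δ hδ hγ
    rw [show stageSeq 0 = (∅ : ZFSet.{u}) from (ZFSet.eq_empty _).2 fun p hp => by
      obtain ⟨β, hβ, -⟩ := mem_stageSeq.1 hp
      exact not_lt_bot hβ]
    exact empty_mem_Lset hγ
  | add_one γ ih =>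
    intro δ hδ hγ
    rw [← Order.succ_eq_add_one] at hγ ⊢
    have hγ' : γ < δ := (Order.lt_succ γ).trans hγ
    rw [show stageSeq (Order.succ γ) =
      insert (ZFSet.pair γ.toZFSet (Lset γ)) (stageSeq γ) from ZFSet.ext fun p => by
        simp only [mem_stageSeq, ZFSet.mem_insert_iff, Order.lt_succ_iff, le_iff_eq_or_lt]
        constructor
        · rintro ⟨β, rfl | hβ, rfl⟩
          · exact Or.inl rfl
          · exact Or.inr ⟨β, hβ, rfl⟩
        · rintro (rfl | ⟨β, hβ, rfl⟩)
          · exact ⟨γ, Or.inl rfl, rfl⟩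
          · exact ⟨β, Or.inr hβ, rfl⟩]
    exact insert_mem_Lset_limit hδ (pair_mem_Lset_limit hδ (toZFSet_mem_Lset.2 hγ')
      (Lset_mem_Lset hγ')) (ih hδ hγ')
  | limit γ hγl ih =>
    intro δ hδ hγ
    refine Lset_mono (hδ.add_one_lt hγ).le ?_
    have hd : Dfn limits fun α (z : Fin 1 → ZFSet.{u}) (_ : Fin 0 → Ordinal.{u}) =>
        ∃ β < α, ∃ y ∈ Lset α, z 0 = ZFSet.pair β.toZFSet y ∧
          ∃ C ∈ Lset α, StageSeq α C ∧ ZFSet.pair β.toZFSet y ∈ C :=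
      Dfn.exists_lt (Dfn.exists_mem_Lset (Dfn.and (Dfn.eq_pair (isVar_set _) (isVar_ord _)
        (isVar_set _)) (Dfn.exists_mem_Lset (Dfn.and (Dfn.stageSeq _) (Dfn.pair_mem (isVar_ord _)
          (isVar_set _) (isVar_set _))))))
    have := Dfn.sep_mem (M := 0) (x := Fin.elim0) (ξ := Fin.elim0) (R := fun α _ _ p =>
      ∃ β < α, ∃ y ∈ Lset α, p = ZFSet.pair β.toZFSet y ∧
          ∃ C ∈ Lset α, StageSeq α C ∧ ZFSet.pair β.toZFSet y ∈ C) hd hγl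
      ⟨fun i => i.elim0, fun i => i.elim0⟩
    convert this using 1
    ext p
    rw [mem_stageSeq, ZFSet.mem_sep]
    constructor
    · rintro ⟨β, hβ, rfl⟩
      exact ⟨pair_mem_Lset_limit hγl (toZFSet_mem_Lset.2 hβ) (Lset_mem_Lset hβ), β, hβ, _,
        Lset_mem_Lset hβ, rfl, _, ih _ (hγl.succ_lt hβ) hγl (hγl.succ_lt hβ),
        stageSeq_spec hγl (hγl.succ_lt hβ).le, mem_stageSeq.2 ⟨β, Order.lt_succ β, rfl⟩⟩
    · rintro ⟨-, β, hβ, y, -, rfl, C, -, hC, hp⟩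
      exact ⟨β, hβ, by rw [hC.eq_Lset hγl hp]⟩

/-- The function `β ↦ L_β` is uniformly definable over the limit stages. -/
lemma Dfn.stage : Dfn limits fun α (z : Fin 2 → ZFSet.{u}) (_ : Fin 0 → Ordinal.{u}) =>
    ∃ β < α, z 0 = β.toZFSet ∧ z 1 = Lset β := by
  have h : Dfn limits fun α (z : Fin 2 → ZFSet.{u}) (_ : Fin 0 → Ordinal.{u}) =>
      ∃ β < α, z 0 = β.toZFSet ∧ ∃ C ∈ Lset α, StageSeq α C ∧ ZFSet.pair β.toZFSet (z 1) ∈ C :=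
    exists_lt (and (eq (isVar_set _) (isVar_ord _)) (exists_mem_Lset (and (stageSeq _)
      (pair_mem (isVar_ord _) (isVar_set _) (isVar_set _)))))
  refine h.congr fun α hα z _ _ => exists_congr fun β => and_congr_right fun hβ =>
    and_congr_right fun _ => ⟨?_, fun h => ?_⟩
  · rintro ⟨C, -, hC, hp⟩
    exact hC.eq_Lset hα hp
  · have hs : Order.succ β < α := Order.IsSuccLimit.succ_lt hα hβ
    exact ⟨_, stageSeq_mem_Lset hα hs, stageSeq_spec hα hs.le,
      h ▸ mem_stageSeq.2 ⟨β, Order.lt_succ β, rfl⟩⟩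

/-! ### Three-valued logic -/

namespace Truth

variable {ι : Type*} {p q : ι → Truth.{u}}

lemma all_eq_bot : all p = bot ↔ ∃ i, p i = bot := by
  unfold all; split_ifs with h h' <;> simp [h]

lemma all_eq_top : all p = top ↔ ∀ i, p i = top := by
  unfold all
  split_ifs with h h'
  · obtain ⟨i, hi⟩ := h
    exact iff_of_false (by simp) fun H => by simp [H i] at hi
  · obtain ⟨i, hi⟩ := h'
    exact iff_of_false (by simp) fun H => by simp [H i] at hi
  · push Not at h h'
    refine iff_of_true rfl fun i => ?_
    cases hi : p i
    · rfl
    · exact (h i hi).elim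
    · exact (h' i hi).elim

lemma any_eq_top : any p = top ↔ ∃ i, p i = top := by
  unfold any; split_ifs with h h' <;> simp [h]

lemma any_eq_bot : any p = bot ↔ ∀ i, p i = bot := by
  unfold any
  split_ifs with h h'
  · obtain ⟨i, hi⟩ := h
    exact iff_of_false (by simp) fun H => by simp [H i] at hi
  · obtain ⟨i, hi⟩ := h'
    exact iff_of_false (by simp) fun H => by simp [H i] at hi
  · push Not at h h'
    refine iff_of_true rfl fun i => ?_
    cases hi : p i
    · exact (h i hi).elim
    · rfl
    · exact (h' i hi).elim

lemma ne_undef_iff {v : Truth.{u}} : v ≠ undef ↔ v = top ∨ v = bot := by cases v <;> simp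

lemma and_eq_top {v w : Truth.{u}} : v.and w = top ↔ v = top ∧ w = top := by
  cases v <;> cases w <;> simp [and]

lemma and_eq_bot {v w : Truth.{u}} : v.and w = bot ↔ v = bot ∨ w = bot := by
  cases v <;> cases w <;> simp [and]

lemma or_eq_top {v w : Truth.{u}} : v.or w = top ↔ v = top ∨ w = top := by
  cases v <;> cases w <;> simp [or]

lemma or_eq_bot {v w : Truth.{u}} : v.or w = bot ↔ v = bot ∧ w = bot := by
  cases v <;> cases w <;> simp [or]

lemma not_eq_top {v : Truth.{u}} : v.not = top ↔ v = bot := by cases v <;> simp [not]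

lemma not_eq_bot {v : Truth.{u}} : v.not = bot ↔ v = top := by cases v <;> simp [not]

lemma ofProp_eq_top {P : Prop} : ofProp.{u} P = top ↔ P := by
  unfold ofProp; split_ifs with h <;> simp [h]

lemma ofProp_eq_bot {P : Prop} : ofProp.{u} P = bot ↔ ¬ P := by
  unfold ofProp; split_ifs with h <;> simp [h]

lemma ofProp_ne_undef {P : Prop} : ofProp.{u} P ≠ undef := by
  unfold ofProp; split_ifs <;> simp

/-- A truth value is determined by when it is true and when it is false. -/
lemma eq_ofProp {v : Truth.{u}} {P : Prop} (h : P → v = top) (h' : ¬ P → v = bot) :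
    v = ofProp P := by
  by_cases hP : P
  · rw [h hP, ofProp_eq_top.2 hP]
  · rw [h' hP, ofProp_eq_bot.2 hP]

lemma not_ofProp (P : Prop) : (ofProp.{u} P).not = ofProp (¬ P) :=
  eq_ofProp (fun h => not_eq_top.2 (ofProp_eq_bot.2 h)) fun h =>
    not_eq_bot.2 (ofProp_eq_top.2 (not_not.1 h))

lemma and_ofProp (P Q : Prop) : (ofProp.{u} P).and (ofProp Q) = ofProp (P ∧ Q) :=
  eq_ofProp (fun h => and_eq_top.2 ⟨ofProp_eq_top.2 h.1, ofProp_eq_top.2 h.2⟩) fun h =>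
    and_eq_bot.2 (by simp only [ofProp_eq_bot]; tauto)

lemma or_ofProp (P Q : Prop) : (ofProp.{u} P).or (ofProp Q) = ofProp (P ∨ Q) :=
  eq_ofProp (fun h => or_eq_top.2 (by simpa only [ofProp_eq_top] using h)) fun h =>
    or_eq_bot.2 (by simp only [ofProp_eq_bot]; tauto)

end Truth

lemma minVal_eq_some {η α : Ordinal.{u}} {p : Ordinal.{u} → Truth.{u}} :
    minVal η p = some α ↔ α < η ∧ p α = .top ∧ ∀ β < α, p β = .bot := by
  have huniq : ∀ {α β}, (p α = .top ∧ ∀ γ < α, p γ = .bot) → (p β = .top ∧ ∀ γ < β, p γ = .bot) →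
      α ≤ β := fun h h' => not_lt.1 fun hlt => by simp [h.2 _ hlt] at h'
  unfold minVal
  split_ifs with h
  · obtain ⟨β, hβ⟩ := h
    have : sInf {α | α < η ∧ p α = .top ∧ ∀ β < α, p β = .bot} = β :=
      le_antisymm (csInf_le' hβ) (le_csInf ⟨β, hβ⟩ fun γ hγ => huniq hβ.2 hγ.2)
    rw [this, Option.some_inj]
    exact ⟨fun h => h ▸ hβ, fun h => le_antisymm (huniq hβ.2 h.2) (huniq h.2 hβ.2)⟩
  · exact iff_of_false (by simp) fun h' => h ⟨α, h'⟩

lemma sepVal_eq_some {η : Ordinal.{u}} {v s : ZFSet.{u}} {p : ZFSet.{u} → Truth.{u}} :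
    sepVal η v p = some s ↔ (∀ y ∈ v, p y ≠ .undef) ∧ s ∈ Lset η ∧
      s = ZFSet.sep (fun y => p y = .top) v := by
  unfold sepVal
  split_ifs with h
  · rw [Option.some_inj, eq_comm]
    exact ⟨fun hs => ⟨h.1, hs ▸ h.2, hs⟩, fun hs => hs.2.2⟩
  · exact iff_of_false (by simp) fun hs => h ⟨hs.1, hs.2.2 ▸ hs.2.1⟩

/-! ### Values of expressions -/

section Values

variable {η : Ordinal.{u}} {M N : ℕ} {x : Fin M → ZFSet.{u}} {ξ : Fin N → Ordinal.{u}}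

lemma interp_mem {s t : Srt} {a : Expr (.term s) M N} {b : Expr (.term t) M N} {v w}
    (ha : interp η a x ξ = some v) (hb : interp η b x ξ = some w) :
    interp η (.mem a b) x ξ = Truth.ofProp (s.toZF v ∈ t.toZF w) := by
  rw [interp, ha, hb]

lemma interp_eq {s t : Srt} {a : Expr (.term s) M N} {b : Expr (.term t) M N} {v w}
    (ha : interp η a x ξ = some v) (hb : interp η b x ξ = some w) :
    interp η (.eq a b) x ξ = Truth.ofProp (s.toZF v = t.toZF w) := by
  rw [interp, ha, hb]

lemma interp_mem_eq_top {s t : Srt} {a : Expr (.term s) M N} {b : Expr (.term t) M N} :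
    interp η (.mem a b) x ξ = .top ↔ ∃ v w, interp η a x ξ = some v ∧ interp η b x ξ = some w ∧
      s.toZF v ∈ t.toZF w := by
  rw [interp]
  cases interp η a x ξ <;> cases interp η b x ξ <;> simp [Truth.ofProp_eq_top]

lemma interp_mem_eq_bot {s t : Srt} {a : Expr (.term s) M N} {b : Expr (.term t) M N} :
    interp η (.mem a b) x ξ = .bot ↔ ∃ v w, interp η a x ξ = some v ∧ interp η b x ξ = some w ∧
      s.toZF v ∉ t.toZF w := by
  rw [interp]
  cases interp η a x ξ <;> cases interp η b x ξ <;> simp [Truth.ofProp_eq_bot]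

lemma interp_eq_eq_top {s t : Srt} {a : Expr (.term s) M N} {b : Expr (.term t) M N} :
    interp η (.eq a b) x ξ = .top ↔ ∃ v w, interp η a x ξ = some v ∧ interp η b x ξ = some w ∧
      s.toZF v = t.toZF w := by
  rw [interp]
  cases interp η a x ξ <;> cases interp η b x ξ <;> simp [Truth.ofProp_eq_top]

lemma interp_eq_eq_bot {s t : Srt} {a : Expr (.term s) M N} {b : Expr (.term t) M N} :
    interp η (.eq a b) x ξ = .bot ↔ ∃ v w, interp η a x ξ = some v ∧ interp η b x ξ = some w ∧
      s.toZF v ≠ t.toZF w := by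
  rw [interp]
  cases interp η a x ξ <;> cases interp η b x ξ <;> simp [Truth.ofProp_eq_bot]

lemma interp_dn_eq_top {s : Srt} {a : Expr (.term s) M N} :
    interp η (.dn a) x ξ = .top ↔ ∃ v, interp η a x ξ = some v := by
  rw [interp]
  cases interp η a x ξ <;> simp

lemma interp_dn_ne_bot {s : Srt} {a : Expr (.term s) M N} : interp η (.dn a) x ξ ≠ .bot := by
  rw [interp]
  cases interp η a x ξ <;> simp

lemma interp_allS_eq_top {X : SetTm M N} {P : Fml (M + 1) N} :
    interp η (.allS X P) x ξ = .top ↔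
      ∃ v, interp η X x ξ = some v ∧ ∀ y ∈ v, interp η P (ext y x) ξ = .top := by
  rw [interp]
  cases interp η X x ξ <;> simp [Truth.all_eq_top]

lemma interp_allS_eq_bot {X : SetTm M N} {P : Fml (M + 1) N} :
    interp η (.allS X P) x ξ = .bot ↔
      ∃ v, interp η X x ξ = some v ∧ ∃ y ∈ v, interp η P (ext y x) ξ = .bot := by
  rw [interp]
  cases interp η X x ξ <;> simp [Truth.all_eq_bot]

lemma interp_exS_eq_top {X : SetTm M N} {P : Fml (M + 1) N} :
    interp η (.exS X P) x ξ = .top ↔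
      ∃ v, interp η X x ξ = some v ∧ ∃ y ∈ v, interp η P (ext y x) ξ = .top := by
  rw [interp]
  cases interp η X x ξ <;> simp [Truth.any_eq_top]

lemma interp_exS_eq_bot {X : SetTm M N} {P : Fml (M + 1) N} :
    interp η (.exS X P) x ξ = .bot ↔
      ∃ v, interp η X x ξ = some v ∧ ∀ y ∈ v, interp η P (ext y x) ξ = .bot := by
  rw [interp]
  cases interp η X x ξ <;> simp [Truth.any_eq_bot]

lemma interp_allO_eq_top {A : OrdTm M N} {P : Fml M (N + 1)} :
    interp η (.allO A P) x ξ = .top ↔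
      ∃ α, interp η A x ξ = some α ∧ ∀ β < α, interp η P x (ext β ξ) = .top := by
  rw [interp]
  cases interp η A x ξ <;> simp [Truth.all_eq_top]

lemma interp_allO_eq_bot {A : OrdTm M N} {P : Fml M (N + 1)} :
    interp η (.allO A P) x ξ = .bot ↔
      ∃ α, interp η A x ξ = some α ∧ ∃ β < α, interp η P x (ext β ξ) = .bot := by
  rw [interp]
  cases interp η A x ξ <;> simp [Truth.all_eq_bot]

lemma interp_exO_eq_top {A : OrdTm M N} {P : Fml M (N + 1)} :
    interp η (.exO A P) x ξ = .top ↔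
      ∃ α, interp η A x ξ = some α ∧ ∃ β < α, interp η P x (ext β ξ) = .top := by
  rw [interp]
  cases interp η A x ξ <;> simp [Truth.any_eq_top]

lemma interp_exO_eq_bot {A : OrdTm M N} {P : Fml M (N + 1)} :
    interp η (.exO A P) x ξ = .bot ↔
      ∃ α, interp η A x ξ = some α ∧ ∀ β < α, interp η P x (ext β ξ) = .bot := by
  rw [interp]
  cases interp η A x ξ <;> simp [Truth.any_eq_bot]

lemma interp_sep_eq_some {X : SetTm M N} {P : Fml (M + 1) N} {s : ZFSet.{u}} :
    interp η (.sep X P) x ξ = some s ↔ ∃ v, interp η X x ξ = some v ∧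
      (∀ y ∈ v, interp η P (ext y x) ξ ≠ .undef) ∧ s ∈ Lset η ∧
        s = ZFSet.sep (fun y => interp η P (ext y x) ξ = .top) v := by
  rw [interp]
  cases interp η X x ξ with
  | none => simp
  | some v => simp [sepVal_eq_some]

lemma interp_stage_eq_some {A : OrdTm M N} {s : ZFSet.{u}} :
    interp η (.stage A) x ξ = some s ↔ ∃ α, interp η A x ξ = some α ∧ s = Lset α := by
  rw [interp]
  cases interp η A x ξ <;> simp [eq_comm]

lemma interp_stage {A : OrdTm M N} {α : Ordinal.{u}} (h : interp η A x ξ = some α) :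
    interp η (.stage A) x ξ = some (Lset α) := interp_stage_eq_some.2 ⟨α, h, rfl⟩

lemma interp_min_eq_some {P : Fml M (N + 1)} {α : Ordinal.{u}} :
    interp η (.min P) x ξ = some α ↔ α < η ∧ interp η P x (ext α ξ) = .top ∧
      ∀ β < α, interp η P x (ext β ξ) = .bot := by
  rw [interp]
  exact minVal_eq_some

end Values

/-- The value of a term at `η`, if defined, lies in `L_η` (which for ordinals means that it is less
than `η`). -/
def Kind.ValIn (η : Ordinal.{u}) : (k : Kind) → Kind.Val.{u} k → Prop
  | .fml => fun _ => True
  | .term s => fun o => ∀ v, o = some v → s.toZF v ∈ Lset η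

lemma interp_valIn {η : Ordinal.{u}} {k : Kind} {M N : ℕ} (E : Expr k M N)
    {x : Fin M → ZFSet.{u}} {ξ : Fin N → Ordinal.{u}} (h : InDomain η x ξ) :
    k.ValIn η (interp η E x ξ) := by
  induction E with
  | svar i =>
    intro v hv
    rw [interp, Option.some_inj] at hv
    exact hv ▸ h.1 i
  | ovar j =>
    intro v hv
    rw [interp, Option.some_inj] at hv
    exact hv ▸ toZFSet_mem_Lset.2 (h.2 j)
  | sep X P _ _ =>
    intro v hv
    obtain ⟨_, _, _, hv, _⟩ := interp_sep_eq_some.1 hv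
    exact hv
  | stage A ih =>
    intro v hv
    obtain ⟨α, hα, rfl⟩ := interp_stage_eq_some.1 hv
    exact Lset_mem_Lset (toZFSet_mem_Lset.1 (ih h α hα))
  | min P _ =>
    intro v hv
    exact toZFSet_mem_Lset.2 (interp_min_eq_some.1 hv).1
  | _ => trivial

lemma interp_set_mem {η : Ordinal.{u}} {M N : ℕ} {X : SetTm M N} {x : Fin M → ZFSet.{u}}
    {ξ : Fin N → Ordinal.{u}} (h : InDomain η x ξ) {v : ZFSet.{u}} (hv : interp η X x ξ = some v) :
    v ∈ Lset η := interp_valIn X h v hv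

lemma interp_ord_lt {η : Ordinal.{u}} {M N : ℕ} {A : OrdTm M N} {x : Fin M → ZFSet.{u}}
    {ξ : Fin N → Ordinal.{u}} (h : InDomain η x ξ) {α : Ordinal.{u}}
    (hα : interp η A x ξ = some α) : α < η := toZFSet_mem_Lset.1 (interp_valIn A h α hα)

/-- The interpretations increase with `η`: values, once defined, do not change. -/
lemma interp_mono {η η' : Ordinal.{u}} (hη : η ≤ η') {k : Kind} {M N : ℕ} (E : Expr k M N)
    {x : Fin M → ZFSet.{u}} {ξ : Fin N → Ordinal.{u}} (h : InDomain η x ξ)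
    (hd : k.IsDefined (interp η E x ξ)) : interp η' E x ξ = interp η E x ξ := by
  have opt : ∀ {s : Srt} {o o' : Option (Srt.Carrier.{u} s)},
      (Kind.IsDefined (.term s) o → o' = o) → ∀ v, o = some v → o' = some v := by
    intro s o o' h v hv
    rw [h (by simp [hv, Kind.IsDefined]), hv]
  have some_of : ∀ {s : Srt} {o : Option (Srt.Carrier.{u} s)}, Kind.IsDefined (.term s) o →
      ∃ v, o = some v := fun h => Option.ne_none_iff_exists'.1 h
  induction E with
  | svar i => rfl
  | ovar j => rfl
  | mem a b iha ihb =>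
    rcases Truth.ne_undef_iff.1 hd with hd | hd
    · obtain ⟨v, w, hv, hw, hm⟩ := interp_mem_eq_top.1 hd
      exact (interp_mem_eq_top.2 ⟨v, w, opt (iha h) v hv, opt (ihb h) w hw, hm⟩).trans hd.symm
    · obtain ⟨v, w, hv, hw, hm⟩ := interp_mem_eq_bot.1 hd
      exact (interp_mem_eq_bot.2 ⟨v, w, opt (iha h) v hv, opt (ihb h) w hw, hm⟩).trans hd.symm
  | eq a b iha ihb =>
    rcases Truth.ne_undef_iff.1 hd with hd | hd
    · obtain ⟨v, w, hv, hw, hm⟩ := interp_eq_eq_top.1 hd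
      exact (interp_eq_eq_top.2 ⟨v, w, opt (iha h) v hv, opt (ihb h) w hw, hm⟩).trans hd.symm
    · obtain ⟨v, w, hv, hw, hm⟩ := interp_eq_eq_bot.1 hd
      exact (interp_eq_eq_bot.2 ⟨v, w, opt (iha h) v hv, opt (ihb h) w hw, hm⟩).trans hd.symm
  | dn a iha =>
    rcases Truth.ne_undef_iff.1 hd with hd | hd
    · obtain ⟨v, hv⟩ := interp_dn_eq_top.1 hd
      exact (interp_dn_eq_top.2 ⟨v, opt (iha h) v hv⟩).trans hd.symm
    · exact (interp_dn_ne_bot hd).elim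
  | and P Q ihP ihQ =>
    have key : ∀ v, v ≠ Truth.undef → (interp η P x ξ = v → interp η' P x ξ = v) ∧
        (interp η Q x ξ = v → interp η' Q x ξ = v) := fun v hv =>
      ⟨fun hP => (ihP h (hP ▸ hv)).trans hP, fun hQ => (ihQ h (hQ ▸ hv)).trans hQ⟩
    rcases Truth.ne_undef_iff.1 hd with hd | hd
    · refine Eq.trans (Truth.and_eq_top.2 ?_) hd.symm
      exact (Truth.and_eq_top.1 hd).imp (key _ (by simp)).1 (key _ (by simp)).2
    · refine Eq.trans (Truth.and_eq_bot.2 ?_) hd.symm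
      exact (Truth.and_eq_bot.1 hd).imp (key _ (by simp)).1 (key _ (by simp)).2
  | or P Q ihP ihQ =>
    have key : ∀ v, v ≠ Truth.undef → (interp η P x ξ = v → interp η' P x ξ = v) ∧
        (interp η Q x ξ = v → interp η' Q x ξ = v) := fun v hv =>
      ⟨fun hP => (ihP h (hP ▸ hv)).trans hP, fun hQ => (ihQ h (hQ ▸ hv)).trans hQ⟩
    rcases Truth.ne_undef_iff.1 hd with hd | hd
    · refine Eq.trans (Truth.or_eq_top.2 ?_) hd.symm
      exact (Truth.or_eq_top.1 hd).imp (key _ (by simp)).1 (key _ (by simp)).2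
    · refine Eq.trans (Truth.or_eq_bot.2 ?_) hd.symm
      exact (Truth.or_eq_bot.1 hd).imp (key _ (by simp)).1 (key _ (by simp)).2
  | not P ih =>
    have : interp η P x ξ ≠ .undef := fun h0 => hd (by rw [interp, h0]; rfl)
    rw [interp, interp, ih h this]
  | allS X P ihX ihP =>
    have key : ∀ v, interp η X x ξ = some v → ∀ y ∈ v, ∀ t, t ≠ Truth.undef →
        interp η P (ext y x) ξ = t → interp η' P (ext y x) ξ = t := fun v hv y hy t ht hP =>
      (ihP (h.extS (isTransitive_Lset η _ (interp_set_mem h hv) hy)) (hP ▸ ht)).trans hP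
    rcases Truth.ne_undef_iff.1 hd with hd | hd
    · obtain ⟨v, hv, hm⟩ := interp_allS_eq_top.1 hd
      exact (interp_allS_eq_top.2 ⟨v, opt (ihX h) v hv, fun y hy => key v hv y hy _ (by simp)
        (hm y hy)⟩).trans hd.symm
    · obtain ⟨v, hv, y, hy, hm⟩ := interp_allS_eq_bot.1 hd
      exact (interp_allS_eq_bot.2 ⟨v, opt (ihX h) v hv, y, hy, key v hv y hy _ (by simp)
        hm⟩).trans hd.symm
  | exS X P ihX ihP =>
    have key : ∀ v, interp η X x ξ = some v → ∀ y ∈ v, ∀ t, t ≠ Truth.undef →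
        interp η P (ext y x) ξ = t → interp η' P (ext y x) ξ = t := fun v hv y hy t ht hP =>
      (ihP (h.extS (isTransitive_Lset η _ (interp_set_mem h hv) hy)) (hP ▸ ht)).trans hP
    rcases Truth.ne_undef_iff.1 hd with hd | hd
    · obtain ⟨v, hv, y, hy, hm⟩ := interp_exS_eq_top.1 hd
      exact (interp_exS_eq_top.2 ⟨v, opt (ihX h) v hv, y, hy, key v hv y hy _ (by simp)
        hm⟩).trans hd.symm
    · obtain ⟨v, hv, hm⟩ := interp_exS_eq_bot.1 hd
      exact (interp_exS_eq_bot.2 ⟨v, opt (ihX h) v hv, fun y hy => key v hv y hy _ (by simp)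
        (hm y hy)⟩).trans hd.symm
  | allO A P ihA ihP =>
    have key : ∀ α, interp η A x ξ = some α → ∀ β < α, ∀ t, t ≠ Truth.undef →
        interp η P x (ext β ξ) = t → interp η' P x (ext β ξ) = t := fun α hα β hβ t ht hP =>
      (ihP (h.extO (hβ.trans (interp_ord_lt h hα))) (hP ▸ ht)).trans hP
    rcases Truth.ne_undef_iff.1 hd with hd | hd
    · obtain ⟨v, hv, hm⟩ := interp_allO_eq_top.1 hd
      exact (interp_allO_eq_top.2 ⟨v, opt (ihA h) v hv, fun y hy => key v hv y hy _ (by simp)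
        (hm y hy)⟩).trans hd.symm
    · obtain ⟨v, hv, y, hy, hm⟩ := interp_allO_eq_bot.1 hd
      exact (interp_allO_eq_bot.2 ⟨v, opt (ihA h) v hv, y, hy, key v hv y hy _ (by simp)
        hm⟩).trans hd.symm
  | exO A P ihA ihP =>
    have key : ∀ α, interp η A x ξ = some α → ∀ β < α, ∀ t, t ≠ Truth.undef →
        interp η P x (ext β ξ) = t → interp η' P x (ext β ξ) = t := fun α hα β hβ t ht hP =>
      (ihP (h.extO (hβ.trans (interp_ord_lt h hα))) (hP ▸ ht)).trans hP
    rcases Truth.ne_undef_iff.1 hd with hd | hd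
    · obtain ⟨v, hv, y, hy, hm⟩ := interp_exO_eq_top.1 hd
      exact (interp_exO_eq_top.2 ⟨v, opt (ihA h) v hv, y, hy, key v hv y hy _ (by simp)
        hm⟩).trans hd.symm
    · obtain ⟨v, hv, hm⟩ := interp_exO_eq_bot.1 hd
      exact (interp_exO_eq_bot.2 ⟨v, opt (ihA h) v hv, fun y hy => key v hv y hy _ (by simp)
        (hm y hy)⟩).trans hd.symm
  | sep X P ihX ihP =>
    obtain ⟨s, hs⟩ := some_of hd
    rw [hs]
    obtain ⟨v, hv, hP, hsη, hsv⟩ := interp_sep_eq_some.1 hs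
    have key : ∀ y ∈ v, interp η' P (ext y x) ξ = interp η P (ext y x) ξ := fun y hy =>
      ihP (h.extS (isTransitive_Lset η _ (interp_set_mem h hv) hy)) (hP y hy)
    refine interp_sep_eq_some.2 ⟨v, opt (ihX h) v hv, fun y hy => key y hy ▸ hP y hy,
      Lset_mono hη hsη, ?_⟩
    rw [hsv]
    ext y
    simp only [ZFSet.mem_sep]
    exact and_congr_right fun hy => by rw [key y hy]
  | stage A ih =>
    obtain ⟨s, hs⟩ := some_of hd
    rw [hs]
    obtain ⟨α, hα, hs⟩ := interp_stage_eq_some.1 hs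
    exact interp_stage_eq_some.2 ⟨α, opt (ih h) α hα, hs⟩
  | min P ih =>
    obtain ⟨α, hs⟩ := some_of hd
    rw [hs]
    obtain ⟨hα, hP, hb⟩ := interp_min_eq_some.1 hs
    refine interp_min_eq_some.2 ⟨hα.trans_le hη, ?_, fun β hβ => ?_⟩
    · rw [ih (h.extO hα) (by simp [hP, Kind.IsDefined]), hP]
    · rw [ih (h.extO (hβ.trans hα)) (by simp [hb β hβ, Kind.IsDefined]), hb β hβ]

lemma interp_mono_term {η η' : Ordinal.{u}} (hη : η ≤ η') {s : Srt} {M N : ℕ}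
    {a : Expr (.term s) M N} {x : Fin M → ZFSet.{u}} {ξ : Fin N → Ordinal.{u}}
    (h : InDomain η x ξ) {v} (hv : interp η a x ξ = some v) : interp η' a x ξ = some v :=
  (interp_mono hη a h (by simp [hv, Kind.IsDefined])).trans hv

lemma interp_mono_fml {η η' : Ordinal.{u}} (hη : η ≤ η') {M N : ℕ} {P : Fml M N}
    {x : Fin M → ZFSet.{u}} {ξ : Fin N → Ordinal.{u}} (h : InDomain η x ξ) {v : Truth.{u}}
    (hv : interp η P x ξ = v) (hne : v ≠ .undef) : interp η' P x ξ = v :=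
  (interp_mono hη P h (by simp [hv, hne, Kind.IsDefined])).trans hv

/-! ### Substitution -/

lemma ext_comp_under {α : Type*} {m n : ℕ} (f : Fin m → Fin n) (y : α) (x : Fin n → α) :
    (fun i => ext y x (Expr.under f i)) = ext y fun i => x (f i) := by
  funext i
  cases i using Fin.cases <;> rfl

lemma interp_rename {η : Ordinal.{u}} {k : Kind} {M N M' N' : ℕ} (E : Expr k M N)
    (f : Fin M → Fin M') (g : Fin N → Fin N') (x : Fin M' → ZFSet.{u}) (ξ : Fin N' → Ordinal.{u}) :
    interp η (E.rename f g) x ξ = interp η E (fun i => x (f i)) fun j => ξ (g j) := by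
  induction E generalizing M' N' <;> simp only [Expr.rename, interp, ext_comp_under, *]

section Weakening

variable {η : Ordinal.{u}} {k : Kind} {M N : ℕ} {x : Fin M → ZFSet.{u}} {ξ : Fin N → Ordinal.{u}}

@[simp] lemma interp_upS (E : Expr k M N) (y : ZFSet.{u}) :
    interp η E.upS (ext y x) ξ = interp η E x ξ := interp_rename ..

@[simp] lemma interp_upO (E : Expr k M N) (β : Ordinal.{u}) :
    interp η E.upO x (ext β ξ) = interp η E x ξ := interp_rename ..

@[simp] lemma interp_upS' (E : Expr k (M + 1) N) (y w : ZFSet.{u}) :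
    interp η E.upS' (ext w (ext y x)) ξ = interp η E (ext w x) ξ := by
  rw [Expr.upS', interp_rename, ext_comp_under]
  rfl

@[simp] lemma interp_svar (i : Fin M) : interp η (.svar i : SetTm M N) x ξ = some (x i) := by
  rw [interp]

@[simp] lemma interp_ovar (j : Fin N) : interp η (.ovar j : OrdTm M N) x ξ = some (ξ j) := by
  rw [interp]

end Weakening

/-- Substitution of terms for the free variables. -/
def Expr.subst : {k : Kind} → {M N M' N' : ℕ} → (Fin M → SetTm M' N') → (Fin N → OrdTm M' N') →
    Expr k M N → Expr k M' N'
  | _, _, _, _, _, σ, _, .svar i => σ i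
  | _, _, _, _, _, _, τ, .ovar j => τ j
  | _, _, _, _, _, σ, τ, .mem a b => .mem (subst σ τ a) (subst σ τ b)
  | _, _, _, _, _, σ, τ, .eq a b => .eq (subst σ τ a) (subst σ τ b)
  | _, _, _, _, _, σ, τ, .dn a => .dn (subst σ τ a)
  | _, _, _, _, _, σ, τ, .and P Q => .and (subst σ τ P) (subst σ τ Q)
  | _, _, _, _, _, σ, τ, .or P Q => .or (subst σ τ P) (subst σ τ Q)
  | _, _, _, _, _, σ, τ, .not P => .not (subst σ τ P)
  | _, _, _, _, _, σ, τ, .allS X P => .allS (subst σ τ X)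
      (subst (ext (.svar 0) fun i => (σ i).upS) (fun j => (τ j).upS) P)
  | _, _, _, _, _, σ, τ, .exS X P => .exS (subst σ τ X)
      (subst (ext (.svar 0) fun i => (σ i).upS) (fun j => (τ j).upS) P)
  | _, _, _, _, _, σ, τ, .allO A P => .allO (subst σ τ A)
      (subst (fun i => (σ i).upO) (ext (.ovar 0) fun j => (τ j).upO) P)
  | _, _, _, _, _, σ, τ, .exO A P => .exO (subst σ τ A)
      (subst (fun i => (σ i).upO) (ext (.ovar 0) fun j => (τ j).upO) P)
  | _, _, _, _, _, σ, τ, .sep X P => .sep (subst σ τ X)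
      (subst (ext (.svar 0) fun i => (σ i).upS) (fun j => (τ j).upS) P)
  | _, _, _, _, _, σ, τ, .stage A => .stage (subst σ τ A)
  | _, _, _, _, _, σ, τ, .min P => .min
      (subst (fun i => (σ i).upO) (ext (.ovar 0) fun j => (τ j).upO) P)

lemma interp_subst {η : Ordinal.{u}} {k : Kind} {M N M' N' : ℕ} (E : Expr k M N)
    {σ : Fin M → SetTm M' N'} {τ : Fin N → OrdTm M' N'} {x : Fin M → ZFSet.{u}}
    {ξ : Fin N → Ordinal.{u}} {x' : Fin M' → ZFSet.{u}} {ξ' : Fin N' → Ordinal.{u}}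
    (hσ : ∀ i, interp η (σ i) x' ξ' = some (x i)) (hτ : ∀ j, interp η (τ j) x' ξ' = some (ξ j)) :
    interp η (E.subst σ τ) x' ξ' = interp η E x ξ := by
  have hS : ∀ {M N M' N' : ℕ} {σ : Fin M → SetTm M' N'} {x : Fin M → ZFSet.{u}}
      {x' : Fin M' → ZFSet.{u}} {ξ' : Fin N' → Ordinal.{u}} {τ : Fin N → OrdTm M' N'}
      {ξ : Fin N → Ordinal.{u}} (hσ : ∀ i, interp η (σ i) x' ξ' = some (x i))
      (hτ : ∀ j, interp η (τ j) x' ξ' = some (ξ j)) (y : ZFSet.{u}),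
      (∀ i, interp η (ext (.svar 0) (fun i => (σ i).upS) i : SetTm (M' + 1) N') (ext y x') ξ' =
        some (ext y x i)) ∧ ∀ j, interp η ((τ j).upS) (ext y x') ξ' = some (ξ j) := by
    intro M N M' N' σ x x' ξ' τ ξ hσ hτ y
    refine ⟨fun i => ?_, fun j => by rw [interp_upS, hτ]⟩
    cases i using Fin.cases with
    | zero => simp
    | succ i => simp [hσ]
  have hO : ∀ {M N M' N' : ℕ} {σ : Fin M → SetTm M' N'} {x : Fin M → ZFSet.{u}}
      {x' : Fin M' → ZFSet.{u}} {ξ' : Fin N' → Ordinal.{u}} {τ : Fin N → OrdTm M' N'}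
      {ξ : Fin N → Ordinal.{u}} (hσ : ∀ i, interp η (σ i) x' ξ' = some (x i))
      (hτ : ∀ j, interp η (τ j) x' ξ' = some (ξ j)) (β : Ordinal.{u}),
      (∀ i, interp η ((σ i).upO) x' (ext β ξ') = some (x i)) ∧ ∀ j,
        interp η (ext (.ovar 0) (fun j => (τ j).upO) j : OrdTm M' (N' + 1)) x' (ext β ξ') =
          some (ext β ξ j) := by
    intro M N M' N' σ x x' ξ' τ ξ hσ hτ y
    refine ⟨fun j => by rw [interp_upO, hσ], fun i => ?_⟩
    cases i using Fin.cases with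
    | zero => simp
    | succ i => simp [hτ]
  induction E generalizing M' N' with
  | svar i => rw [Expr.subst, hσ, interp_svar]
  | ovar j => rw [Expr.subst, hτ, interp_ovar]
  | mem a b iha ihb => simp only [Expr.subst, interp, iha hσ hτ, ihb hσ hτ]
  | eq a b iha ihb => simp only [Expr.subst, interp, iha hσ hτ, ihb hσ hτ]
  | dn a ih => simp only [Expr.subst, interp, ih hσ hτ]
  | and P Q iha ihb => simp only [Expr.subst, interp, iha hσ hτ, ihb hσ hτ]
  | or P Q iha ihb => simp only [Expr.subst, interp, iha hσ hτ, ihb hσ hτ]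
  | not P ih => simp only [Expr.subst, interp, ih hσ hτ]
  | allS X P ihX ihP =>
    have h := fun y => ihP (hS hσ hτ y).1 (hS hσ hτ y).2
    simp only [Expr.subst, interp, ihX hσ hτ, h]
  | exS X P ihX ihP =>
    have h := fun y => ihP (hS hσ hτ y).1 (hS hσ hτ y).2
    simp only [Expr.subst, interp, ihX hσ hτ, h]
  | sep X P ihX ihP =>
    have h := fun y => ihP (hS hσ hτ y).1 (hS hσ hτ y).2
    simp only [Expr.subst, interp, ihX hσ hτ, h]
  | allO X P ihX ihP =>
    have h := fun y => ihP (hO hσ hτ y).1 (hO hσ hτ y).2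
    simp only [Expr.subst, interp, ihX hσ hτ, h]
  | exO X P ihX ihP =>
    have h := fun y => ihP (hO hσ hτ y).1 (hO hσ hτ y).2
    simp only [Expr.subst, interp, ihX hσ hτ, h]
  | stage A ih => simp only [Expr.subst, interp, ih hσ hτ]
  | min P ihP =>
    have h := fun y => ihP (hO hσ hτ y).1 (hO hσ hτ y).2
    simp only [Expr.subst, interp, h]

/-! ### The interpretation at a limit ordinal is definable over its stage -/

namespace Dfn

variable {K : Set Ordinal.{u}} {M N M' N' : ℕ}

/-- Renaming of variables in a relation with a distinguished set variable. -/
lemma renameS {R : Ordinal.{u} → (Fin M → ZFSet.{u}) → (Fin N → Ordinal.{u}) → ZFSet.{u} → Prop}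
    (h : Dfn K fun α (z : Fin (M + 1) → ZFSet.{u}) ξ => R α (fun i => z i.succ) ξ (z 0))
    (c : Fin M') (f : Fin M → Fin M') (g : Fin N → Fin N') :
    Dfn K fun α (z : Fin M' → ZFSet.{u}) ξ => R α (fun i => z (f i)) (fun j => ξ (g j)) (z c) :=
  h.reindex (Fin.cases (.inl c) fun i => .inl (f i)) g

/-- Renaming of variables in a relation with a distinguished ordinal variable. -/
lemma renameO {R : Ordinal.{u} → (Fin M → ZFSet.{u}) → (Fin N → Ordinal.{u}) → Ordinal.{u} → Prop}
    (h : Dfn K fun α x (ζ : Fin (N + 1) → Ordinal.{u}) => R α x (fun j => ζ j.succ) (ζ 0))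
    (c : Fin N') (f : Fin M → Fin M') (g : Fin N → Fin N') :
    Dfn K fun α (z : Fin M' → ZFSet.{u}) (ζ : Fin N' → Ordinal.{u}) =>
      R α (fun i => z (f i)) (fun j => ζ (g j)) (ζ c) :=
  (h.reindex (fun i => .inl (f i)) (Fin.cases c g) :)

end Dfn

/-- The interpretation `I_α` of the expression is uniformly definable over `L_α`, for limit `α`. -/
def Expr.DfnInterp : {k : Kind} → {M N : ℕ} → Expr k M N → Prop
  | .fml, _, _, E => Dfn limits.{u} (fun α x ξ => interp α E x ξ = .top) ∧
      Dfn limits.{u} (fun α x ξ => interp α E x ξ = .bot)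
  | .term s, M, _, E => Dfn limits.{u} fun α (z : Fin (M + 1) → ZFSet.{u}) ξ =>
      ∃ w, interp α E (fun i => z i.succ) ξ = some w ∧ s.toZF w = z 0

/-- The value of the term, regarded as a set, is `v`. -/
def TermVal {s : Srt} {M N : ℕ} (a : Expr (.term s) M N) (α : Ordinal.{u}) (x : Fin M → ZFSet.{u})
    (ξ : Fin N → Ordinal.{u}) (v : ZFSet.{u}) : Prop :=
  ∃ w, interp α a x ξ = some w ∧ s.toZF w = v

lemma TermVal.mem {s : Srt} {M N : ℕ} {a : Expr (.term s) M N} {α : Ordinal.{u}}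
    {x : Fin M → ZFSet.{u}} {ξ : Fin N → Ordinal.{u}} {v : ZFSet.{u}} (h : TermVal a α x ξ v)
    (hx : InDomain α x ξ) : v ∈ Lset α := by
  obtain ⟨w, hw, rfl⟩ := h
  exact interp_valIn a hx w hw

lemma Expr.DfnInterp.quantS {M N : ℕ} {P : Fml (M + 1) N} (h : Expr.DfnInterp.{u} P) (v : Truth.{u})
    (hv : v ≠ .undef) : Dfn limits.{u} fun α (z : Fin (M + 1) → ZFSet.{u}) ξ =>
      interp α P (ext (z 0) fun i => z i.succ) ξ = v := by
  have : ∀ z : Fin (M + 1) → ZFSet.{u}, ext (z 0) (fun i => z i.succ) = z := Fin.cons_self_tail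
  simp only [this]
  rcases Truth.ne_undef_iff.1 hv with rfl | rfl
  exacts [h.1, h.2]

lemma Expr.DfnInterp.quantO {M N : ℕ} {P : Fml M (N + 1)} (h : Expr.DfnInterp.{u} P) (v : Truth.{u})
    (hv : v ≠ .undef) : Dfn limits.{u} fun α x (ζ : Fin (N + 1) → Ordinal.{u}) =>
      interp α P x (ext (ζ 0) fun j => ζ j.succ) = v := by
  have : ∀ z : Fin (N + 1) → Ordinal.{u}, ext (z 0) (fun i => z i.succ) = z := Fin.cons_self_tail
  simp only [this]
  rcases Truth.ne_undef_iff.1 hv with rfl | rfl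
  exacts [h.1, h.2]

section

variable {M N : ℕ}

/-- Definability of an existential statement about the value of a term. -/
lemma Expr.DfnInterp.exists_val {s : Srt} {a : Expr (.term s) M N} (h : Expr.DfnInterp.{u} a)
    {R : Ordinal.{u} → (Fin M → ZFSet.{u}) → (Fin N → Ordinal.{u}) → ZFSet.{u} → Prop}
    (hR : Dfn limits fun α (z : Fin (M + 1) → ZFSet.{u}) ξ => R α (fun i => z i.succ) ξ (z 0)) :
    Dfn limits fun α x ξ => ∃ v, TermVal a α x ξ v ∧ R α x ξ v := by
  have h' : Dfn limits fun α x ξ => ∃ v ∈ Lset α, TermVal a α x ξ v ∧ R α x ξ v :=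
    Dfn.exists_mem_Lset (Dfn.and h hR)
  exact h'.congr fun α _ x ξ hx => ⟨fun ⟨v, _, h⟩ => ⟨v, h⟩, fun ⟨v, h⟩ => ⟨v, h.1.mem hx, h⟩⟩

lemma Expr.DfnInterp.exists_val₂ {s t : Srt} {a : Expr (.term s) M N} {b : Expr (.term t) M N}
    (ha : Expr.DfnInterp.{u} a) (hb : Expr.DfnInterp.{u} b) {R : ZFSet.{u} → ZFSet.{u} → Prop}
    (hR : Dfn limits fun _ (z : Fin (M + 2) → ZFSet.{u}) (_ : Fin N → Ordinal.{u}) =>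
      R (z 1) (z 0)) :
    Dfn limits.{u} fun α x ξ => ∃ v, TermVal a α x ξ v ∧ ∃ w, TermVal b α x ξ w ∧ R v w := by
  refine ha.exists_val ?_
  have h' : Dfn limits fun α (z : Fin (M + 1) → ZFSet.{u}) ξ => ∃ w ∈ Lset α,
      TermVal b α (fun i => z i.succ) ξ w ∧ R (z 0) w :=
    Dfn.exists_mem_Lset (Dfn.and (Dfn.renameS (R := fun α x ξ v => TermVal b α x ξ v) hb 0
      (fun i => i.succ.succ) id) hR)
  exact h'.congr fun α _ x ξ hx => ⟨fun ⟨v, _, h⟩ => ⟨v, h⟩, fun ⟨v, h⟩ =>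
    ⟨v, h.1.mem ⟨fun i => hx.1 i.succ, hx.2⟩, h⟩⟩

end

lemma Expr.dfnInterp {k : Kind} {M N : ℕ} (E : Expr k M N) : Expr.DfnInterp.{u} E := by
  have quantS : ∀ {M N : ℕ} {P : Fml (M + 1) N} (_ : Expr.DfnInterp.{u} P) (v : Truth.{u})
      (_ : v ≠ .undef), Dfn limits.{u} fun α (z : Fin (M + 1 + 1) → ZFSet.{u}) ξ =>
        interp α P (ext (z 0) fun i => z i.succ.succ) ξ = v := fun {M N P} hP v hv =>
    Dfn.renameS (R := fun α x ξ y => interp α P (ext y x) ξ = v) (hP.quantS v hv) 0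
      (fun i => i.succ.succ) id
  have quantO : ∀ {M N : ℕ} {P : Fml M (N + 1)} (_ : Expr.DfnInterp.{u} P) (v : Truth.{u})
      (_ : v ≠ .undef), Dfn limits.{u} fun α (z : Fin (M + 1) → ZFSet.{u})
        (ζ : Fin (N + 1) → Ordinal.{u}) =>
        interp α P (fun i => z i.succ) (ext (ζ 0) fun j => ζ j.succ) = v := fun {M N P} hP v hv =>
    Dfn.renameO (R := fun α x ξ y => interp α P x (ext y ξ) = v) (hP.quantO v hv) 0
      (fun i => i.succ) Fin.succ
  have ordMem : ∀ {α β : Ordinal.{u}} {M N : ℕ} {A : OrdTm M N} {x : Fin M → ZFSet.{u}}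
      {ξ : Fin N → Ordinal.{u}}, InDomain α x ξ → interp α A x ξ = some β → ∀ {γ}, γ < β → γ < α :=
    fun hx hβ _ hγ => hγ.trans (interp_ord_lt hx hβ)
  induction E with
  | svar i =>
    exact (Dfn.eq (isVar_set i.succ) (isVar_set 0)).congr fun α _ z ξ _ => by simp [Srt.toZF]
  | ovar j =>
    exact (Dfn.eq (isVar_ord j) (isVar_set 0)).congr fun α _ z ξ _ => by simp [Srt.toZF]
  | mem a b iha ihb =>
    constructor
    · refine (iha.exists_val₂ ihb (R := fun v w => v ∈ w)
        (Dfn.mem (isVar_set _) (isVar_set _))).congr fun α _ x ξ _ => ?_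
      rw [interp_mem_eq_top]
      exact ⟨fun ⟨_, ⟨v, hv, rfl⟩, _, ⟨w, hw, rfl⟩, h⟩ => ⟨v, w, hv, hw, h⟩,
        fun ⟨v, w, hv, hw, h⟩ => ⟨_, ⟨v, hv, rfl⟩, _, ⟨w, hw, rfl⟩, h⟩⟩
    · refine (iha.exists_val₂ ihb (R := fun v w => v ∉ w)
        (Dfn.not (Dfn.mem (isVar_set _) (isVar_set _)))).congr fun α _ x ξ _ => ?_
      rw [interp_mem_eq_bot]
      exact ⟨fun ⟨_, ⟨v, hv, rfl⟩, _, ⟨w, hw, rfl⟩, h⟩ => ⟨v, w, hv, hw, h⟩,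
        fun ⟨v, w, hv, hw, h⟩ => ⟨_, ⟨v, hv, rfl⟩, _, ⟨w, hw, rfl⟩, h⟩⟩
  | eq a b iha ihb =>
    constructor
    · refine (iha.exists_val₂ ihb (R := fun v w => v = w)
        (Dfn.eq (isVar_set _) (isVar_set _))).congr fun α _ x ξ _ => ?_
      rw [interp_eq_eq_top]
      exact ⟨fun ⟨_, ⟨v, hv, rfl⟩, _, ⟨w, hw, rfl⟩, h⟩ => ⟨v, w, hv, hw, h⟩,
        fun ⟨v, w, hv, hw, h⟩ => ⟨_, ⟨v, hv, rfl⟩, _, ⟨w, hw, rfl⟩, h⟩⟩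
    · refine (iha.exists_val₂ ihb (R := fun v w => v ≠ w)
        (Dfn.not (Dfn.eq (isVar_set _) (isVar_set _)))).congr fun α _ x ξ _ => ?_
      rw [interp_eq_eq_bot]
      exact ⟨fun ⟨_, ⟨v, hv, rfl⟩, _, ⟨w, hw, rfl⟩, h⟩ => ⟨v, w, hv, hw, h⟩,
        fun ⟨v, w, hv, hw, h⟩ => ⟨_, ⟨v, hv, rfl⟩, _, ⟨w, hw, rfl⟩, h⟩⟩
  | dn a iha =>
    constructor
    · refine (iha.exists_val (R := fun _ _ _ _ => True) Dfn.true).congr fun α _ x ξ _ => ?_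
      rw [interp_dn_eq_top]
      exact ⟨fun ⟨_, ⟨v, hv, rfl⟩, _⟩ => ⟨v, hv⟩, fun ⟨v, hv⟩ => ⟨_, ⟨v, hv, rfl⟩, trivial⟩⟩
    · exact Dfn.true.not.congr fun α _ x ξ _ => iff_of_false (by simp) interp_dn_ne_bot
  | and P Q ihP ihQ =>
    exact ⟨(ihP.1.and ihQ.1).congr fun α _ x ξ _ => by rw [interp, Truth.and_eq_top],
      (ihP.2.or ihQ.2).congr fun α _ x ξ _ => by rw [interp, Truth.and_eq_bot]⟩
  | or P Q ihP ihQ =>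
    exact ⟨(ihP.1.or ihQ.1).congr fun α _ x ξ _ => by rw [interp, Truth.or_eq_top],
      (ihP.2.and ihQ.2).congr fun α _ x ξ _ => by rw [interp, Truth.or_eq_bot]⟩
  | not P ihP =>
    exact ⟨ihP.2.congr fun α _ x ξ _ => by rw [interp, Truth.not_eq_top],
      ihP.1.congr fun α _ x ξ _ => by rw [interp, Truth.not_eq_bot]⟩
  | @allS M N X P ihX ihP =>
    constructor
    · refine (ihX.exists_val (R := fun α x ξ v => ∀ y ∈ v, interp α P (ext y x) ξ = .top)
        (Dfn.forall_mem (isVar_set _) (quantS ihP .top (by simp)))).congr fun α _ x ξ _ => ?_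
      rw [interp_allS_eq_top]
      exact ⟨fun ⟨_, ⟨v, hv, rfl⟩, h⟩ => ⟨v, hv, h⟩, fun ⟨v, hv, h⟩ => ⟨_, ⟨v, hv, rfl⟩, h⟩⟩
    · refine (ihX.exists_val (R := fun α x ξ v => ∃ y ∈ v, interp α P (ext y x) ξ = .bot)
        (Dfn.exists_mem (isVar_set _) (quantS ihP .bot (by simp)))).congr fun α _ x ξ _ => ?_
      rw [interp_allS_eq_bot]
      exact ⟨fun ⟨_, ⟨v, hv, rfl⟩, h⟩ => ⟨v, hv, h⟩, fun ⟨v, hv, h⟩ => ⟨_, ⟨v, hv, rfl⟩, h⟩⟩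
  | @exS M N X P ihX ihP =>
    constructor
    · refine (ihX.exists_val (R := fun α x ξ v => ∃ y ∈ v, interp α P (ext y x) ξ = .top)
        (Dfn.exists_mem (isVar_set _) (quantS ihP .top (by simp)))).congr fun α _ x ξ _ => ?_
      rw [interp_exS_eq_top]
      exact ⟨fun ⟨_, ⟨v, hv, rfl⟩, h⟩ => ⟨v, hv, h⟩, fun ⟨v, hv, h⟩ => ⟨_, ⟨v, hv, rfl⟩, h⟩⟩
    · refine (ihX.exists_val (R := fun α x ξ v => ∀ y ∈ v, interp α P (ext y x) ξ = .bot)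
        (Dfn.forall_mem (isVar_set _) (quantS ihP .bot (by simp)))).congr fun α _ x ξ _ => ?_
      rw [interp_exS_eq_bot]
      exact ⟨fun ⟨_, ⟨v, hv, rfl⟩, h⟩ => ⟨v, hv, h⟩, fun ⟨v, hv, h⟩ => ⟨_, ⟨v, hv, rfl⟩, h⟩⟩
  | @allO M N A P ihA ihP =>
    constructor
    · refine (ihA.exists_val (R := fun α x ξ v => ∀ β < α, β.toZFSet ∈ v →
        interp α P x (ext β ξ) = .top) (Dfn.forall_lt (Dfn.imp (Dfn.mem (isVar_ord _)
          (isVar_set _)) (quantO ihP .top (by simp))))).congr fun α _ x ξ hx => ?_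
      rw [interp_allO_eq_top]
      constructor
      · rintro ⟨_, ⟨v, hv, rfl⟩, h⟩
        exact ⟨v, hv, fun β hβ => h β (ordMem hx hv hβ) (Ordinal.toZFSet_mem_toZFSet_iff.2 hβ)⟩
      · rintro ⟨v, hv, h⟩
        exact ⟨_, ⟨v, hv, rfl⟩, fun β _ hβ => h β (Ordinal.toZFSet_mem_toZFSet_iff.1 hβ)⟩
    · refine (ihA.exists_val (R := fun α x ξ v => ∃ β < α, β.toZFSet ∈ v ∧
        interp α P x (ext β ξ) = .bot) (Dfn.exists_lt (Dfn.and (Dfn.mem (isVar_ord _)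
          (isVar_set _)) (quantO ihP .bot (by simp))))).congr fun α _ x ξ hx => ?_
      rw [interp_allO_eq_bot]
      constructor
      · rintro ⟨_, ⟨v, hv, rfl⟩, β, -, hβ, h⟩
        exact ⟨v, hv, β, Ordinal.toZFSet_mem_toZFSet_iff.1 hβ, h⟩
      · rintro ⟨v, hv, β, hβ, h⟩
        exact ⟨_, ⟨v, hv, rfl⟩, β, ordMem hx hv hβ, Ordinal.toZFSet_mem_toZFSet_iff.2 hβ, h⟩
  | @exO M N A P ihA ihP =>
    constructor
    · refine (ihA.exists_val (R := fun α x ξ v => ∃ β < α, β.toZFSet ∈ v ∧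
        interp α P x (ext β ξ) = .top) (Dfn.exists_lt (Dfn.and (Dfn.mem (isVar_ord _)
          (isVar_set _)) (quantO ihP .top (by simp))))).congr fun α _ x ξ hx => ?_
      rw [interp_exO_eq_top]
      constructor
      · rintro ⟨_, ⟨v, hv, rfl⟩, β, -, hβ, h⟩
        exact ⟨v, hv, β, Ordinal.toZFSet_mem_toZFSet_iff.1 hβ, h⟩
      · rintro ⟨v, hv, β, hβ, h⟩
        exact ⟨_, ⟨v, hv, rfl⟩, β, ordMem hx hv hβ, Ordinal.toZFSet_mem_toZFSet_iff.2 hβ, h⟩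
    · refine (ihA.exists_val (R := fun α x ξ v => ∀ β < α, β.toZFSet ∈ v →
        interp α P x (ext β ξ) = .bot) (Dfn.forall_lt (Dfn.imp (Dfn.mem (isVar_ord _)
          (isVar_set _)) (quantO ihP .bot (by simp))))).congr fun α _ x ξ hx => ?_
      rw [interp_exO_eq_bot]
      constructor
      · rintro ⟨_, ⟨v, hv, rfl⟩, h⟩
        exact ⟨v, hv, fun β hβ => h β (ordMem hx hv hβ) (Ordinal.toZFSet_mem_toZFSet_iff.2 hβ)⟩
      · rintro ⟨v, hv, h⟩
        exact ⟨_, ⟨v, hv, rfl⟩, fun β _ hβ => h β (Ordinal.toZFSet_mem_toZFSet_iff.1 hβ)⟩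
  | @sep M N X P ihX ihP =>
    have h : Dfn limits.{u} fun α (z : Fin (M + 1) → ZFSet.{u}) ξ => ∃ v ∈ Lset α,
        TermVal X α (fun i => z i.succ) ξ v ∧
        (∀ y ∈ v, interp α P (ext y fun i => z i.succ) ξ = .top ∨
          interp α P (ext y fun i => z i.succ) ξ = .bot) ∧ z 0 ⊆ v ∧
        ∀ y ∈ v, (y ∈ z 0 ↔ interp α P (ext y fun i => z i.succ) ξ = .top) := by
      have q : ∀ v : Truth.{u}, v ≠ .undef → Dfn limits.{u}
          fun α (z : Fin (M + 1 + 1 + 1) → ZFSet.{u}) ξ =>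
            interp α P (ext (z 0) fun i => z i.succ.succ.succ) ξ = v := fun v hv =>
        Dfn.renameS (R := fun α x ξ y => interp α P (ext y x) ξ = v) (ihP.quantS v hv) 0
          (fun i => i.succ.succ.succ) id
      exact Dfn.exists_mem_Lset (Dfn.and (Dfn.renameS (R := fun α x ξ v => TermVal X α x ξ v) ihX 0
        (fun i => i.succ.succ) id) (Dfn.and (Dfn.forall_mem (isVar_set _) (Dfn.or
          (q .top (by simp)) (q .bot (by simp)))) (Dfn.and (Dfn.subset (isVar_set _) (isVar_set _))
          (Dfn.forall_mem (isVar_set _) (Dfn.iff (Dfn.mem (isVar_set _) (isVar_set _))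
            (q .top (by simp)))))))
    refine h.congr fun α _ z ξ hz => ?_
    have hz' : InDomain α (fun i => z i.succ) ξ := ⟨fun i => hz.1 _, hz.2⟩
    simp only [Srt.toZF, id_eq, exists_eq_right]
    refine Iff.trans ?_ interp_sep_eq_some.symm
    constructor
    · rintro ⟨_, -, ⟨v, hv, rfl⟩, hP, hs, h⟩
      refine ⟨v, hv, fun y hy => Truth.ne_undef_iff.2 (hP y hy), hz.1 0, ?_⟩
      ext y
      rw [ZFSet.mem_sep]
      exact ⟨fun hy => ⟨hs hy, (h y (hs hy)).1 hy⟩, fun hy => (h y hy.1).2 hy.2⟩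
    · rintro ⟨v, hv, hP, -, h⟩
      refine ⟨v, interp_set_mem hz' hv, ⟨v, hv, rfl⟩, fun y hy => Truth.ne_undef_iff.1 (hP y hy),
        h ▸ ZFSet.sep_subset, fun y hy => ?_⟩
      rw [h, ZFSet.mem_sep, and_iff_right hy]
  | @stage M N A ihA =>
    have h : Dfn limits.{u} fun α (z : Fin (M + 1) → ZFSet.{u}) ξ => ∃ v ∈ Lset α,
        TermVal A α (fun i => z i.succ) ξ v ∧ ∃ β < α, v = β.toZFSet ∧ z 0 = Lset β :=
      Dfn.exists_mem_Lset (Dfn.and (Dfn.renameS (R := fun α x ξ v => TermVal A α x ξ v) ihA 0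
        (fun i => i.succ.succ) id) (Dfn.comp₂ (R := fun α a b => ∃ β < α, a = β.toZFSet ∧
          b = Lset β) Dfn.stage (isVar_set _) (isVar_set _)))
    refine h.congr fun α _ z ξ hz => ?_
    have hz' : InDomain α (fun i => z i.succ) ξ := ⟨fun i => hz.1 _, hz.2⟩
    simp only [Srt.toZF, id_eq, exists_eq_right]
    refine Iff.trans ?_ interp_stage_eq_some.symm
    constructor
    · rintro ⟨_, -, ⟨γ, hγ, rfl⟩, β, hβ, h1, h2⟩
      obtain rfl := Ordinal.toZFSet_injective h1
      exact ⟨γ, hγ, h2⟩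
    · rintro ⟨γ, hγ, h2⟩
      have := interp_ord_lt hz' hγ
      exact ⟨_, toZFSet_mem_Lset.2 this, ⟨γ, hγ, rfl⟩, γ, this, rfl, h2⟩
  | @min M N P ihP =>
    have h : Dfn limits.{u} fun α (z : Fin (M + 1) → ZFSet.{u}) ξ => ∃ β < α, β.toZFSet = z 0 ∧
        interp α P (fun i => z i.succ) (ext β ξ) = .top ∧ ∀ γ < α, γ.toZFSet ∈ z 0 →
          interp α P (fun i => z i.succ) (ext γ ξ) = .bot :=
      Dfn.exists_lt (Dfn.and (Dfn.eq (isVar_ord _) (isVar_set _)) (Dfn.and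
        (quantO ihP .top (by simp)) (Dfn.forall_lt (Dfn.imp (Dfn.mem (isVar_ord _) (isVar_set _))
          (Dfn.renameO (R := fun α x ξ y => interp α P x (ext y ξ) = .bot)
            (ihP.quantO .bot (by simp)) 0 (fun i => i.succ) fun j => j.succ.succ)))))
    refine h.congr fun α _ z ξ hz => exists_congr fun β => ?_
    rw [interp_min_eq_some]
    constructor
    · rintro ⟨hβ, h0, h1, h2⟩
      exact ⟨⟨hβ, h1, fun γ hγ => h2 γ (hγ.trans hβ) (h0 ▸ Ordinal.toZFSet_mem_toZFSet_iff.2 hγ)⟩,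
        h0⟩
    · rintro ⟨⟨hβ, h1, h2⟩, h0⟩
      exact ⟨hβ, h0, h1, fun γ _ hγ => h2 γ (Ordinal.toZFSet_mem_toZFSet_iff.1
        (show γ.toZFSet ∈ β.toZFSet from (show β.toZFSet = z 0 from h0) ▸ hγ))⟩

/-! ### Values of some formulas and terms -/

section Values

variable {η : Ordinal.{u}} {M N : ℕ} {x : Fin M → ZFSet.{u}} {ξ : Fin N → Ordinal.{u}}

lemma interp_allS {X : SetTm M N} {P : Fml (M + 1) N} {v : ZFSet.{u}} {p : ZFSet.{u} → Prop}
    (hX : interp η X x ξ = some v) (hP : ∀ y ∈ v, interp η P (ext y x) ξ = .ofProp (p y)) :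
    interp η (.allS X P) x ξ = .ofProp (∀ y ∈ v, p y) := by
  refine Truth.eq_ofProp (fun h => interp_allS_eq_top.2 ⟨v, hX, fun y hy => ?_⟩) fun h =>
    interp_allS_eq_bot.2 ⟨v, hX, ?_⟩
  · rw [hP y hy, Truth.ofProp_eq_top]
    exact h y hy
  · push Not at h
    obtain ⟨y, hy, h⟩ := h
    exact ⟨y, hy, by rwa [hP y hy, Truth.ofProp_eq_bot]⟩

lemma interp_exS {X : SetTm M N} {P : Fml (M + 1) N} {v : ZFSet.{u}} {p : ZFSet.{u} → Prop}
    (hX : interp η X x ξ = some v) (hP : ∀ y ∈ v, interp η P (ext y x) ξ = .ofProp (p y)) :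
    interp η (.exS X P) x ξ = .ofProp (∃ y ∈ v, p y) := by
  refine Truth.eq_ofProp (fun ⟨y, hy, h⟩ => interp_exS_eq_top.2 ⟨v, hX, y, hy, ?_⟩) fun h =>
    interp_exS_eq_bot.2 ⟨v, hX, fun y hy => ?_⟩
  · rwa [hP y hy, Truth.ofProp_eq_top]
  · rw [hP y hy, Truth.ofProp_eq_bot]
    exact fun hp => h ⟨y, hy, hp⟩

lemma interp_allO {A : OrdTm M N} {P : Fml M (N + 1)} {α : Ordinal.{u}} {p : Ordinal.{u} → Prop}
    (hA : interp η A x ξ = some α) (hP : ∀ β < α, interp η P x (ext β ξ) = .ofProp (p β)) :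
    interp η (.allO A P) x ξ = .ofProp (∀ β < α, p β) := by
  refine Truth.eq_ofProp (fun h => interp_allO_eq_top.2 ⟨α, hA, fun y hy => ?_⟩) fun h =>
    interp_allO_eq_bot.2 ⟨α, hA, ?_⟩
  · rw [hP y hy, Truth.ofProp_eq_top]
    exact h y hy
  · push Not at h
    obtain ⟨y, hy, h⟩ := h
    exact ⟨y, hy, by rwa [hP y hy, Truth.ofProp_eq_bot]⟩

lemma interp_exO {A : OrdTm M N} {P : Fml M (N + 1)} {α : Ordinal.{u}} {p : Ordinal.{u} → Prop}
    (hA : interp η A x ξ = some α) (hP : ∀ β < α, interp η P x (ext β ξ) = .ofProp (p β)) :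
    interp η (.exO A P) x ξ = .ofProp (∃ β < α, p β) := by
  refine Truth.eq_ofProp (fun ⟨y, hy, h⟩ => interp_exO_eq_top.2 ⟨α, hA, y, hy, ?_⟩) fun h =>
    interp_exO_eq_bot.2 ⟨α, hA, fun y hy => ?_⟩
  · rwa [hP y hy, Truth.ofProp_eq_top]
  · rw [hP y hy, Truth.ofProp_eq_bot]
    exact fun hp => h ⟨y, hy, hp⟩

lemma interp_not {P : Fml M N} {p : Prop} (hP : interp η P x ξ = .ofProp p) :
    interp η P.not x ξ = .ofProp (¬ p) := by rw [interp, hP, Truth.not_ofProp]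

lemma interp_and {P Q : Fml M N} {p q : Prop} (hP : interp η P x ξ = .ofProp p)
    (hQ : interp η Q x ξ = .ofProp q) : interp η (P.and Q) x ξ = .ofProp (p ∧ q) := by
  rw [interp, hP, hQ, Truth.and_ofProp]

lemma interp_or {P Q : Fml M N} {p q : Prop} (hP : interp η P x ξ = .ofProp p)
    (hQ : interp η Q x ξ = .ofProp q) : interp η (P.or Q) x ξ = .ofProp (p ∨ q) := by
  rw [interp, hP, hQ, Truth.or_ofProp]

lemma interp_imp {P Q : Fml M N} {p q : Prop} (hP : interp η P x ξ = .ofProp p)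
    (hQ : interp η Q x ξ = .ofProp q) : interp η (P.imp Q) x ξ = .ofProp (p → q) := by
  rw [Expr.imp, interp_or (interp_not hP) hQ, imp_iff_not_or]

lemma interp_iff {P Q : Fml M N} {p q : Prop} (hP : interp η P x ξ = .ofProp p)
    (hQ : interp η Q x ξ = .ofProp q) : interp η (P.iff Q) x ξ = .ofProp (p ↔ q) := by
  rw [Expr.iff, interp_and (interp_imp hP hQ) (interp_imp hQ hP), iff_def]

lemma interp_mem_ord {A B : OrdTm M N} {α β : Ordinal.{u}} (hA : interp η A x ξ = some α)
    (hB : interp η B x ξ = some β) : interp η (.mem A B) x ξ = .ofProp (α < β) := by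
  rw [interp_mem hA hB]
  exact congrArg _ (propext Ordinal.toZFSet_mem_toZFSet_iff)

lemma interp_eq_ord {A B : OrdTm M N} {α β : Ordinal.{u}} (hA : interp η A x ξ = some α)
    (hB : interp η B x ξ = some β) : interp η (.eq A B) x ξ = .ofProp (α = β) := by
  rw [interp_eq hA hB]
  exact congrArg _ (propext Ordinal.toZFSet_injective.eq_iff)

/-- A term `min {α : P(α)}` denotes the least element of a set all of whose initial segments are
decided at `η`. -/
lemma interp_min {P : Fml M (N + 1)} {p : Ordinal.{u} → Prop} {α : Ordinal.{u}} (hα : α < η)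
    (hP : ∀ β ≤ α, interp η P x (ext β ξ) = .ofProp (p β)) (h : p α) (h' : ∀ β < α, ¬ p β) :
    interp η (.min P) x ξ = some α :=
  interp_min_eq_some.2 ⟨hα, by rwa [hP α le_rfl, Truth.ofProp_eq_top], fun β hβ => by
    rw [hP β hβ.le, Truth.ofProp_eq_bot]
    exact h' β hβ⟩

lemma interp_isZero {A : OrdTm M N} {α : Ordinal.{u}} (hA : interp η A x ξ = some α) :
    interp η (Expr.isZero A) x ξ = .ofProp (α = 0) := by
  rw [Expr.isZero, interp_allO (p := fun _ => False) hA fun β _ => by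
    rw [interp_not (interp_eq_ord (interp_ovar 0) (interp_ovar 0))]; simp]
  congr 1
  refine propext ⟨fun h => ?_, fun h β hβ => by simp [h] at hβ⟩
  by_contra h0
  exact h 0 (pos_iff_ne_zero.2 h0)

lemma interp_isSucc {A B : OrdTm M N} {α β : Ordinal.{u}} (hA : interp η A x ξ = some α)
    (hB : interp η B x ξ = some β) : interp η (Expr.isSucc B A) x ξ = .ofProp (β = α + 1) := by
  rw [Expr.isSucc, interp_and (interp_mem_ord hA hB) (interp_allO hB fun γ _ =>
    interp_or (interp_mem_ord (interp_ovar 0) ((interp_upO A γ).trans hA))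
      (interp_eq_ord (interp_ovar 0) ((interp_upO A γ).trans hA)))]
  congr 1
  refine propext ⟨fun ⟨h, h'⟩ => le_antisymm ?_ (Order.add_one_le_of_lt h), ?_⟩
  · by_contra hlt
    have := h' _ (not_le.1 hlt)
    simp only [ext_zero] at this
    rcases this with h1 | h1
    · exact absurd h1 (lt_add_one α).not_gt
    · exact (lt_add_one α).ne' h1
  · rintro rfl
    exact ⟨lt_add_one α, fun γ hγ => (Order.lt_add_one_iff.1 hγ).lt_or_eq⟩

lemma isSuccLimit_iff {α : Ordinal.{u}} :
    Order.IsSuccLimit α ↔ α ≠ 0 ∧ ∀ β < α, ∃ γ < α, β < γ := by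
  refine ⟨fun h => ⟨h.bot_lt.ne', fun β hβ => ⟨β + 1, h.add_one_lt hβ, lt_add_one β⟩⟩,
    fun ⟨h, h'⟩ => ⟨fun hm => h (isMin_iff_eq_bot.1 hm), fun β hβ => ?_⟩⟩
  obtain ⟨γ, h1, h2⟩ := h' β hβ.1
  exact hβ.2 h2 h1

lemma interp_isLimit {A : OrdTm M N} {α : Ordinal.{u}} (hA : interp η A x ξ = some α) :
    interp η (Expr.isLimit A) x ξ = .ofProp (Order.IsSuccLimit α) := by
  rw [Expr.isLimit, isSuccLimit_iff]
  exact interp_and (interp_not (interp_isZero hA)) (interp_allO hA fun β _ =>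
    interp_exO ((interp_upO A β).trans hA) fun γ _ =>
      interp_mem_ord (interp_ovar 1) (interp_ovar 0))

/-- An ordinal term for `0`. -/
def Expr.zero : OrdTm M N := min (eq (ovar 0 : OrdTm M (N + 1)) (ovar 0 : OrdTm M (N + 1)))

lemma interp_zero (h : 0 < η) : interp η (.zero : OrdTm M N) x ξ = some 0 :=
  interp_min (p := fun _ => True) h (fun β _ => by
    rw [interp_eq_ord (interp_ovar 0) (interp_ovar 0)]; simp) trivial
    fun β hβ => absurd hβ not_lt_zero

lemma interp_omega (h : Ordinal.omega0 < η) :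
    interp η (Expr.omega : OrdTm M N) x ξ = some Ordinal.omega0 :=
  interp_min h (fun _ _ => interp_isLimit (interp_ovar 0)) Ordinal.isSuccLimit_omega0
    fun _ hβ hl => absurd (Ordinal.omega0_le_of_isSuccLimit hl) (not_le.2 hβ)

lemma interp_succ {A : OrdTm M N} {α : Ordinal.{u}} (hA : interp η A x ξ = some α)
    (h : α + 1 < η) : interp η (Expr.succ A) x ξ = some (α + 1) :=
  interp_min h (fun β _ => interp_mem_ord ((interp_upO A β).trans hA) (interp_ovar 0))
    (lt_add_one α) fun _ hβ h' => absurd (Order.add_one_le_of_lt h') (not_le.2 hβ)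

end Values

/-! ### First-order formulas over stages, in the language of GDST -/

/-- The formula of GDST which says that `φ` holds in `L_A`, where the term `e i` (of either sort)
is put for the variable `i`. -/
def SetFml.toFml : SetFml → {M N : ℕ} → (ℕ → (s : Srt) × Expr (.term s) M N) → OrdTm M N → Fml M N
  | mem i j, _, _, e, _ => .mem (e i).2 (e j).2
  | neg φ, _, _, e, A => (φ.toFml e A).not
  | and φ ψ, _, _, e, A => (φ.toFml e A).and (ψ.toFml e A)
  | ex φ, _, _, e, A =>
      .exS (.stage A) (φ.toFml (push ⟨.set, .svar 0⟩ fun i => ⟨(e i).1, (e i).2.upS⟩) A.upS)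

lemma interp_toFml {η α : Ordinal.{u}} (φ : SetFml) {M N : ℕ} {x : Fin M → ZFSet.{u}}
    {ξ : Fin N → Ordinal.{u}} {e : ℕ → (s : Srt) × Expr (.term s) M N} {A : OrdTm M N}
    {v : ℕ → ZFSet.{u}} (hA : interp η A x ξ = some α) (he : ∀ i, TermVal (e i).2 η x ξ (v i)) :
    interp η (φ.toFml e A) x ξ = .ofProp (φ.Sat (Lset α) v) := by
  induction φ generalizing M v with
  | mem i j =>
    obtain ⟨a, ha, hi⟩ := he i
    obtain ⟨b, hb, hj⟩ := he j
    rw [SetFml.toFml, interp_mem ha hb, hi, hj]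
    rfl
  | neg φ ih => exact interp_not (ih hA he)
  | and φ ψ ih₁ ih₂ => exact interp_and (ih₁ hA he) (ih₂ hA he)
  | ex φ ih =>
    refine interp_exS (interp_stage hA) fun y _ => ih ((interp_upS A y).trans hA) fun i => ?_
    cases i with
    | zero => exact ⟨y, interp_svar 0, rfl⟩
    | succ i =>
      obtain ⟨a, ha, hi⟩ := he i
      exact ⟨a, (interp_upS _ y).trans ha, hi⟩

/-- A uniformly definable relation is expressed by a formula of GDST, the additional ordinal
variable `0` standing for the index of the stage. -/
lemma Dfn.exists_fml {K : Set Ordinal.{u}} {M N : ℕ}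
    {R : Ordinal.{u} → (Fin M → ZFSet.{u}) → (Fin N → Ordinal.{u}) → Prop} (h : Dfn K R) :
    ∃ P : Fml M (N + 1), ∀ η α x ξ, α < η → ∃ p, interp η P x (ext α ξ) = .ofProp p ∧
      (α ∈ K → InDomain α x ξ → (p ↔ R α x ξ)) := by
  obtain ⟨e, φ, h⟩ := h
  refine ⟨φ.toFml (fun i => (e i).elim ⟨.ord, .zero⟩
    (Sum.elim (fun i => ⟨.set, .svar i⟩) fun j => ⟨.ord, .ovar j.succ⟩)) (.ovar 0),
    fun η α x ξ hα => ⟨_, interp_toFml φ (v := envVal e x ξ) (interp_ovar 0) fun i => ?_,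
      fun hK hd => h α hK x ξ hd⟩⟩
  unfold envVal
  rcases e i with _ | i | j
  · exact ⟨(0 : Ordinal), interp_zero (pos_of_gt hα), Ordinal.toZFSet_zero⟩
  · exact ⟨x i, interp_svar i, rfl⟩
  · exact ⟨ξ j, interp_ovar j.succ, rfl⟩

/-! ### Reflection -/

/-- No ordinal term with parameters from `L_η` has the value `η` at `θ`. -/
def Indescribable (η θ : Ordinal.{u}) : Prop :=
  ∀ (M N : ℕ) (A : OrdTm M N) (x : Fin M → ZFSet.{u}) (ξ : Fin N → Ordinal.{u}),
    InDomain η x ξ → interp θ A x ξ ≠ some η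

/-- `y` is the value at `θ` of a term with ordinal parameters less than `η`. -/
def Named (η θ : Ordinal.{u}) (y : ZFSet.{u}) : Prop :=
  ∃ (N : ℕ) (X : SetTm 0 N) (ξ : Fin N → Ordinal.{u}),
    (∀ j, ξ j < η) ∧ interp θ X Fin.elim0 ξ = some y

@[simp] lemma Lset_zero : Lset (0 : Ordinal.{u}) = ∅ :=
  (ZFSet.eq_empty _).2 fun _ hy => (mem_Lset.1 hy).elim fun _ h => not_lt_zero h.1

lemma interp_rename_ord {η : Ordinal.{u}} {k : Kind} {N N' : ℕ} (E : Expr k 0 N)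
    (g : Fin N → Fin N') (x x' : Fin 0 → ZFSet.{u}) (ξ : Fin N' → Ordinal.{u}) :
    interp η (E.rename id g) x ξ = interp η E x' fun j => ξ (g j) := by
  rw [interp_rename, Subsingleton.elim x' fun i => x (id i)]

/-- Finitely many sets that have names have names with the same parameters. -/
lemma Named.exists_common {η θ : Ordinal.{u}} {n : ℕ} {y : Fin n → ZFSet.{u}}
    (h : ∀ i, Named η θ (y i)) : ∃ (N : ℕ) (X : Fin n → SetTm 0 N) (ξ : Fin N → Ordinal.{u}),
      (∀ j, ξ j < η) ∧ ∀ i, interp θ (X i) Fin.elim0 ξ = some (y i) := by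
  induction n with
  | zero => exact ⟨0, Fin.elim0, Fin.elim0, fun j => j.elim0, fun i => i.elim0⟩
  | succ n ih =>
    obtain ⟨N₁, X₁, ξ₁, hξ₁, h₁⟩ := h 0
    obtain ⟨N₂, X₂, ξ₂, hξ₂, h₂⟩ := ih fun i => h i.succ
    refine ⟨N₁ + N₂, Fin.cons (X₁.rename id (Fin.castAdd N₂))
      fun i => (X₂ i).rename id (Fin.natAdd N₁), Fin.append ξ₁ ξ₂, fun j => ?_, fun i => ?_⟩
    · cases j using Fin.addCases with
      | left j => simpa using hξ₁ j
      | right j => simpa using hξ₂ j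
    · cases i using Fin.cases with
      | zero =>
        rw [Fin.cons_zero, interp_rename_ord X₁ _ _ Fin.elim0]
        simpa using h₁
      | succ i =>
        rw [Fin.cons_succ, interp_rename_ord (X₂ i) _ _ Fin.elim0]
        simpa using h₂ i

/-- Every element of `L_η` has a name: it is defined over some `L_γ`, `γ < η`, by a first-order
formula with parameters from `L_γ`, which have names by induction. -/
lemma named_of_mem {η θ : Ordinal.{u}} (hηθ : η ≤ θ) {y : ZFSet.{u}} (hy : y ∈ Lset η) :
    Named η θ y := by
  suffices H : ∀ γ ≤ η, ∀ y ∈ Lset γ, Named η θ y from H η le_rfl y hy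
  intro γ
  induction γ using WellFoundedLT.induction with
  | ind γ ih =>
    intro hγη y hy
    have hyθ : y ∈ Lset θ := Lset_mono (hγη.trans hηθ) hy
    obtain ⟨β, hβγ, hy⟩ := mem_Lset.1 hy
    obtain ⟨hsub, φ, p, hp, hφ⟩ := (mem_defPow (isTransitive_Lset β)).1 hy
    have hβη := hβγ.trans_le hγη
    have hβθ := hβη.trans_le hηθ
    have hθ := pos_of_gt hβθ
    have hnamed : ∀ i : Fin φ.fv, Named η θ (p i) := fun i => by
      rcases hp i with h | h
      · exact ih β hβγ hβη.le _ h
      · refine ⟨0, .stage .zero, Fin.elim0, fun j => j.elim0, ?_⟩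
        rw [interp_stage (interp_zero hθ), h, Lset_zero]
    obtain ⟨N, X, ξ, hξ, hX⟩ := Named.exists_common hnamed
    -- the parameters that do not occur in `φ` are replaced by `∅`
    let e : ℕ → (s : Srt) × Expr (.term s) 1 (N + 1) := push ⟨.set, .svar 0⟩ fun i =>
      if h : i < φ.fv then ⟨.set, (X ⟨i, h⟩).upO.upS⟩ else ⟨.ord, .zero⟩
    let q : ℕ → ZFSet.{u} := fun i => if i < φ.fv then p i else ∅
    have hP : ∀ z, interp θ (φ.toFml e (.ovar 0)) (ext z Fin.elim0) (ext β ξ) =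
        .ofProp (φ.Sat (Lset β) (push z q)) := fun z =>
      interp_toFml φ (interp_ovar 0) fun i => by
        cases i with
        | zero => exact ⟨z, interp_svar 0, rfl⟩
        | succ i =>
          simp only [push_succ, e, q]
          by_cases hi : i < φ.fv
          · rw [dif_pos hi, if_pos hi]
            exact ⟨p i, by simpa using hX ⟨i, hi⟩, rfl⟩
          · rw [dif_neg hi, if_neg hi]
            exact ⟨(0 : Ordinal), interp_zero hθ, Ordinal.toZFSet_zero⟩
    refine ⟨N + 1, .sep (.stage (.ovar 0)) (φ.toFml e (.ovar 0)), ext β ξ,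
      fun j => Fin.cases hβη hξ j, interp_sep_eq_some.2 ⟨_, interp_stage (interp_ovar 0),
        fun z _ => (hP z).symm ▸ Truth.ofProp_ne_undef, hyθ, ?_⟩⟩
    ext z
    rw [ZFSet.mem_sep, hP z, Truth.ofProp_eq_top]
    have hq : φ.Sat (Lset β) (push z q) ↔ φ.Sat (Lset β) (push z p) :=
      φ.sat_congr _ fun i hi => by
        cases i with
        | zero => rfl
        | succ i => simp only [push_succ, q, if_pos (Nat.lt_of_succ_lt hi)]
    rw [hq]
    exact ⟨fun hz => ⟨hsub hz, (hφ z (hsub hz)).1 hz⟩, fun hz => (hφ z hz.1).2 hz.2⟩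

lemma indescribable_of_descr {η θ : Ordinal.{u}} (hηθ : η < θ) (h : descr η.toZFSet θ = η) :
    Indescribable η θ := by
  have hne : {α : Ordinal.{u} | ¬ ∃ (M : ℕ) (A : OrdTm M 0) (w : Fin M → ZFSet.{u}),
      (∀ i, w i ∈ η.toZFSet ∧ w i ∈ Lset θ) ∧ interp θ A w Fin.elim0 = some α}.Nonempty :=
    ⟨θ, fun ⟨M, A, w, hw, hA⟩ =>
      (interp_ord_lt ⟨fun i => (hw i).2, fun j => j.elim0⟩ hA).false⟩
  have hmem := csInf_mem hne
  change descr η.toZFSet θ ∈ _ at hmem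
  rw [h] at hmem
  intro M N A x ξ hd hA
  refine hmem ?_
  obtain ⟨N', X, ζ, hζ, hX⟩ := Named.exists_common fun i => named_of_mem hηθ.le (hd.1 i)
  -- all parameters become ordinals, which are in turn given by set variables
  let ρ : Fin (N' + N) → Ordinal.{u} := Fin.append ζ ξ
  have hρ : ∀ j, ρ j < η := fun j => by
    cases j using Fin.addCases with
    | left j => simpa [ρ] using hζ j
    | right j => simpa [ρ] using hd.2 j
  let A' : OrdTm 0 (N' + N) := A.subst (fun i => (X i).rename id (Fin.castAdd N))
    fun j => .ovar (Fin.natAdd N' j)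
  have hA' : interp θ A' Fin.elim0 ρ = some η := by
    rw [← hA]
    refine interp_subst A (fun i => ?_) fun j => ?_
    · rw [interp_rename_ord (X i) _ _ Fin.elim0]
      simpa [ρ] using hX i
    · rw [interp_ovar]
      simp [ρ]
  refine ⟨N' + N, A'.subst Fin.elim0 fun j => .min (.eq (.ovar 0 : OrdTm (N' + N) 1) (.svar j)),
    fun j => (ρ j).toZFSet, fun j => ⟨Ordinal.toZFSet_mem_toZFSet_iff.2 (hρ j),
      toZFSet_mem_Lset.2 ((hρ j).trans hηθ)⟩, ?_⟩
  rw [← hA']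
  refine interp_subst A' (fun i => i.elim0) fun j => interp_min (p := fun β => β = ρ j)
    ((hρ j).trans hηθ) (fun β _ => ?_) rfl fun β hβ => hβ.ne
  rw [interp_eq (interp_ovar 0) (interp_svar j)]
  exact congrArg _ (propext Ordinal.toZFSet_injective.eq_iff)

namespace Indescribable

variable {η θ : Ordinal.{u}}

/-- A property which is decided at `θ` for all smaller ordinals and which holds of `η` reflects to a
smaller ordinal, since `η` is not the least ordinal with this property. -/
lemma reflect (h : Indescribable η θ) (hηθ : η < θ) {M N : ℕ} {P : Fml M (N + 1)}
    {x : Fin M → ZFSet.{u}} {ξ : Fin N → Ordinal.{u}} (hd : InDomain η x ξ)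
    (hdec : ∀ β < η, interp θ P x (ext β ξ) ≠ .undef) (hP : interp θ P x (ext η ξ) = .top) :
    ∃ β < η, interp θ P x (ext β ξ) = .top := by
  by_contra hne
  refine h M N (.min P) x ξ hd (interp_min_eq_some.2 ⟨hηθ, hP, fun β hβ => ?_⟩)
  exact (Truth.ne_undef_iff.1 (hdec β hβ)).resolve_left fun hβ' => hne ⟨β, hβ, hβ'⟩

lemma isSuccLimit (h : Indescribable η θ) (hηθ : η < θ) : Order.IsSuccLimit η := by
  have hd : InDomain η (Fin.elim0 : Fin 0 → ZFSet.{u}) Fin.elim0 :=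
    ⟨fun i => i.elim0, fun j => j.elim0⟩
  refine isSuccLimit_iff.2 ⟨?_, fun β hβ => ?_⟩
  · rintro rfl
    exact h 0 0 .zero _ _ hd (interp_zero hηθ)
  · by_contra hne
    have hη : η = β + 1 := le_antisymm (not_lt.1 fun hlt => hne ⟨_, hlt, lt_add_one β⟩)
      (Order.add_one_le_of_lt hβ)
    refine h 0 1 (Expr.succ (.ovar 0)) Fin.elim0 (fun _ => β) ⟨fun i => i.elim0, fun _ => hβ⟩ ?_
    rw [interp_succ (interp_ovar 0) (hη ▸ hηθ), hη]

lemma omega_lt (h : Indescribable η θ) (hηθ : η < θ) : Ordinal.omega0 < η := by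
  refine (Ordinal.omega0_le_of_isSuccLimit (h.isSuccLimit hηθ)).lt_of_ne fun heq => ?_
  refine h 0 0 Expr.omega Fin.elim0 Fin.elim0 ⟨fun i => i.elim0, fun j => j.elim0⟩ ?_
  rw [interp_omega (heq ▸ hηθ), heq]

/-- Reflection of first-order properties of `L_η` to smaller limit stages. -/
lemma reflect_dfn (h : Indescribable η θ) (hηθ : η < θ) {M N : ℕ}
    {R : Ordinal.{u} → (Fin M → ZFSet.{u}) → (Fin N → Ordinal.{u}) → Prop} (hR : Dfn limits R)
    {x : Fin M → ZFSet.{u}} {ξ : Fin N → Ordinal.{u}} (hd : InDomain η x ξ) (hη : R η x ξ) :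
    ∃ β < η, Order.IsSuccLimit β ∧ InDomain β x ξ ∧ R β x ξ := by
  have hlim := h.isSuccLimit hηθ
  obtain ⟨γ, hγ, hdγ⟩ : ∃ γ < η, InDomain γ x ξ := by
    obtain ⟨γ, hγ, hx⟩ := exists_lt_forall_mem_Lset hlim fun c : Fin M ⊕ Fin N => varVal_mem hd c
    exact ⟨γ, hγ, fun i => hx (.inl i), fun j => toZFSet_mem_Lset.1 (hx (.inr j))⟩
  obtain ⟨P, hP⟩ := hR.exists_fml
  let Q : Fml M (N + 1 + 1) := (Expr.isLimit (.ovar 0)).and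
    ((Expr.mem (.ovar 1 : OrdTm M (N + 1 + 1)) (.ovar 0 : OrdTm M (N + 1 + 1))).and
      (P.rename id (ext 0 fun j => j.succ.succ)))
  have hQ : ∀ β ≤ η, ∃ p, interp θ Q x (ext β (ext γ ξ)) = .ofProp p ∧
      (p → Order.IsSuccLimit β ∧ γ < β ∧ R β x ξ) ∧ (β = η → p) := fun β hβ => by
    obtain ⟨p, hp, hpR⟩ := hP θ β x ξ (hβ.trans_lt hηθ)
    have hren : interp θ (P.rename id (ext 0 fun j => j.succ.succ)) x (ext β (ext γ ξ)) =
        .ofProp p := by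
      rw [interp_rename, ← hp]
      congr 1
      funext j
      cases j using Fin.cases <;> rfl
    refine ⟨_, interp_and (interp_isLimit (interp_ovar 0)) (interp_and
      (interp_mem_ord (interp_ovar 1) (interp_ovar 0)) hren), ?_, ?_⟩
    · rintro ⟨h1, h2, h3⟩
      exact ⟨h1, h2, (hpR h1 (hdγ.mono h2.le)).1 h3⟩
    · rintro rfl
      exact ⟨hlim, hγ, (hpR hlim hd).2 hη⟩
  obtain ⟨β, hβ, hβQ⟩ := h.reflect hηθ (P := Q) (x := x) (ξ := ext γ ξ) (hd.extO hγ)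
    (fun β hβ => by
      obtain ⟨p, hp, -⟩ := hQ β hβ.le
      exact hp ▸ Truth.ofProp_ne_undef)
    (by
      obtain ⟨p, hp, -, h2⟩ := hQ η le_rfl
      rw [hp, Truth.ofProp_eq_top]
      exact h2 rfl)
  obtain ⟨p, hp, h1, -⟩ := hQ β hβ.le
  obtain ⟨h1, h2, h3⟩ := h1 (Truth.ofProp_eq_top.1 (hp ▸ hβQ))
  exact ⟨β, hβ, h1, hdγ.mono h2.le, h3⟩

/-- A separation term all of whose instances are defined is defined: by reflection the instances are
already defined at some limit `β < η`, hence the set is first-order definable over `L_β`. -/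
lemma sep_isDefined (h : Indescribable η θ) (hηθ : η < θ) {M N : ℕ} {X : SetTm M N}
    {P : Fml (M + 1) N} {x : Fin M → ZFSet.{u}} {ξ : Fin N → Ordinal.{u}} (hd : InDomain η x ξ)
    {v : ZFSet.{u}} (hX : interp η X x ξ = some v)
    (hP : ∀ y ∈ v, interp η P (ext y x) ξ ≠ .undef) :
    interp η (.sep X P) x ξ = some (ZFSet.sep (fun y => interp η P (ext y x) ξ = .top) v) := by
  refine interp_sep_eq_some.2 ⟨v, hX, hP, ?_, rfl⟩
  have hv := interp_set_mem hd hX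
  have hPd := P.dfnInterp
  have q : ∀ t : Truth.{u}, t ≠ .undef → Dfn limits.{u} fun α (z : Fin (M + 1 + 1) → ZFSet.{u}) ξ =>
      interp α P (ext (z 0) fun i => z i.succ.succ) ξ = t := fun t ht =>
    Dfn.renameS (R := fun α x ξ y => interp α P (ext y x) ξ = t)
      (Expr.DfnInterp.quantS hPd t ht) 0 (fun i => i.succ.succ) id
  have hR : Dfn limits.{u} fun α (z : Fin (M + 1) → ZFSet.{u}) ξ => ∀ y ∈ z 0,
      interp α P (ext y fun i => z i.succ) ξ = .top ∨
        interp α P (ext y fun i => z i.succ) ξ = .bot :=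
    Dfn.forall_mem (isVar_set 0) (Dfn.or (q .top (by simp)) (q .bot (by simp)))
  obtain ⟨β, hβη, hlim, hdβ, hβ⟩ := h.reflect_dfn hηθ hR (hd.extS hv)
    fun y hy => Truth.ne_undef_iff.1 (hP y hy)
  have hvβ : v ∈ Lset β := hdβ.1 0
  have hxβ : InDomain β x ξ := ⟨fun i => hdβ.1 i.succ, hdβ.2⟩
  have hS : Dfn limits.{u} fun α (z : Fin (M + 1 + 1) → ZFSet.{u}) ξ => z 0 ∈ z 1 ∧
      interp α P (ext (z 0) fun i => z i.succ.succ) ξ = .top :=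
    Dfn.and (Dfn.mem (isVar_set _) (isVar_set _)) (q .top (by simp))
  have hmem := Dfn.sep_mem (R := fun α (z : Fin (M + 1) → ZFSet.{u}) ξ y => y ∈ z 0 ∧
      interp α P (ext y fun i => z i.succ) ξ = .top) hS hlim hdβ
  refine Lset_mono (Order.add_one_le_of_lt hβη) ?_
  convert hmem using 1
  ext y
  rw [ZFSet.mem_sep, ZFSet.mem_sep]
  change _ ↔ y ∈ Lset β ∧ y ∈ v ∧ interp β P (ext y x) ξ = .top
  refine ⟨fun ⟨hy, hyP⟩ => ?_, fun ⟨_, hy, hyP⟩ => ⟨hy, ?_⟩⟩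
  · have hyβ := isTransitive_Lset β v hvβ hy
    refine ⟨hyβ, hy, ?_⟩
    rw [← hyP]
    rcases hβ y hy with h' | h' <;>
      exact (interp_mono_fml hβη.le (hxβ.extS hyβ) h' (by simp)).symm ▸ h'
  · exact interp_mono_fml hβη.le (hxβ.extS (isTransitive_Lset β v hvβ hy)) hyP (by simp)

end Indescribable

/-! ### Transfinite iteration of operators on sets of natural numbers -/

/-- The iterate with index `α` of the operator `t` starting from `w`. Only subsets of `ℕ` matter, so
that unions at limits may be taken inside `ℕ`. -/
noncomputable def iterate (t : ZFSet.{u} → ZFSet.{u}) (w : ZFSet.{u}) (α : Ordinal.{u}) :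
    ZFSet.{u} :=
  Ordinal.limitRecOn (motive := fun _ => ZFSet.{u}) α w (fun _ v => t v) fun β _ f =>
    ZFSet.sep (fun n => ∃ (γ : Ordinal.{u}) (h : γ < β), n ∈ f γ h) Ordinal.omega0.toZFSet

/-- The sequence of the iterates with index less than `δ`, as a set of pairs. -/
noncomputable def iterSeq (t : ZFSet.{u} → ZFSet.{u}) (w : ZFSet.{u}) (δ : Ordinal.{u}) :
    ZFSet.{u} :=
  ZFSet.range fun β : Set.Iio δ => ZFSet.pair β.1.toZFSet (iterate t w β.1)

/-- `t` is an inflationary operator on the subsets of `ℕ`. -/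
def Inflationary (t : ZFSet.{u} → ZFSet.{u}) : Prop :=
  ∀ v, v ⊆ Ordinal.omega0.toZFSet → v ⊆ t v ∧ t v ⊆ Ordinal.omega0.toZFSet

section Iterate

variable {t : ZFSet.{u} → ZFSet.{u}} {w : ZFSet.{u}}

lemma iterate_zero : iterate t w 0 = w := Ordinal.limitRecOn_zero ..

lemma iterate_add_one (α : Ordinal.{u}) : iterate t w (α + 1) = t (iterate t w α) :=
  Ordinal.limitRecOn_add_one ..

lemma mem_iterate_of_limit {β : Ordinal.{u}} (hβ : Order.IsSuccLimit β) {n : ZFSet.{u}} :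
    n ∈ iterate t w β ↔ n ∈ Ordinal.omega0.toZFSet ∧ ∃ γ < β, n ∈ iterate t w γ := by
  unfold iterate
  rw [Ordinal.limitRecOn_limit (h := hβ), ZFSet.mem_sep]
  simp only [exists_prop]

lemma iterate_subset_omega (ht : Inflationary t) (hw : w ⊆ Ordinal.omega0.toZFSet)
    (α : Ordinal.{u}) : iterate t w α ⊆ Ordinal.omega0.toZFSet := by
  induction α using Ordinal.limitRecOn with
  | zero => rwa [iterate_zero]
  | add_one α ih => exact iterate_add_one (t := t) α ▸ (ht _ ih).2
  | limit β hβ _ => exact fun n hn => ((mem_iterate_of_limit hβ).1 hn).1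

lemma mem_iterate_limit (ht : Inflationary t) (hw : w ⊆ Ordinal.omega0.toZFSet)
    {β : Ordinal.{u}} (hβ : Order.IsSuccLimit β) {n : ZFSet.{u}} :
    n ∈ iterate t w β ↔ ∃ γ < β, n ∈ iterate t w γ :=
  (mem_iterate_of_limit hβ).trans ⟨fun h => h.2, fun h => ⟨by
    obtain ⟨γ, _, h⟩ := h
    exact iterate_subset_omega ht hw γ h, h⟩⟩

lemma iterate_mono (ht : Inflationary t) (hw : w ⊆ Ordinal.omega0.toZFSet)
    {α β : Ordinal.{u}} (h : α ≤ β) : iterate t w α ⊆ iterate t w β := by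
  induction β using Ordinal.limitRecOn with
  | zero => rw [nonpos_iff_eq_zero.1 h]
  | add_one β ih =>
    rcases h.eq_or_lt with rfl | h
    · exact fun _ => id
    · exact fun n hn => iterate_add_one (t := t) β ▸ (ht _ (iterate_subset_omega ht hw β)).1
        (ih (Order.lt_add_one_iff.1 h) hn)
  | limit β hβ ih =>
    rcases h.eq_or_lt with rfl | h
    · exact fun _ => id
    · exact fun n hn => (mem_iterate_limit ht hw hβ).2 ⟨α, h, hn⟩

end Iterate

lemma mem_iterSeq {t : ZFSet.{u} → ZFSet.{u}} {w p : ZFSet.{u}} {δ : Ordinal.{u}} :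
    p ∈ iterSeq t w δ ↔ ∃ β < δ, p = ZFSet.pair β.toZFSet (iterate t w β) := by
  simp [iterSeq, eq_comm]

lemma pair_mem_iterSeq {t : ZFSet.{u} → ZFSet.{u}} {w X : ZFSet.{u}} {β δ : Ordinal.{u}} :
    ZFSet.pair β.toZFSet X ∈ iterSeq t w δ ↔ β < δ ∧ X = iterate t w β := by
  rw [mem_iterSeq]
  constructor
  · rintro ⟨γ, hγ, h⟩
    obtain ⟨h1, h2⟩ := ZFSet.pair_inj.1 h
    obtain rfl := Ordinal.toZFSet_injective h1
    exact ⟨hγ, h2⟩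
  · rintro ⟨hβ, rfl⟩
    exact ⟨β, hβ, rfl⟩

/-- The conditions expressed by the formula `Expr.compat`. -/
def Compat (t : ZFSet.{u} → ZFSet.{u}) (w h : ZFSet.{u}) (δ ζ : Ordinal.{u}) : Prop :=
  (∀ p ∈ h, ∃ β < δ, ∃ X ∈ Lset ζ, p = ZFSet.pair β.toZFSet X ∧ X ⊆ Ordinal.omega0.toZFSet) ∧
  (∀ β < δ, ∃ X ∈ Lset ζ, ZFSet.pair β.toZFSet X ∈ h) ∧
  (∀ β < δ, ∀ X ∈ Lset ζ, ∀ Y ∈ Lset ζ,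
    ZFSet.pair β.toZFSet Y ∈ h ∧ ZFSet.pair β.toZFSet X ∈ h → Y = X) ∧
  (∀ β < δ, β = 0 → ZFSet.pair β.toZFSet w ∈ h) ∧
  (∀ β < δ, ∀ γ < δ, γ = β + 1 → ∀ X ∈ Lset ζ, ZFSet.pair β.toZFSet X ∈ h →
    ZFSet.pair γ.toZFSet (t X) ∈ h) ∧
  ∀ β < δ, Order.IsSuccLimit β → ∀ X ∈ Lset ζ, ZFSet.pair β.toZFSet X ∈ h → ∀ n ∈ Lset ζ,
    (n ∈ X ↔ ∃ γ < β, ∃ Y ∈ Lset ζ, ZFSet.pair γ.toZFSet Y ∈ h ∧ n ∈ Y)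

/-- The only compatible map with domain `δ` is the sequence of iterates. -/
lemma compat_iff {t : ZFSet.{u} → ZFSet.{u}} (ht : Inflationary t) {w h : ZFSet.{u}}
    (hw : w ⊆ Ordinal.omega0.toZFSet) {δ ζ : Ordinal.{u}} (hh : h ∈ Lset ζ) :
    Compat t w h δ ζ ↔ h = iterSeq t w δ := by
  have htr := isTransitive_Lset ζ
  have hval : ∀ {β X}, ZFSet.pair (Ordinal.toZFSet β) X ∈ h → X ∈ Lset ζ := fun hp =>
    (mem_of_pair_mem_Lset (htr h hh hp)).2
  constructor
  · rintro ⟨h1, h2, h3, h4, h5, h6⟩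
    have key : ∀ β, β < δ → ZFSet.pair β.toZFSet (iterate t w β) ∈ h := by
      intro β
      induction β using Ordinal.limitRecOn with
      | zero => exact fun hβ => iterate_zero (t := t) ▸ h4 0 hβ rfl
      | add_one β ih =>
        intro hβ
        have hβ' := (lt_add_one β).trans hβ
        exact iterate_add_one (t := t) β ▸ h5 β hβ' _ hβ rfl _ (hval (ih hβ')) (ih hβ')
      | limit β hl ih =>
        intro hβ
        obtain ⟨X, hX, hp⟩ := h2 β hβ
        convert hp using 2
        ext n
        rw [mem_iterate_limit ht hw hl]
        constructor
        · rintro ⟨γ, hγ, hn⟩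
          have hγ' := ih γ hγ (hγ.trans hβ)
          exact (h6 β hβ hl X hX hp n (htr _ (hval hγ') hn)).2 ⟨γ, hγ, _, hval hγ', hγ', hn⟩
        · intro hn
          obtain ⟨γ, hγ, Y, hY, hpY, hn⟩ := (h6 β hβ hl X hX hp n (htr X hX hn)).1 hn
          have hγ' := ih γ hγ (hγ.trans hβ)
          exact ⟨γ, hγ, h3 γ (hγ.trans hβ) _ (hval hγ') Y hY ⟨hpY, hγ'⟩ ▸ hn⟩
    ext p
    rw [mem_iterSeq]
    constructor
    · intro hp
      obtain ⟨β, hβ, X, hX, rfl, -⟩ := h1 p hp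
      exact ⟨β, hβ, by rw [h3 β hβ _ (hval (key β hβ)) X hX ⟨hp, key β hβ⟩]⟩
    · rintro ⟨β, hβ, rfl⟩
      exact key β hβ
  · rintro rfl
    have hmem : ∀ {β}, β < δ → iterate t w β ∈ Lset ζ := fun hβ =>
      hval (pair_mem_iterSeq.2 ⟨hβ, rfl⟩)
    refine ⟨fun p hp => ?_, fun β hβ => ⟨_, hmem hβ, pair_mem_iterSeq.2 ⟨hβ, rfl⟩⟩,
      fun β hβ X _ Y _ h => ?_, ?_, ?_, ?_⟩
    · obtain ⟨β, hβ, rfl⟩ := mem_iterSeq.1 hp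
      exact ⟨β, hβ, _, hmem hβ, rfl, iterate_subset_omega ht hw β⟩
    · exact (pair_mem_iterSeq.1 h.1).2.trans (pair_mem_iterSeq.1 h.2).2.symm
    · rintro β hβ rfl
      exact pair_mem_iterSeq.2 ⟨hβ, iterate_zero.symm⟩
    · rintro β hβ _ hγ rfl X _ hX
      rw [(pair_mem_iterSeq.1 hX).2]
      exact pair_mem_iterSeq.2 ⟨hγ, (iterate_add_one β).symm⟩
    · intro β hβ hl X _ hX n _
      rw [(pair_mem_iterSeq.1 hX).2, mem_iterate_limit ht hw hl]
      constructor
      · rintro ⟨γ, hγ, hn⟩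
        exact ⟨γ, hγ, _, hmem (hγ.trans hβ), pair_mem_iterSeq.2 ⟨hγ.trans hβ, rfl⟩, hn⟩
      · rintro ⟨γ, hγ, Y, _, hY, hn⟩
        exact ⟨γ, hγ, (pair_mem_iterSeq.1 hY).2 ▸ hn⟩

/-! ### The values of the formulas defining iteration -/

section Values

variable {η : Ordinal.{u}} {M N : ℕ} {x : Fin M → ZFSet.{u}} {ξ : Fin N → Ordinal.{u}} {r s : Srt}

lemma TermVal.upS {a : Expr (.term s) M N} {v : ZFSet.{u}} (h : TermVal a η x ξ v) (y : ZFSet.{u}) :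
    TermVal a.upS η (ext y x) ξ v := by
  obtain ⟨c, hc, rfl⟩ := h
  exact ⟨c, (interp_upS a y).trans hc, rfl⟩

lemma termVal_set {X : SetTm M N} {v : ZFSet.{u}} (h : interp η X x ξ = some v) :
    TermVal X η x ξ v := ⟨v, h, rfl⟩

lemma termVal_ord {A : OrdTm M N} {α : Ordinal.{u}} (h : interp η A x ξ = some α) :
    TermVal A η x ξ α.toZFSet := ⟨α, h, rfl⟩

lemma TermVal.interp_mem {a : Expr (.term r) M N} {b : Expr (.term s) M N} {v w : ZFSet.{u}}
    (ha : TermVal a η x ξ v) (hb : TermVal b η x ξ w) :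
    interp η (.mem a b) x ξ = .ofProp (v ∈ w) := by
  obtain ⟨c, hc, rfl⟩ := ha
  obtain ⟨d, hd, rfl⟩ := hb
  exact GDST.interp_mem hc hd

lemma TermVal.interp_eq {a : Expr (.term r) M N} {b : Expr (.term s) M N} {v w : ZFSet.{u}}
    (ha : TermVal a η x ξ v) (hb : TermVal b η x ξ w) :
    interp η (.eq a b) x ξ = .ofProp (v = w) := by
  obtain ⟨c, hc, rfl⟩ := ha
  obtain ⟨d, hd, rfl⟩ := hb
  exact GDST.interp_eq hc hd

lemma interp_isSingleton {v : SetTm M N} {a : Expr (.term s) M N} {v₀ a₀ : ZFSet.{u}}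
    (hv : interp η v x ξ = some v₀) (ha : TermVal a η x ξ a₀) :
    interp η (Expr.isSingleton v a) x ξ = .ofProp (v₀ = {a₀}) := by
  rw [Expr.isSingleton, interp_and (ha.interp_mem (termVal_set hv)) (interp_allS hv fun y _ =>
    (termVal_set (interp_svar 0)).interp_eq (ha.upS y))]
  congr 1
  refine propext ⟨fun ⟨h, h'⟩ => ?_, ?_⟩
  · ext y
    rw [ZFSet.mem_singleton]
    exact ⟨h' y, fun hy => hy ▸ h⟩
  · rintro rfl
    simp

lemma interp_isUPair {v : SetTm M N} {a : Expr (.term r) M N} {b : Expr (.term s) M N}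
    {v₀ a₀ b₀ : ZFSet.{u}} (hv : interp η v x ξ = some v₀) (ha : TermVal a η x ξ a₀)
    (hb : TermVal b η x ξ b₀) : interp η (Expr.isUPair v a b) x ξ = .ofProp (v₀ = {a₀, b₀}) := by
  rw [Expr.isUPair, interp_and (ha.interp_mem (termVal_set hv)) (interp_and
    (hb.interp_mem (termVal_set hv)) (interp_allS hv fun y _ => interp_or
      ((termVal_set (interp_svar 0)).interp_eq (ha.upS y))
      ((termVal_set (interp_svar 0)).interp_eq (hb.upS y))))]
  congr 1
  refine propext ⟨fun ⟨h, h', h''⟩ => ?_, ?_⟩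
  · ext y
    rw [ZFSet.mem_pair]
    exact ⟨h'' y, by rintro (rfl | rfl) <;> assumption⟩
  · rintro rfl
    simp

lemma interp_isPair {p : SetTm M N} {a : Expr (.term r) M N} {b : Expr (.term s) M N}
    {p₀ a₀ b₀ : ZFSet.{u}} (hp : interp η p x ξ = some p₀) (ha : TermVal a η x ξ a₀)
    (hb : TermVal b η x ξ b₀) :
    interp η (Expr.isPair p a b) x ξ = .ofProp (p₀ = ZFSet.pair a₀ b₀) := by
  have h1 : ∀ y, interp η (Expr.isSingleton (.svar 0) a.upS) (ext y x) ξ = .ofProp (y = {a₀}) :=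
    fun y => interp_isSingleton (interp_svar 0) (ha.upS y)
  have h2 : ∀ y, interp η (Expr.isUPair (.svar 0) a.upS b.upS) (ext y x) ξ =
    .ofProp (y = {a₀, b₀}) := fun y => interp_isUPair (interp_svar 0) (ha.upS y) (hb.upS y)
  rw [Expr.isPair, interp_and (interp_allS hp fun y _ => interp_or (h1 y) (h2 y)) (interp_and
    (interp_exS hp fun y _ => h1 y) (interp_exS hp fun y _ => h2 y))]
  congr 1
  refine propext ⟨fun ⟨h, ⟨y, hy, hy'⟩, z, hz, hz'⟩ => ?_, ?_⟩
  · ext c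
    rw [ZFSet.pair, ZFSet.mem_pair]
    exact ⟨h c, by rintro (rfl | rfl) <;> [exact hy' ▸ hy; exact hz' ▸ hz]⟩
  · rintro rfl
    simp [ZFSet.pair]

lemma interp_pairMem {h : SetTm M N} {a : Expr (.term r) M N} {b : Expr (.term s) M N}
    {h₀ a₀ b₀ : ZFSet.{u}} (hh : interp η h x ξ = some h₀) (ha : TermVal a η x ξ a₀)
    (hb : TermVal b η x ξ b₀) :
    interp η (Expr.pairMem a b h) x ξ = .ofProp (ZFSet.pair a₀ b₀ ∈ h₀) := by
  rw [Expr.pairMem, interp_exS hh fun y _ =>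
    interp_isPair (interp_svar 0) (ha.upS y) (hb.upS y)]
  simp

lemma interp_subOmega (hη : Ordinal.omega0 < η) {X : SetTm M N} {X₀ : ZFSet.{u}}
    (hX : interp η X x ξ = some X₀) :
    interp η (Expr.subOmega X) x ξ = .ofProp (X₀ ⊆ Ordinal.omega0.toZFSet) :=
  interp_allS hX fun _ _ => (termVal_set (interp_svar 0)).interp_mem (termVal_ord (interp_omega hη))

/-- Conjunction, where the second conjunct need only be evaluated if the first one is true. -/
lemma interp_and_of {P Q : Fml M N} {p q : Prop} (hP : interp η P x ξ = .ofProp p)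
    (hQ : p → interp η Q x ξ = .ofProp q) : interp η (P.and Q) x ξ = .ofProp (p ∧ q) := by
  by_cases hp : p
  · exact interp_and hP (hQ hp)
  · rw [interp, hP, Truth.eq_ofProp (P := p ∧ q) (fun h => absurd h.1 hp) fun _ =>
      Truth.and_eq_bot.2 (.inl (Truth.ofProp_eq_bot.2 hp))]

/-- Implication, where the conclusion need only be evaluated if the premise is true. -/
lemma interp_imp_of {P Q : Fml M N} {p q : Prop} (hP : interp η P x ξ = .ofProp p)
    (hQ : p → interp η Q x ξ = .ofProp q) : interp η (P.imp Q) x ξ = .ofProp (p → q) := by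
  by_cases hp : p
  · exact interp_imp hP (hQ hp)
  · rw [Expr.imp, interp, interp_not hP, Truth.eq_ofProp (P := p → q) (fun _ =>
      Truth.or_eq_top.2 (.inl (Truth.ofProp_eq_top.2 hp))) fun h =>
        absurd (fun h' => absurd h' hp) h]

/-- At `η`, the terms `T` and `W` denote the inflationary operator `t` and the initial set `w`. -/
structure Represents (η : Ordinal.{u}) (T : SetTm (M + 1) N) (W : SetTm M N)
    (x : Fin M → ZFSet.{u}) (ξ : Fin N → Ordinal.{u}) (t : ZFSet.{u} → ZFSet.{u}) (w : ZFSet.{u}) :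
    Prop where
  inflationary : Inflationary t
  subset : w ⊆ Ordinal.omega0.toZFSet
  op : ∀ v ∈ Lset η, v ⊆ Ordinal.omega0.toZFSet → interp η T (ext v x) ξ = some (t v)
  init : interp η W x ξ = some w

variable {T : SetTm (M + 1) N} {W : SetTm M N} {t : ZFSet.{u} → ZFSet.{u}} {w : ZFSet.{u}}

lemma Represents.upS (H : Represents η T W x ξ t w) (y : ZFSet.{u}) :
    Represents η T.upS' W.upS (ext y x) ξ t w :=
  ⟨H.1, H.2, fun v hv hv' => (interp_upS' T y v).trans (H.3 v hv hv'),
    (interp_upS W y).trans H.4⟩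

lemma Represents.upO (H : Represents η T W x ξ t w) (β : Ordinal.{u}) :
    Represents η T.upO W.upO x (ext β ξ) t w :=
  ⟨H.1, H.2, fun v hv hv' => (interp_upO T β).trans (H.3 v hv hv'),
    (interp_upO W β).trans H.4⟩

lemma interp_compat (hη : Ordinal.omega0 < η) (H : Represents η T W x ξ t w) {h : SetTm M N}
    {δ ζ : OrdTm M N} {h₀ : ZFSet.{u}} {δ₀ ζ₀ : Ordinal.{u}} (hh : interp η h x ξ = some h₀)
    (hδ : interp η δ x ξ = some δ₀) (hζ : interp η ζ x ξ = some ζ₀) (hζη : ζ₀ ≤ η) :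
    interp η (Expr.compat T W h δ ζ) x ξ = .ofProp (Compat t w h₀ δ₀ ζ₀) := by
  unfold Expr.compat Compat
  refine interp_and_of ?_ fun hC1 => interp_and ?_ <| interp_and ?_ <| interp_and ?_ <|
    interp_and ?_ ?_
  · refine interp_allS hh fun p _ => interp_exO ((interp_upS δ p).trans hδ) fun β _ =>
      interp_exS (interp_stage (by simpa using hζ)) fun X _ => interp_and
        (interp_isPair (interp_svar 1) (termVal_ord (interp_ovar 0)) (termVal_set (interp_svar 0)))
        (interp_subOmega hη (interp_svar 0))
  · exact interp_allO hδ fun β _ => interp_exS (interp_stage (by simpa using hζ)) fun X _ =>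
      interp_pairMem (by simpa using hh) (termVal_ord (interp_ovar 0)) (termVal_set (interp_svar 0))
  · exact interp_allO hδ fun β _ => interp_allS (interp_stage (by simpa using hζ)) fun X _ =>
      interp_allS (interp_stage (by simpa using hζ)) fun Y _ => interp_imp (interp_and
        (interp_pairMem (by simpa using hh) (termVal_ord (interp_ovar 0))
          (termVal_set (interp_svar 0)))
        (interp_pairMem (by simpa using hh) (termVal_ord (interp_ovar 0))
          (termVal_set (interp_svar 1)))) (interp_eq (interp_svar 0) (interp_svar 1))
  · exact interp_allO hδ fun β _ => interp_imp (interp_isZero (interp_ovar 0))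
      (interp_pairMem (by simpa using hh) (termVal_ord (interp_ovar 0))
        (termVal_set (by simpa using H.init)))
  · refine interp_allO hδ fun β _ => interp_allO (by simpa using hδ) fun γ _ =>
      interp_imp (interp_isSucc (interp_ovar 1) (interp_ovar 0)) <|
        interp_allS (interp_stage (by simpa using hζ)) fun X hX => interp_imp_of
          (interp_pairMem (by simpa using hh) (termVal_ord (interp_ovar 1))
            (termVal_set (interp_svar 0))) fun hp =>
          interp_pairMem (by simpa using hh) (termVal_ord (interp_ovar 0)) (termVal_set ?_)
    -- by the first condition `X` is a subset of `ℕ`, hence `T(X)` is defined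
    obtain ⟨γ, _, Y, _, hY, hYω⟩ := hC1 _ hp
    simpa using H.op X (Lset_mono hζη hX) ((ZFSet.pair_inj.1 hY).2 ▸ hYω)
  · exact interp_allO hδ fun β _ => interp_imp (interp_isLimit (interp_ovar 0)) <|
      interp_allS (interp_stage (by simpa using hζ)) fun X _ => interp_imp
        (interp_pairMem (by simpa using hh) (termVal_ord (interp_ovar 0))
          (termVal_set (interp_svar 0))) <|
        interp_allS (interp_stage (by simpa using hζ)) fun n _ => interp_iff
          (interp_mem (interp_svar 0) (interp_svar 1)) <|
          interp_exO (interp_ovar 0) fun γ _ => interp_exS (interp_stage (by simpa using hζ))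
            fun Y _ => interp_and (interp_pairMem (by simpa using hh) (termVal_ord (interp_ovar 0))
              (termVal_set (interp_svar 0))) (interp_mem (interp_svar 1) (interp_svar 0))

/-- `L_ζ` contains an initial segment of the sequence of iterates which is long enough for `α`. -/
def HasIter (t : ZFSet.{u} → ZFSet.{u}) (w : ZFSet.{u}) (α ζ : Ordinal.{u}) : Prop :=
  ∃ δ < ζ, α < δ ∧ iterSeq t w δ ∈ Lset ζ

lemma HasIter.iterate_mem {α ζ : Ordinal.{u}} (h : HasIter t w α ζ) :
    ZFSet.pair α.toZFSet (iterate t w α) ∈ Lset ζ ∧ iterate t w α ∈ Lset ζ := by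
  obtain ⟨δ, _, hα, hs⟩ := h
  have := isTransitive_Lset ζ _ hs (pair_mem_iterSeq.2 ⟨hα, rfl⟩)
  exact ⟨this, (mem_of_pair_mem_Lset this).2⟩

lemma interp_hasIter (hη : Ordinal.omega0 < η) (H : Represents η T W x ξ t w) {A ζ : OrdTm M N}
    {α ζ₀ : Ordinal.{u}} (hA : interp η A x ξ = some α) (hζ : interp η ζ x ξ = some ζ₀)
    (hζη : ζ₀ ≤ η) : interp η (Expr.hasIter T W A ζ) x ξ = .ofProp (HasIter t w α ζ₀) := by
  rw [Expr.hasIter, interp_exS (interp_stage hζ) fun h _ =>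
    interp_exO ((interp_upS ζ h).trans hζ) fun δ _ => interp_and
      (interp_mem_ord (β := δ) (by simpa using hA) (interp_ovar 0))
      (interp_compat hη ((H.upS h).upO δ) (interp_svar 0) (interp_ovar 0) (by simpa using hζ) hζη)]
  congr 1
  refine propext ⟨fun ⟨h, hh, δ, hδ, hα, hc⟩ => ?_, fun ⟨δ, hδ, hα, hs⟩ => ?_⟩
  · exact ⟨δ, hδ, hα, (compat_iff H.inflationary H.subset hh).1 hc ▸ hh⟩
  · exact ⟨_, hs, δ, hδ, hα, (compat_iff H.inflationary H.subset hs).2 rfl⟩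

/-- The term `T^A(W)` has the expected value, as soon as the iteration can be carried out inside
some stage before `L_η`. -/
lemma interp_iter (hη : Ordinal.omega0 < η) (H : Represents η T W x ξ t w) {A : OrdTm M N}
    {α ζ : Ordinal.{u}} (hA : interp η A x ξ = some α) (hζη : ζ < η) (hζ : HasIter t w α ζ) :
    interp η (Expr.iter T W A) x ξ = some (iterate t w α) := by
  classical
  obtain ⟨ζ₀, hζ₀η, hζ₀, hmin⟩ : ∃ ζ₀ < η, HasIter t w α ζ₀ ∧ ∀ ζ' < ζ₀, ¬ HasIter t w α ζ' :=
    ⟨sInf {ζ | HasIter t w α ζ}, (csInf_le' (s := {ζ | HasIter t w α ζ}) hζ).trans_lt hζη,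
      csInf_mem (s := {ζ | HasIter t w α ζ}) ⟨ζ, hζ⟩, fun ζ' h h' =>
      notMem_of_lt_csInf' (s := {ζ | HasIter t w α ζ}) h h'⟩
  have hI : interp η (Expr.iterIndex T W A) x ξ = some ζ₀ :=
    interp_min hζ₀η (fun β hβ => interp_hasIter hη (H.upO β) ((interp_upO A β).trans hA)
      (interp_ovar 0) (hβ.trans_lt hζ₀η).le) hζ₀ hmin
  have hP := fun n : ZFSet.{u} => interp_exS (η := η) (x := ext n x) (ξ := ξ)
    (X := .stage (Expr.iterIndex T W A).upS) (interp_stage (by simpa using hI)) fun h hh =>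
    interp_exO (p := fun δ => α < δ ∧ Compat t w h δ ζ₀ ∧ ∃ X ∈ Lset ζ₀,
        ZFSet.pair α.toZFSet X ∈ h ∧ n ∈ X) (A := (Expr.iterIndex T W A).upS.upS)
      (P := (Expr.mem A.upS.upS.upO (.ovar 0 : OrdTm (M + 2) (N + 1))).and
      ((Expr.compat T.upS'.upS'.upO W.upS.upS.upO (.svar 0) (.ovar 0)
        (Expr.iterIndex T W A).upS.upS.upO).and
        (.exS (.stage (Expr.iterIndex T W A).upS.upS.upO)
          ((Expr.pairMem A.upS.upS.upO.upS (.svar 0 : SetTm (M + 3) (N + 1)) (.svar 1)).and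
            (.mem (.svar 2 : SetTm (M + 3) (N + 1)) (.svar 0 : SetTm (M + 3) (N + 1)))))))
      (by simpa using hI) fun δ _ => interp_and
      (interp_mem_ord (β := δ) (by simpa using hA) (interp_ovar 0)) <| interp_and
      (interp_compat hη (((H.upS n).upS h).upO δ) (interp_svar 0) (interp_ovar 0)
        (by simpa using hI) hζ₀η.le) <|
      interp_exS (interp_stage (by simpa using hI)) fun X _ => interp_and
        (interp_pairMem (interp_svar 1) (termVal_ord (by simpa using hA))
          (termVal_set (interp_svar 0))) (interp_mem (interp_svar 2) (interp_svar 0))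
  refine interp_sep_eq_some.2 ⟨_, interp_stage hI, fun n _ => (hP n).symm ▸ Truth.ofProp_ne_undef,
    Lset_mono hζ₀η.le hζ₀.iterate_mem.2, ?_⟩
  ext n
  rw [ZFSet.mem_sep, hP n, Truth.ofProp_eq_top]
  constructor
  · intro hn
    have hm := hζ₀.iterate_mem.2
    obtain ⟨δ, hδ, hα, hs⟩ := hζ₀
    exact ⟨isTransitive_Lset _ _ hm hn, _, hs, δ, hδ, hα,
      (compat_iff H.inflationary H.subset hs).2 rfl, _, hm, pair_mem_iterSeq.2 ⟨hα, rfl⟩, hn⟩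
  · rintro ⟨-, h, hh, δ, hδ, hα, hc, X, -, hX, hn⟩
    rw [(compat_iff H.inflationary H.subset hh).1 hc] at hX
    exact (pair_mem_iterSeq.1 hX).2 ▸ hn

end Values

/-! ### Iterations inside reflecting stages -/

section Stages

variable {η θ : Ordinal.{u}} {M N : ℕ} {x : Fin M → ZFSet.{u}} {ξ : Fin N → Ordinal.{u}}
  {T : SetTm (M + 1) N} {W : SetTm M N} {t : ZFSet.{u} → ZFSet.{u}} {w : ZFSet.{u}}

lemma omega0_toZFSet_subset_Lset {η : Ordinal.{u}} (h : Ordinal.omega0 ≤ η) :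
    Ordinal.omega0.toZFSet ⊆ Lset η := fun n hn => by
  obtain ⟨k, hk, rfl⟩ := Ordinal.mem_toZFSet_iff.1 hn
  exact toZFSet_mem_Lset.2 (hk.trans_le h)

lemma hasIter_of_mem (hη : Order.IsSuccLimit η) {α δ : Ordinal.{u}} (hδ : δ < η) (hα : α < δ)
    (hs : iterSeq t w δ ∈ Lset η) : ∃ ζ < η, HasIter t w α ζ := by
  obtain ⟨γ, hγ, hs⟩ := Lset_exists_lt_of_limit hη hs
  exact ⟨max γ (δ + 1), max_lt hγ (hη.add_one_lt hδ), δ, lt_max_of_lt_right (lt_add_one δ), hα,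
    Lset_mono (le_max_left ..) hs⟩

lemma iterSeq_add_one (β : Ordinal.{u}) : iterSeq t w (β + 1) =
    insert (ZFSet.pair β.toZFSet (iterate t w β)) (iterSeq t w β) := by
  ext p
  rw [mem_iterSeq, ZFSet.mem_insert_iff, mem_iterSeq]
  constructor
  · rintro ⟨γ, hγ, rfl⟩
    rcases (Order.lt_add_one_iff.1 hγ).eq_or_lt with rfl | hγ
    · exact .inl rfl
    · exact .inr ⟨γ, hγ, rfl⟩
  · rintro (rfl | ⟨γ, hγ, rfl⟩)
    · exact ⟨β, lt_add_one β, rfl⟩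
    · exact ⟨γ, hγ.trans (lt_add_one β), rfl⟩

namespace Indescribable

/-- If the sequence of the iterates with index less than `β` belongs to `L_η`, then so does the next
iterate. At limits, this union is the value of a separation term. -/
lemma iterate_mem (h : Indescribable η θ) (hηθ : η < θ) (hd : InDomain η x ξ)
    (H : Represents η T W x ξ t w) {β : Ordinal.{u}} (hβ : β < η)
    (hs : iterSeq t w β ∈ Lset η) : iterate t w β ∈ Lset η := by
  have hlim := h.isSuccLimit hηθ
  have hω := h.omega_lt hηθ
  have hmem : ∀ γ < β, iterate t w γ ∈ Lset η := fun γ hγ => by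
    obtain ⟨ζ, hζ, hI⟩ := hasIter_of_mem hlim hβ hγ hs
    exact Lset_mono hζ.le hI.iterate_mem.2
  induction β using Ordinal.limitRecOn with
  | zero => exact iterate_zero (t := t) ▸ interp_set_mem hd H.init
  | add_one γ =>
    have hγ := hmem γ (lt_add_one γ)
    rw [iterate_add_one]
    exact interp_set_mem (hd.extS hγ)
      (H.op _ hγ (iterate_subset_omega H.inflationary H.subset γ))
  | limit β hβl =>
    have hP : ∀ n, interp η (.exO (.ovar 0) (.mem (.svar 0 : SetTm (M + 1) (N + 2))
        (Expr.iter T.upS'.upO.upO W.upS.upO.upO (.ovar 0)))) (ext n x) (ext β ξ) =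
          .ofProp (∃ γ < β, n ∈ iterate t w γ) := fun n =>
      interp_exO (interp_ovar 0) fun γ hγ => by
        obtain ⟨ζ, hζ, hI⟩ := hasIter_of_mem hlim hβ hγ hs
        exact interp_mem (interp_svar 0)
          (interp_iter hω (((H.upS n).upO β).upO γ) (interp_ovar 0) hζ hI)
    have hsep := h.sep_isDefined hηθ (X := .stage .omega) (hd.extO hβ)
      (interp_stage (interp_omega hω)) fun n _ => (hP n).symm ▸ Truth.ofProp_ne_undef
    convert interp_set_mem (hd.extO hβ) hsep using 1
    ext n
    rw [ZFSet.mem_sep, hP n, Truth.ofProp_eq_top, mem_iterate_limit H.inflationary H.subset hβl]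
    refine ⟨fun hn => ⟨?_, hn⟩, fun hn => hn.2⟩
    obtain ⟨γ, -, hn⟩ := hn
    exact omega0_toZFSet_subset_Lset le_rfl (iterate_subset_omega H.inflationary H.subset γ hn)

/-- The initial segments of the iteration belong to `L_η`. At limits `δ`, reflection provides a
stage `α < η` which contains all the shorter segments; the segment of length `δ` is then separated
from `L_α`. -/
lemma iterSeq_mem (h : Indescribable η θ) (hηθ : η < θ) (hd : InDomain η x ξ)
    (H : Represents η T W x ξ t w) (H' : Represents θ T W x ξ t w) {δ : Ordinal.{u}} (hδ : δ < η) :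
    iterSeq t w δ ∈ Lset η := by
  have hlim := h.isSuccLimit hηθ
  have hω := h.omega_lt hηθ
  induction δ using Ordinal.limitRecOn with
  | zero =>
    rw [(ZFSet.eq_empty (iterSeq t w 0)).2 fun p hp => by
      obtain ⟨β, hβ, -⟩ := mem_iterSeq.1 hp
      exact not_lt_zero hβ]
    exact empty_mem_Lset hδ
  | add_one β ih =>
    have hβ := (lt_add_one β).trans hδ
    rw [iterSeq_add_one]
    exact insert_mem_Lset_limit hlim (pair_mem_Lset_limit hlim (toZFSet_mem_Lset.2 hβ)
      (h.iterate_mem hηθ hd H hβ (ih hβ))) (ih hβ)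
  | limit δ hδl ih =>
    have hI : ∀ β < δ, ∃ ζ < η, HasIter t w β ζ := fun β hβ => by
      have hβ' := hδl.add_one_lt hβ
      exact hasIter_of_mem hlim (hβ'.trans hδ) (lt_add_one β) (ih _ hβ' (hβ'.trans hδ))
    have hQ : ∀ α ≤ η, interp θ (.allO (.ovar 1) (Expr.hasIter T.upO.upO.upO W.upO.upO.upO
        (.ovar 0) (.ovar 1))) x (ext α (ext δ ξ)) = .ofProp (∀ β < δ, HasIter t w β α) :=
      fun α hα => interp_allO (interp_ovar 1) fun β _ => interp_hasIter (hω.trans hηθ)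
        (((H'.upO δ).upO α).upO β) (interp_ovar 0) (interp_ovar 1) (hα.trans hηθ.le)
    obtain ⟨α, hα, hαI⟩ := h.reflect hηθ (hd.extO hδ)
      (fun β hβ => (hQ β hβ.le).symm ▸ Truth.ofProp_ne_undef) (by
        rw [hQ η le_rfl, Truth.ofProp_eq_top]
        intro β hβ
        have hβ' := hδl.add_one_lt hβ
        exact ⟨β + 1, hβ'.trans hδ, lt_add_one β, ih _ hβ' (hβ'.trans hδ)⟩)
    rw [hQ α hα.le, Truth.ofProp_eq_top] at hαI
    have hdα := (hd.extO hδ).extO hα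
    have hP : ∀ p, interp η (.exO (.ovar 1) (Expr.isPair (.svar 0 : SetTm (M + 1) (N + 3))
        (.ovar 0 : OrdTm (M + 1) (N + 3))
        (Expr.iter T.upS'.upO.upO.upO W.upS.upO.upO.upO (.ovar 0)))) (ext p x)
          (ext α (ext δ ξ)) = .ofProp (∃ β < δ, p = ZFSet.pair β.toZFSet (iterate t w β)) :=
      fun p =>
      interp_exO (interp_ovar 1) fun β hβ => by
        obtain ⟨ζ, hζ, hI⟩ := hI β hβ
        exact interp_isPair (interp_svar 0) (termVal_ord (interp_ovar 0)) (termVal_set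
          (interp_iter hω ((((H.upS p).upO δ).upO α).upO β) (interp_ovar 0) hζ hI))
    have hsep := h.sep_isDefined hηθ (X := .stage (.ovar 0)) hdα (interp_stage (interp_ovar 0))
      fun p _ => (hP p).symm ▸ Truth.ofProp_ne_undef
    convert interp_set_mem hdα hsep using 1
    ext p
    rw [ZFSet.mem_sep, hP p, Truth.ofProp_eq_top, mem_iterSeq]
    refine ⟨fun hp => ⟨?_, hp⟩, fun hp => hp.2⟩
    obtain ⟨β, hβ, rfl⟩ := hp
    exact (hαI β hβ).iterate_mem.1

/-- All terms `T^A(W)` are defined at a reflecting ordinal, if `A` is. -/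
lemma interp_iter (h : Indescribable η θ) (hηθ : η < θ) (hd : InDomain η x ξ)
    (H : Represents η T W x ξ t w) (H' : Represents θ T W x ξ t w) {A : OrdTm M N} {α : Ordinal.{u}}
    (hA : interp η A x ξ = some α) : interp η (Expr.iter T W A) x ξ = some (iterate t w α) := by
  have hlim := h.isSuccLimit hηθ
  have hα := hlim.add_one_lt (interp_ord_lt hd hA)
  obtain ⟨ζ, hζ, hI⟩ := hasIter_of_mem hlim hα (lt_add_one α) (h.iterSeq_mem hηθ hd H H' hα)
  exact GDST.interp_iter (h.omega_lt hηθ) H hA hζ hI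

variable {η₀ η₁ η₂ : Ordinal.{u}}

/-- The iteration has become constant at `η₀`: otherwise `η₀` would be definable at `η₁`, as the
least `α` such that a certain natural number belongs to the iterate with index `α + 1`. -/
lemma iterate_eq (h₀ : Indescribable η₀ η₁) (h₀₁ : η₀ < η₁) (h₁ : Indescribable η₁ η₂)
    (h₁₂ : η₁ < η₂) (hd : InDomain η₀ x ξ) (H₁ : Represents η₁ T W x ξ t w)
    (H₂ : Represents η₂ T W x ξ t w) : iterate t w (η₀ + 1) = iterate t w η₀ := by
  have hmono := fun {α β} => iterate_mono H₁.inflationary H₁.subset (α := α) (β := β)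
  by_contra hne
  obtain ⟨n, hn, hn'⟩ : ∃ n ∈ iterate t w (η₀ + 1), n ∉ iterate t w η₀ := by
    by_contra! hall
    exact hne (ZFSet.ext fun n => ⟨hall n, fun hn => hmono (lt_add_one η₀).le hn⟩)
  have hnω := iterate_subset_omega H₁.inflationary H₁.subset _ hn
  have hd' : InDomain η₀ (ext n x) ξ :=
    hd.extS (omega0_toZFSet_subset_Lset (h₀.omega_lt h₀₁).le hnω)
  refine h₀ (M + 1) N (.min (.mem (.svar 0 : SetTm (M + 1) (N + 1))
    (Expr.iter T.upS'.upO W.upS.upO (Expr.succ (.ovar 0))))) (ext n x) ξ hd'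
    (interp_min (p := fun α => n ∈ iterate t w (α + 1)) h₀₁ (fun α hα => ?_) hn fun α hα hn => ?_)
  · have hα' := hα.trans_lt h₀₁
    exact interp_mem (interp_svar 0) (h₁.interp_iter h₁₂ ((hd'.mono h₀₁.le).extO hα')
      ((H₁.upS n).upO α) ((H₂.upS n).upO α)
      (interp_succ (interp_ovar 0) ((h₁.isSuccLimit h₁₂).add_one_lt hα')))
  · exact hn' (hmono (Order.add_one_le_of_lt hα) hn)

/-- The closure ordinal of the iteration is less than `η₀`, being definable at `η₁`; hence the
result of the iteration is defined at `η₀`. -/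
lemma iterInfty_isDefined (h₀ : Indescribable η₀ η₁) (h₀₁ : η₀ < η₁) (h₁ : Indescribable η₁ η₂)
    (h₁₂ : η₁ < η₂) (hd : InDomain η₀ x ξ) (H₀ : Represents η₀ T W x ξ t w)
    (H₁ : Represents η₁ T W x ξ t w) (H₂ : Represents η₂ T W x ξ t w) :
    ∃ v, interp η₀ (Expr.iterInfty T W) x ξ = some v := by
  obtain ⟨α, hα, hmin⟩ : ∃ α, iterate t w (α + 1) = iterate t w α ∧
      ∀ β < α, iterate t w (β + 1) ≠ iterate t w β :=
    ⟨_, csInf_mem (s := {α | iterate t w (α + 1) = iterate t w α})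
      ⟨η₀, h₀.iterate_eq h₀₁ h₁ h₁₂ hd H₁ H₂⟩, fun β hβ hβ' =>
        notMem_of_lt_csInf' (s := {α | iterate t w (α + 1) = iterate t w α}) hβ hβ'⟩
  have hαη : α ≤ η₀ := not_lt.1 fun hlt => hmin _ hlt (h₀.iterate_eq h₀₁ h₁ h₁₂ hd H₁ H₂)
  have hval : ∀ {η θ : Ordinal.{u}}, Indescribable η θ → η < θ → InDomain η x ξ →
      Represents η T W x ξ t w → Represents θ T W x ξ t w → α < η → interp η
        (.min (.eq (Expr.iter T.upO W.upO (Expr.succ (.ovar 0)))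
          (Expr.iter T.upO W.upO (.ovar 0)))) x ξ = some α := fun {η θ} h hηθ hd H H' hα' =>
    interp_min hα' (fun β hβ => interp_eq
      (h.interp_iter hηθ (hd.extO (hβ.trans_lt hα')) (H.upO β) (H'.upO β) (interp_succ
        (interp_ovar 0) ((h.isSuccLimit hηθ).add_one_lt (hβ.trans_lt hα'))))
      (h.interp_iter hηθ (hd.extO (hβ.trans_lt hα')) (H.upO β) (H'.upO β) (interp_ovar 0)))
      hα hmin
  have hαη' : α < η₀ := hαη.lt_of_ne fun heq => by
    refine h₀ M N _ x ξ hd (heq ▸ hval h₁ h₁₂ (hd.mono h₀₁.le) H₁ H₂ (hαη.trans_lt h₀₁))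
  exact ⟨_, h₀.interp_iter h₀₁ hd H₀ H₁ (hval h₀ h₀₁ hd H₀ H₁ hαη')⟩

end Indescribable

end Stages

/-! ### Expressions of NMID are defined at sufficiently reflecting ordinals -/

/-- The ordinals `e 0 < ⋯ < e k` witness that `e 0` is `k`-fold reflecting. The values of the
sequence at larger indices are irrelevant. -/
def ReflectingChain (k : ℕ) (e : ℕ → Ordinal.{u}) : Prop :=
  ∀ i < k, e i < e (i + 1) ∧ Indescribable (e i) (e (i + 1))

lemma ReflectingChain.le {k : ℕ} {e : ℕ → Ordinal.{u}} (h : ReflectingChain k e) {i j : ℕ}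
    (hij : i ≤ j) (hj : j ≤ k) : e i ≤ e j := by
  induction j, hij using Nat.le_induction with
  | base => exact le_rfl
  | succ j _ ih => exact (ih (by omega)).trans (h j (by omega)).1.le

lemma ReflectingChain.shift {k m j : ℕ} {e : ℕ → Ordinal.{u}} (h : ReflectingChain k e)
    (hjk : j + m ≤ k) : ReflectingChain m fun i => e (j + i) := fun i hi => h (j + i) (by omega)

namespace NMID

/-- Every `k`-fold reflecting ordinal (with witnesses at which the expression is regular) is large
enough for the expression to be defined. -/
def DefinedAtFold (k : ℕ) {c : Kind} {M N : ℕ} (E : NMID c M N) : Prop :=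
  ∀ e : ℕ → Ordinal.{u}, ReflectingChain k e → ∀ x ξ, InDomain (e 0) x ξ →
    (∀ i ≤ k, E.RegularAt (e i) x ξ) → c.IsDefined (E.val (e 0) x ξ)

variable {k m M N : ℕ} {c : Kind}

lemma DefinedAtFold.mono {E : NMID c M N} (h : DefinedAtFold.{u} k E) (hkm : k ≤ m) :
    DefinedAtFold.{u} m E := fun e he x ξ hd hr =>
  h e (fun i hi => he i (by omega)) x ξ hd fun i hi => hr i (by omega)

lemma DefinedAtFold.exists_val {s : Srt} {a : NMID (.term s) M N} (h : DefinedAtFold.{u} k a)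
    {e : ℕ → Ordinal.{u}} (he : ReflectingChain k e) {x : Fin M → ZFSet.{u}}
    {ξ : Fin N → Ordinal.{u}} (hd : InDomain (e 0) x ξ) (hr : ∀ i ≤ k, a.RegularAt (e i) x ξ) :
    ∃ v, ∀ i ≤ k, interp (e i) a.toExpr x ξ = some v := by
  obtain ⟨v, hv⟩ := Option.ne_none_iff_exists'.1 (h e he x ξ hd hr)
  exact ⟨v, fun i hi => interp_mono_term (he.le (Nat.zero_le i) hi) hd hv⟩

lemma _root_.GDST.Truth.eq_ofProp_of_ne_undef {v : Truth.{u}} (h : v ≠ .undef) :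
    v = .ofProp (v = .top) :=
  Truth.eq_ofProp id fun h' => (Truth.ne_undef_iff.1 h).resolve_left h'

/-- The body of a set quantifier or separation term is defined for all values of its variable. -/
lemma DefinedAtFold.body {X : NMID (.term .set) M N} {P : NMID .fml (M + 1) N}
    (hX : DefinedAtFold.{u} k X) (hP : DefinedAtFold.{u} k P) {e : ℕ → Ordinal.{u}}
    (he : ReflectingChain k e) {x : Fin M → ZFSet.{u}} {ξ : Fin N → Ordinal.{u}}
    (hd : InDomain (e 0) x ξ) (hr : ∀ i ≤ k, X.RegularAt (e i) x ξ ∧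
      ∀ v, X.val (e i) x ξ = some v → ∀ y ∈ v, P.RegularAt (e i) (ext y x) ξ) :
    ∃ v, interp (e 0) X.toExpr x ξ = some v ∧
      ∀ y ∈ v, interp (e 0) P.toExpr (ext y x) ξ ≠ .undef := by
  obtain ⟨v, hv⟩ := hX.exists_val he hd fun i hi => (hr i hi).1
  have hv0 := hv 0 (Nat.zero_le k)
  refine ⟨v, hv0, fun y hy => hP e he _ _ (hd.extS ?_) fun i hi => (hr i hi).2 v (hv i hi) y hy⟩
  exact isTransitive_Lset _ v (interp_set_mem hd hv0) hy

/-- The body of an ordinal quantifier is defined for all values of its variable. -/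
lemma DefinedAtFold.bodyOrd {A : NMID (.term .ord) M N} {P : NMID .fml M (N + 1)}
    (hA : DefinedAtFold.{u} k A) (hP : DefinedAtFold.{u} k P) {e : ℕ → Ordinal.{u}}
    (he : ReflectingChain k e) {x : Fin M → ZFSet.{u}} {ξ : Fin N → Ordinal.{u}}
    (hd : InDomain (e 0) x ξ) (hr : ∀ i ≤ k, A.RegularAt (e i) x ξ ∧
      ∀ α, A.val (e i) x ξ = some α → ∀ β < α, P.RegularAt (e i) x (ext β ξ)) :
    ∃ α, interp (e 0) A.toExpr x ξ = some α ∧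
      ∀ β < α, interp (e 0) P.toExpr x (ext β ξ) ≠ .undef := by
  obtain ⟨α, hα⟩ := hA.exists_val he hd fun i hi => (hr i hi).1
  have hα0 := hα 0 (Nat.zero_le k)
  exact ⟨α, hα0, fun β hβ => hP e he _ _ (hd.extO (hβ.trans (interp_ord_lt hd hα0)))
    fun i hi => (hr i hi).2 α (hα i hi) β hβ⟩

/-- The operator and the initial set of a term `T^∞(W)` are represented at the first three members
of a chain, by the same operator on `P(ℕ)`. -/
lemma DefinedAtFold.exists_represents {T : NMID (.term .set) (M + 1) N} {W : NMID (.term .set) M N}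
    (hT : DefinedAtFold.{u} k T) (hW : DefinedAtFold.{u} k W) {e : ℕ → Ordinal.{u}}
    (he : ReflectingChain (k + 2) e) {x : Fin M → ZFSet.{u}} {ξ : Fin N → Ordinal.{u}}
    (hd : InDomain (e 0) x ξ) (hr : ∀ i ≤ k + 2, (NMID.infty T W).RegularAt (e i) x ξ) :
    ∃ t w, ∀ j ≤ 2, Represents (e j) T.toExpr W.toExpr x ξ t w := by
  classical
  obtain ⟨w, hw⟩ := (hW.mono (Nat.le_add_right k 2)).exists_val he hd fun i hi => (hr i hi).1
  have hop : ∀ j ≤ 2, ∀ v ∈ Lset (e j), v ⊆ Ordinal.omega0.toZFSet →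
      ∃ s, interp (e j) T.toExpr (ext v x) ξ = some s ∧ v ⊆ s ∧ s ⊆ Ordinal.omega0.toZFSet := by
    intro j hj v hv hvω
    have hdj := (hd.mono (he.le (Nat.zero_le j) (by omega))).extS hv
    obtain ⟨s, hs⟩ := Option.ne_none_iff_exists'.1 <| hT (fun i => e (j + i))
      (he.shift (by omega)) _ _ hdj fun i hi => ((hr (j + i) (by omega)).2.2 v
        (Lset_mono (he.le (Nat.le_add_right j i) (by omega)) hv) hvω).1
    exact ⟨s, hs, ((hr j (by omega)).2.2 v hv hvω).2 s hs⟩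
  let t : ZFSet.{u} → ZFSet.{u} := fun v =>
    if h : ∃ s, interp (e 2) T.toExpr (ext v x) ξ = some s ∧ v ⊆ s ∧ s ⊆ Ordinal.omega0.toZFSet
      then h.choose else v
  refine ⟨t, w, fun j hj => ⟨fun v hv => ?_, (hr 0 (by omega)).2.1 w (hw 0 (by omega)),
    fun v hv hvω => ?_, hw j (by omega)⟩⟩
  · by_cases h : ∃ s, interp (e 2) T.toExpr (ext v x) ξ = some s ∧ v ⊆ s ∧
        s ⊆ Ordinal.omega0.toZFSet
    · simp only [t, dif_pos h]
      exact h.choose_spec.2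
    · simp only [t, dif_neg h]
      exact ⟨fun _ => id, hv⟩
  · obtain ⟨s, hs, hs'⟩ := hop j hj v hv hvω
    have hs2 : interp (e 2) T.toExpr (ext v x) ξ = some s := interp_mono_term
      (he.le hj (by omega)) ((hd.mono (he.le (Nat.zero_le j) (by omega))).extS hv) hs
    have h : ∃ s, interp (e 2) T.toExpr (ext v x) ξ = some s ∧ v ⊆ s ∧
        s ⊆ Ordinal.omega0.toZFSet := ⟨s, hs2, hs'⟩
    rw [hs]
    simp only [t, dif_pos h]
    exact hs2.symm.trans h.choose_spec.1

lemma exists_definedAtFold (E : NMID c M N) : ∃ k, DefinedAtFold.{u} k E := by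
  have join : ∀ {c₁ c₂ : Kind} {M₁ N₁ M₂ N₂ : ℕ} {E₁ : NMID c₁ M₁ N₁} {E₂ : NMID c₂ M₂ N₂},
      (∃ k, DefinedAtFold.{u} k E₁) → (∃ k, DefinedAtFold.{u} k E₂) →
      ∃ k, DefinedAtFold.{u} k E₁ ∧ DefinedAtFold.{u} k E₂ := fun ⟨k₁, h₁⟩ ⟨k₂, h₂⟩ =>
    ⟨max k₁ k₂, h₁.mono (le_max_left ..), h₂.mono (le_max_right ..)⟩
  induction E with
  | svar i => exact ⟨0, fun e he x ξ hd hr => Option.some_ne_none _⟩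
  | ovar j => exact ⟨0, fun e he x ξ hd hr => Option.some_ne_none _⟩
  | mem a b iha ihb =>
    obtain ⟨k, ha, hb⟩ := join iha ihb
    refine ⟨k, fun e he x ξ hd hr => ?_⟩
    obtain ⟨v, hv⟩ := ha.exists_val he hd fun i hi => (hr i hi).1
    obtain ⟨w, hw⟩ := hb.exists_val he hd fun i hi => (hr i hi).2
    exact (interp_mem (hv 0 (Nat.zero_le k)) (hw 0 (Nat.zero_le k))).trans_ne Truth.ofProp_ne_undef
  | eq a b iha ihb =>
    obtain ⟨k, ha, hb⟩ := join iha ihb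
    refine ⟨k, fun e he x ξ hd hr => ?_⟩
    obtain ⟨v, hv⟩ := ha.exists_val he hd fun i hi => (hr i hi).1
    obtain ⟨w, hw⟩ := hb.exists_val he hd fun i hi => (hr i hi).2
    exact (interp_eq (hv 0 (Nat.zero_le k)) (hw 0 (Nat.zero_le k))).trans_ne Truth.ofProp_ne_undef
  | dn a iha =>
    obtain ⟨k, ha⟩ := iha
    refine ⟨k, fun e he x ξ hd hr => ?_⟩
    obtain ⟨v, hv⟩ := ha.exists_val he hd hr
    exact (interp_dn_eq_top.2 ⟨v, hv 0 (Nat.zero_le k)⟩).trans_ne (by simp)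
  | and P Q ihP ihQ =>
    obtain ⟨k, hP, hQ⟩ := join ihP ihQ
    exact ⟨k, fun e he x ξ hd hr => (interp_and
      (Truth.eq_ofProp_of_ne_undef (hP e he x ξ hd fun i hi => (hr i hi).1))
      (Truth.eq_ofProp_of_ne_undef (hQ e he x ξ hd fun i hi => (hr i hi).2))).trans_ne
        Truth.ofProp_ne_undef⟩
  | or P Q ihP ihQ =>
    obtain ⟨k, hP, hQ⟩ := join ihP ihQ
    exact ⟨k, fun e he x ξ hd hr => (interp_or
      (Truth.eq_ofProp_of_ne_undef (hP e he x ξ hd fun i hi => (hr i hi).1))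
      (Truth.eq_ofProp_of_ne_undef (hQ e he x ξ hd fun i hi => (hr i hi).2))).trans_ne
        Truth.ofProp_ne_undef⟩
  | not P ihP =>
    obtain ⟨k, hP⟩ := ihP
    exact ⟨k, fun e he x ξ hd hr => (interp_not
      (Truth.eq_ofProp_of_ne_undef (hP e he x ξ hd hr))).trans_ne Truth.ofProp_ne_undef⟩
  | allS X P ihX ihP =>
    obtain ⟨k, hX, hP⟩ := join ihX ihP
    refine ⟨k, fun e he x ξ hd hr => ?_⟩
    obtain ⟨v, hv, hb⟩ := hX.body hP he hd hr
    exact (interp_allS hv fun y hy => Truth.eq_ofProp_of_ne_undef (hb y hy)).trans_ne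
      Truth.ofProp_ne_undef
  | exS X P ihX ihP =>
    obtain ⟨k, hX, hP⟩ := join ihX ihP
    refine ⟨k, fun e he x ξ hd hr => ?_⟩
    obtain ⟨v, hv, hb⟩ := hX.body hP he hd hr
    exact (interp_exS hv fun y hy => Truth.eq_ofProp_of_ne_undef (hb y hy)).trans_ne
      Truth.ofProp_ne_undef
  | allO A P ihA ihP =>
    obtain ⟨k, hA, hP⟩ := join ihA ihP
    refine ⟨k, fun e he x ξ hd hr => ?_⟩
    obtain ⟨v, hv, hb⟩ := hA.bodyOrd hP he hd hr
    exact (interp_allO hv fun y hy => Truth.eq_ofProp_of_ne_undef (hb y hy)).trans_ne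
      Truth.ofProp_ne_undef
  | exO A P ihA ihP =>
    obtain ⟨k, hA, hP⟩ := join ihA ihP
    refine ⟨k, fun e he x ξ hd hr => ?_⟩
    obtain ⟨v, hv, hb⟩ := hA.bodyOrd hP he hd hr
    exact (interp_exO hv fun y hy => Truth.eq_ofProp_of_ne_undef (hb y hy)).trans_ne
      Truth.ofProp_ne_undef
  | sep X P ihX ihP =>
    obtain ⟨k, hX, hP⟩ := join ihX ihP
    refine ⟨k + 1, fun e he x ξ hd hr => ?_⟩
    obtain ⟨v, hv, hb⟩ := (hX.mono (Nat.le_succ k)).body (hP.mono (Nat.le_succ k)) he hd hr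
    obtain ⟨h01, h0⟩ := he 0 (Nat.succ_pos k)
    exact Option.ne_none_iff_exists'.2 ⟨_, h0.sep_isDefined h01 hd hv hb⟩
  | stage A ihA =>
    obtain ⟨k, hA⟩ := ihA
    refine ⟨k, fun e he x ξ hd hr => ?_⟩
    obtain ⟨α, hα⟩ := hA.exists_val he hd hr
    exact Option.ne_none_iff_exists'.2 ⟨_, interp_stage (hα 0 (Nat.zero_le k))⟩
  | infty T W ihT ihW =>
    obtain ⟨k, hT, hW⟩ := join ihT ihW
    refine ⟨k + 2, fun e he x ξ hd hr => ?_⟩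
    obtain ⟨t, w, H⟩ := hT.exists_represents hW he hd hr
    obtain ⟨h01, h0⟩ := he 0 (by omega)
    obtain ⟨h12, h1⟩ := he 1 (by omega)
    exact Option.ne_none_iff_exists'.2 (h0.iterInfty_isDefined h01 h1 h12 hd
      (H 0 (by omega)) (H 1 (by omega)) (H 2 le_rfl))

end NMID

lemma KFoldReflecting.exists_chain {Λ : Set Ordinal.{u}} {k : ℕ} {η : Ordinal.{u}}
    (h : KFoldReflecting Λ k η) :
    ∃ e : ℕ → Ordinal.{u}, e 0 = η ∧ (∀ i ≤ k, e i ∈ Λ) ∧ ReflectingChain k e := by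
  obtain ⟨e, hmono, h0, hΛ, hdescr⟩ := h
  have hval : ∀ {i : ℕ} (hi : i < k + 1), e (Fin.ofNat (k + 1) i) = e ⟨i, hi⟩ := fun hi => by
    congr 1
    exact Fin.ext (Nat.mod_eq_of_lt hi)
  refine ⟨fun i => e (Fin.ofNat (k + 1) i), h0, fun i _ => hΛ _, fun i hi => ?_⟩
  beta_reduce
  rw [hval (Nat.lt_succ_of_lt hi), hval (Nat.succ_lt_succ hi)]
  have hlt : e ⟨i, Nat.lt_succ_of_lt hi⟩ < e ⟨i + 1, Nat.succ_lt_succ hi⟩ :=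
    hmono (Nat.lt_succ_self i)
  exact ⟨hlt, indescribable_of_descr hlt (hdescr ⟨i, hi⟩)⟩

end GDST

theorem mainTheorem2 (Λ : Set Ordinal.{u}) (hΛ : IsLowerSet Λ) (hne : Λ.Nonempty)
    (hrefl : ∀ k : ℕ, ∀ α ∈ Λ, ∃ η, α < η ∧ GDST.KFoldReflecting Λ k η)
    (M N : ℕ)
    (P : GDST.NMID .fml M N)
    (A : GDST.NMID (.term .ord) M N)
    (X : GDST.NMID (.term .set) M N)
    (x : Fin M → ZFSet.{u}) (ξ : Fin N → Ordinal.{u})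
    (hx : ∀ i, ∃ β ∈ Λ, x i ∈ GDST.Lset β) (hξ : ∀ j, ξ j ∈ Λ)
    (hP : P.Regular Λ x ξ) (hA : A.Regular Λ x ξ) (hX : X.Regular Λ x ξ) :
    ∃ η ∈ Λ, GDST.InDomain η x ξ ∧
      GDST.Kind.IsDefined _ (P.val η x ξ) ∧
      GDST.Kind.IsDefined _ (A.val η x ξ) ∧
      GDST.Kind.IsDefined _ (X.val η x ξ) := by
  obtain ⟨kP, hkP⟩ := P.exists_definedAtFold
  obtain ⟨kA, hkA⟩ := A.exists_definedAtFold
  obtain ⟨kX, hkX⟩ := X.exists_definedAtFold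
  choose β hβ hxβ using hx
  have : Nonempty Λ := hne.to_subtype
  obtain ⟨⟨α, hα⟩, hbound⟩ := Finite.exists_le (Sum.elim (fun i => (⟨β i, hβ i⟩ : Λ)) fun j =>
    ⟨ξ j, hξ j⟩)
  obtain ⟨η, hαη, hη⟩ := hrefl (max kP (max kA kX)) α hα
  obtain ⟨e, rfl, heΛ, he⟩ := hη.exists_chain
  have hd : GDST.InDomain (e 0) x ξ :=
    ⟨fun i => GDST.Lset_mono ((show β i ≤ α from hbound (.inl i)).trans hαη.le) (hxβ i),
      fun j => (show ξ j ≤ α from hbound (.inr j)).trans_lt hαη⟩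
  have hd' : ∀ i ≤ max kP (max kA kX), GDST.InDomain (e i) x ξ := fun i hi =>
    hd.mono (he.le (Nat.zero_le i) hi)
  exact ⟨e 0, heΛ 0 (Nat.zero_le _), hd,
    hkP.mono (le_max_left ..) e he x ξ hd fun i hi => hP _ (heΛ i hi) (hd' i hi),
    hkA.mono ((le_max_left ..).trans (le_max_right ..)) e he x ξ hd
      fun i hi => hA _ (heΛ i hi) (hd' i hi),
    hkX.mono ((le_max_right ..).trans (le_max_right ..)) e he x ξ hd
      fun i hi => hX _ (heΛ i hi) (hd' i hi)⟩
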